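/- Let $\mathsf A(\mathbb Z)$ be the quasi-local algebra of one spinless fermionic mode per site $x\in\mathbb Z$, with odd self-adjoint Majorana generators $X_x,Y_x$ ($X_x^2=Y_x^2=I$, all distinct generators anticommuting), $Z_x=-iX_xY_x$, and $\boxtimes$ the graded tensor product. For a homogeneous (even or odd) unitary $U$ of the one-mode algebra, the Forking automaton with local unitary $U$ is the nearest-neighbour fermionic cellular automaton (FCA) $\mathcal T$ obtained by applying the two commuting layers of Majorana swaps $O\mapsto S^\dagger OS$, $S=e^{\frac{\pi}{4}X\boxtimes Y}$, on the pairs $(2x,2x+1)$ and on the pairs $(2x+1,2x+2)$, followed by the cell-wise gates $O_x\mapsto U^\dagger O_xU$. Let $\Lambda_x=\{2x,2x+1\}$ and let $\Pi\in\mathsf A(\Lambda_0)$ be a (necessarily even) projection. Let $\mathsf A'_0$ be a graded matrix algebra and $\mathcal E_0:\mathsf A'_0\to\mathsf A(\Lambda_0)$ a graded $*$-isomorphism onto $\Pi\,\mathsf A(\Lambda_0)\,\Pi$, so that $\mathcal E_0(I)=\Pi$. An FCA $\mathcal S$ on $\mathbb Z$ with cell algebra $\mathsf A'_0$ is a $(2,\Pi)$-renormalisation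 of $\mathcal T$ if, for some such $\mathcal E_0$, one has $\mathcal T_w^2\circ\mathcal E=\mathcal E\circ\mathcal S_w$ with $\mathcal E=\boxtimes_x\mathcal E_0$, for all regular wrappings, i.e. for the automata $\mathcal T_w,\mathcal S_w$ with the same transition rules on the rings of $2m$, respectively $m$, sites, whenever wrapping creates no new overlaps between neighbourhoods of $\mathcal T^2$ or of $\mathcal S$. A $(2,\Pi)$-renormalisation is called non-trivial if $\Pi\neq I$, $\operatorname{rank}\Pi\ge 2$ (so $\mathsf A'_0\neq\mathbb C$), and $\mathcal T^2$ is not a cell-wise automorphism, possibly composed with a shift. Then the Forking automaton with local unitary $U$ admits a non-trivial $(2,\Pi)$-renormalisation for some $\Pi$ if and only if, up to a phase factor, $$U=\exp\!\Big[i\,\tfrac{(2n+1)\pi}{4}\,Z\Big]\ \text{ for some } n\in\mathbb Z,\qquad\text{or}\qquad U=\tfrac1{\sqrt2}(X\pm Y).$$ Moreover, write $P=S^\dagger\Pi S$ for the image of $\Pi$ under the Majorana swap of the tile $\Lambda_0$. For every such $U$, the automaton is $(2,\Pi)$-renormalised to the right shift $\tau_+$ ($\mathsf A'_x\to\mathsf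 A'_{x+1}$) of a chain of single fermionic modes when $P=P_R=\frac12(I\pm Z)\boxtimes I$, and to the left shift $\tau_-$ when $P=P_L=\frac12\,I\boxtimes(I\pm Z)$, for either choice of sign. -/

import Mathlib

open scoped Matrix

/-- The type of a cell: the `ℤ/2`-graded matrix algebra `M_{p|q}` with `p + q = dim`, in a homogeneous
matrix-unit basis whose `i`-th vector has parity `par i`.  As the grading of `|i⟩⟨j|` is
`par i + par j`, only differences of parities matter, and they are normalised by `par 0 = 0`. -/
structure Cell where
  dim : ℕ
  [neZero : NeZero dim]
  par : Fin dim → ZMod 2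
  par_zero : par 0 = 0

attribute [instance] Cell.neZero

/-- The matrix algebra underlying a cell. -/
abbrev CellAlg (C : Cell) : Type := Matrix (Fin C.dim) (Fin C.dim) ℂ

/-- `m` is a homogeneous element of degree `p` of the cell algebra. -/
def IsHomog (C : Cell) (p : ZMod 2) (m : CellAlg C) : Prop :=
  ∀ i j, m i j ≠ 0 → C.par i + C.par j = p

/-- The cell of one spinless fermionic mode, `M_{1|1}`. -/
def fermion : Cell where
  dim := 2
  par := fun i => (i.val : ZMod 2)
  par_zero := rfl

section Lattice

variable (C : Cell) (G : Type) [LinearOrder G]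

/-- Configurations of the lattice that differ from the reference configuration `0` in finitely many
sites. -/
abbrev Config : Type := G →₀ Fin C.dim

/-- The Hilbert space with orthonormal basis the configurations (a Fock space). -/
abbrev Fock : Type := lp (fun _ : Config C G => ℂ) 2

variable {C G}

/-- `σ` with the entry at `x` increased by `k` (cyclically). -/
noncomputable def bump (x : G) (k : Fin C.dim) (σ : Config C G) : Config C G :=
  σ.update x (σ x + k)

theorem bump_injective (x : G) (k : Fin C.dim) :
    Function.Injective (bump (C := C) x k) := by
  intro σ τ h
  ext1 y
  have h1 := DFunLike.congr_fun h y
  by_cases hy : y = x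
  · subst hy
    simpa [bump] using h1
  · simpa [bump, hy] using h1

/-- Total parity of the sites before `x` (Jordan-Wigner string). -/
noncomputable def stringPar (x : G) (σ : Config C G) : ZMod 2 :=
  ∑ y ∈ σ.support with y < x, C.par (σ y)

/-- `(-1)^p`. -/
def parSign (p : ZMod 2) : ℂ := if p = 0 then 1 else -1

theorem norm_parSign (p : ZMod 2) : ‖parSign p‖ = 1 := by
  unfold parSign; split_ifs <;> simp

/-- A bounded weight times a composition with an injection of the basis, as a bounded operator. -/
noncomputable def weightedComp {κ : Type} (w : κ → ℂ) (B : ℝ) (hB : 0 ≤ B) (hw : ∀ σ, ‖w σ‖ ≤ B)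
    (g : κ → κ) (hg : Function.Injective g) :
    lp (fun _ : κ => ℂ) 2 →L[ℂ] lp (fun _ : κ => ℂ) 2 :=
  have bound : ∀ (ψ : lp (fun _ : κ => ℂ) 2) (s : Finset κ),
      ∑ σ ∈ s, ‖w σ * ψ (g σ)‖ ^ (2 : ENNReal).toReal ≤ (B * ‖ψ‖) ^ (2 : ENNReal).toReal := by
    intro ψ s
    have h2 : (0 : ℝ) < (2 : ENNReal).toReal := by norm_num
    have h3 := lp.sum_rpow_le_norm_rpow h2 ψ (s.map ⟨g, hg⟩)
    rw [Finset.sum_map] at h3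
    rw [Real.mul_rpow hB (norm_nonneg _)]
    refine le_trans ?_ (mul_le_mul_of_nonneg_left h3 (by positivity))
    rw [Finset.mul_sum]
    refine Finset.sum_le_sum fun σ _ => ?_
    rw [norm_mul, Real.mul_rpow (norm_nonneg _) (norm_nonneg _)]
    exact mul_le_mul_of_nonneg_right
      (Real.rpow_le_rpow (norm_nonneg _) (hw σ) h2.le) (by positivity)
  LinearMap.mkContinuous
    { toFun := fun ψ => ⟨fun σ => w σ * ψ (g σ), memℓp_gen' (bound ψ)⟩
      map_add' := fun ψ φ => by
        ext σ
        exact mul_add (w σ) (ψ (g σ)) (φ (g σ))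
      map_smul' := fun c ψ => by
        ext σ
        simp [mul_left_comm] }
    B (fun ψ => lp.norm_le_of_forall_sum_le (by norm_num) (by positivity) (bound ψ))

theorem entry_norm_le (m : CellAlg C) (i j : Fin C.dim) :
    ‖m i j‖ ≤ ∑ a, ∑ b, ‖m a b‖ :=
  (Finset.single_le_sum (f := fun b => ‖m i b‖) (fun _ _ => norm_nonneg _)
    (Finset.mem_univ j)).trans
  (Finset.single_le_sum (f := fun a => ∑ b, ‖m a b‖)
    (fun _ _ => Finset.sum_nonneg fun _ _ => norm_nonneg _) (Finset.mem_univ i))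

/-- The element `m` of the algebra of the cell at `x`, as an operator on Fock space: `m` acts on the
entry at `x`, and its odd part carries the sign of the parity of the sites before `x`, so that
elements of different cells graded-commute.  See `cellOp_apply` for the formula. -/
noncomputable def cellOp (x : G) (m : CellAlg C) : Fock C G →L[ℂ] Fock C G :=
  ∑ k : Fin C.dim, weightedComp
    (fun σ => m (σ x) (σ x + k) *
      parSign ((C.par (σ x) + C.par (σ x + k)) * stringPar x σ))
    (∑ a, ∑ b, ‖m a b‖) (by positivity)
    (fun σ => by rw [norm_mul, norm_parSign, mul_one]; exact entry_norm_le m _ _)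
    (bump x k) (bump_injective x k)

theorem cellOp_apply (x : G) (m : CellAlg C) (ψ : Fock C G) (σ : Config C G) :
    cellOp x m ψ σ = ∑ j, m (σ x) j * parSign ((C.par (σ x) + C.par j) * stringPar x σ) *
      ψ (σ.update x j) := by
  rw [← Equiv.sum_comp (Equiv.addLeft (σ x))]
  simp only [cellOp, sum_apply]
  rw [lp.coeFn_sum, Finset.sum_apply]
  rfl

variable (C G)

/-- The quasi-local algebra `A(G)`: the norm closure of the `*`-algebra generated by the cell
algebras.  For finite `G` this is the graded tensor product of the cell algebras. -/
noncomputable abbrev QuasiLocal : Type :=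
  (StarAlgebra.adjoin ℂ
    {a : Fock C G →L[ℂ] Fock C G | ∃ x m, a = cellOp x m}).topologicalClosure

variable {C G}

/-- The element `m` of the cell at `x`, as an element of the quasi-local algebra. -/
noncomputable def cell (x : G) (m : CellAlg C) : QuasiLocal C G :=
  ⟨cellOp x m, StarSubalgebra.le_topologicalClosure _
    (StarAlgebra.subset_adjoin ℂ _ ⟨x, m, rfl⟩)⟩

section Local

variable {F : Type} [Fintype F] [LinearOrder F]

/-- The product `⊠_{y ∈ F} m y`, in the order of `F`, with the factor `y` placed at the site `s y`. -/
noncomputable def boxProd (s : F → G) (m : F → CellAlg C) : QuasiLocal C G :=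
  ((Finset.univ.sort (fun a b : F => a ≤ b)).map fun y => cell (s y) (m y)).prod

/-- An element of the algebra `A(F)` of a finite ordered family `F` of cells, given by its
coefficients in the basis `⊠_{y ∈ F} |σ y⟩⟨τ y|`. -/
abbrev LocOp (C : Cell) (F : Type) : Type := Matrix (F → Fin C.dim) (F → Fin C.dim) ℂ

/-- The local operator `c` placed on the sites `s y`, `y ∈ F`, of the lattice. -/
noncomputable def LocOp.place (c : LocOp C F) (s : F → G) : QuasiLocal C G :=
  ∑ σ : F → Fin C.dim, ∑ τ : F → Fin C.dim,
    c σ τ • boxProd s (fun y => Matrix.single (σ y) (τ y) 1)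

/-- `c` is homogeneous of degree `p`. -/
def LocOp.IsHomog (p : ZMod 2) (c : LocOp C F) : Prop :=
  ∀ σ τ, c σ τ ≠ 0 → ∑ y, (C.par (σ y) + C.par (τ y)) = p

end Local

end Lattice

/-- A fermionic cellular automaton on `ℤ` with cell `C` and a finite neighbourhood scheme: a
`*`-automorphism of the quasi-local algebra that maps the element `m` of the cell at `x` to an element
`rule m` of the cells `x + scheme` (locality), the same one for all `x` (translation invariance), and
that respects the grading.  `rule` is the transition rule. -/
structure FCA (C : Cell) where
  scheme : Finset ℤ
  rule : CellAlg C → LocOp C scheme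
  aut : QuasiLocal C ℤ ≃⋆ₐ[ℂ] QuasiLocal C ℤ
  aut_cell : ∀ (x : ℤ) (m : CellAlg C), aut (cell x m) = (rule m).place fun y => x + (y : ℤ)
  graded : ∀ (p : ZMod 2) (m : CellAlg C), IsHomog C p m → (rule m).IsHomog p

/-- The image of `x` in the ring of `n` sites. -/
def ringSite (n : ℕ) [NeZero n] (x : ℤ) : Fin n :=
  ⟨(x % n).toNat, by
    have hn : (0 : ℤ) < n := by exact_mod_cast Nat.pos_of_ne_zero (NeZero.ne n)
    have h1 := Int.emod_nonneg x hn.ne'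
    have h2 := Int.emod_lt_of_pos x hn
    omega⟩

/-- `Tw` is the wrapping of `T` on the ring of `n` sites: it has the same transition rule. -/
def IsWrapping {C : Cell} (T : FCA C) (n : ℕ) [NeZero n]
    (Tw : QuasiLocal C (Fin n) ≃⋆ₐ[ℂ] QuasiLocal C (Fin n)) : Prop :=
  ∀ (x : ℤ) (m : CellAlg C),
    Tw (cell (ringSite n x) m) = (T.rule m).place fun y => ringSite n (x + (y : ℤ))

/-- The neighbourhood `x + 𝒩` of `x`. -/
def nbhd (𝒩 : Finset ℤ) (x : ℤ) : Set ℤ := {z | ∃ y ∈ 𝒩, z = x + y}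

/-- The neighbourhood scheme of `N` iterations, `𝒩 + ⋯ + 𝒩`. -/
def iterScheme (𝒩 : Finset ℤ) : ℕ → Finset ℤ
  | 0 => {0}
  | N + 1 => Finset.image₂ (fun a b => a + b) (iterScheme 𝒩 N) 𝒩

/-- The ring of `n` sites is a regular wrapping for the neighbourhood scheme `𝒩`: wrapping introduces
no new overlaps between neighbourhoods. -/
def IsRegularWrapping (𝒩 : Finset ℤ) (n : ℕ) [NeZero n] : Prop :=
  ∀ x y : ℤ, (nbhd 𝒩 x ∩ nbhd 𝒩 y).Nonempty →
    {z | ringSite n z ∈ ringSite n '' nbhd 𝒩 x ∩ ringSite n '' nbhd 𝒩 y} ∩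
      (nbhd 𝒩 x ∪ nbhd 𝒩 y) = nbhd 𝒩 x ∩ nbhd 𝒩 y

/-- The sites of the tile `[0, N-1]` of `ℤ`. -/
def tileSite (N : ℕ) (j : Fin N) : ℤ := (j.val : ℤ)

/-- The sites `N x, …, N x + N - 1` of the `x`-th tile of the ring of `m * N` sites. -/
def ringTileSite (m N : ℕ) (x : Fin m) (j : Fin N) : Fin (m * N) := finProdFinEquiv (x, j)

/-- An isometry `A'₀ → A(Λ₀)` from the coarse-grained cell to the tile `Λ₀ = [0, N-1]`: a graded
(in general not unital) `*`-isomorphism onto the corner `Π A(Λ₀) Π`, where `Π` is the image of the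
identity. -/
structure IsTileIsometry {C C' : Cell} {N : ℕ} (e : CellAlg C' →ₗ[ℂ] LocOp C (Fin N)) : Prop where
  map_mul : ∀ a b, (e (a * b)).place (tileSite N) = (e a).place (tileSite N) * (e b).place (tileSite N)
  map_star : ∀ a, (e aᴴ).place (tileSite N) = star ((e a).place (tileSite N))
  graded : ∀ p a, IsHomog C' p a → (e a).IsHomog p
  injective : ∀ a, (e a).place (tileSite N) = 0 → a = 0
  onto : ∀ c : LocOp C (Fin N), ∃ a,
    (e 1).place (tileSite N) * c.place (tileSite N) * (e 1).place (tileSite N) = (e a).place (tileSite N)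

/-- `S` is an `(N, Π)`-renormalisation of `T`: for some isometry `e : A'₀ → A(Λ₀)` with `e 1 = Π`, and
for all regular wrappings, the wrapped automata satisfy `Tw ^ N ∘ E = E ∘ Sw`, where
`E = ⊠_x e` maps the algebra of the ring of `m` coarse cells to that of the ring of `m * N` cells. -/
def IsRenormalisation {C C' : Cell} (T : FCA C) (S : FCA C') (N : ℕ) [NeZero N]
    (P : QuasiLocal C ℤ) : Prop :=
  ∃ e : CellAlg C' →ₗ[ℂ] LocOp C (Fin N), IsTileIsometry e ∧ (e 1).place (tileSite N) = P ∧
    ∀ (m : ℕ) [NeZero m], IsRegularWrapping (iterScheme T.scheme N) (m * N) →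
      IsRegularWrapping S.scheme m →
      ∃ (Tw : QuasiLocal C (Fin (m * N)) ≃⋆ₐ[ℂ] QuasiLocal C (Fin (m * N)))
        (Sw : QuasiLocal C' (Fin m) ≃⋆ₐ[ℂ] QuasiLocal C' (Fin m))
        (E : QuasiLocal C' (Fin m) →ₗ[ℂ] QuasiLocal C (Fin (m * N))),
        IsWrapping T (m * N) Tw ∧ IsWrapping S m Sw ∧
        (∀ M : Fin m → CellAlg C', E (boxProd id M) =
          ((Finset.univ.sort (fun a b : Fin m => a ≤ b)).map
            fun x => (e (M x)).place (ringTileSite m N x)).prod) ∧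
        ∀ a, (⇑Tw)^[N] (E a) = E (Sw a)

/-- `S` is the shift by `z` cells, `A_x → A_{x+z}`. -/
def IsShift {C : Cell} (S : FCA C) (z : ℤ) : Prop :=
  ∀ x m, S.aut (cell x m) = cell (x + z) m

/-- `T ^ N` is trivial: a cell-wise transformation, possibly followed by a shift. -/
def IsTrivialAfter {C : Cell} (T : FCA C) (N : ℕ) : Prop :=
  ∃ z : ℤ, ∀ x m, ∃ m', (⇑T.aut)^[N] (cell x m) = cell (x + z) m'

/-- `T` admits a non-trivial `(N, Π)`-renormalisation for some `Π`: `Π` is not the identity, the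
coarse-grained algebra `A'₀` is not the algebra of scalars, and `T ^ N` is not trivial. -/
def AdmitsNontrivialRenormalisation {C : Cell} (T : FCA C) (N : ℕ) [NeZero N] : Prop :=
  ¬ IsTrivialAfter T N ∧ ∃ (C' : Cell) (S : FCA C') (P : QuasiLocal C ℤ),
    2 ≤ C'.dim ∧ P ≠ 1 ∧ IsRenormalisation T S N P

/-! ### The Forking automata -/

/-- The Majorana mode generators of a cell. -/
def majX : CellAlg fermion := (!![0, 1; 1, 0] : Matrix (Fin 2) (Fin 2) ℂ)
/-- The Majorana mode generators of a cell. -/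
def majY : CellAlg fermion := (!![0, -Complex.I; Complex.I, 0] : Matrix (Fin 2) (Fin 2) ℂ)
/-- `Z = -i X Y`. -/
def majZ : CellAlg fermion := (!![1, 0; 0, -1] : Matrix (Fin 2) (Fin 2) ℂ)

/-- The Majorana swap `exp (π/4 X_x ⊠ Y_{x+1})`. -/
noncomputable def majSwap (x : ℤ) : QuasiLocal fermion ℤ :=
  NormedSpace.exp (((Real.pi / 4 : ℝ) : ℂ) • (cell x majX * cell (x + 1) majY))

/-- `L` is the layer of the Majorana swap gates `O ↦ S† O S` on the pairs `(2x + r, 2x + r + 1)`. -/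
def IsMajSwapLayer (r : ℤ) (L : QuasiLocal fermion ℤ ≃⋆ₐ[ℂ] QuasiLocal fermion ℤ) : Prop :=
  ∀ (x : ℤ) (m : CellAlg fermion),
    L (cell (2 * x + r) m) =
      star (majSwap (2 * x + r)) * cell (2 * x + r) m * majSwap (2 * x + r) ∧
    L (cell (2 * x + r + 1) m) =
      star (majSwap (2 * x + r)) * cell (2 * x + r + 1) m * majSwap (2 * x + r)

/-- `L` is the layer of cell-wise gates `O ↦ U† O U`. -/
def IsCellwiseLayer (U : CellAlg fermion)
    (L : QuasiLocal fermion ℤ ≃⋆ₐ[ℂ] QuasiLocal fermion ℤ) : Prop :=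
  ∀ (x : ℤ) (m : CellAlg fermion), L (cell x m) = cell x (Uᴴ * m * U)

/-- `T` is the Forking automaton with local unitary `U`: the nearest-neighbour automaton made of the
layers of Majorana swaps on the pairs `(2x, 2x+1)` and on the pairs `(2x+1, 2x+2)`, followed by the
cell-wise gates `U`. -/
def IsForking (U : CellAlg fermion) (T : FCA fermion) : Prop :=
  T.scheme = {-1, 0, 1} ∧
  ∃ L₀ L₁ L : QuasiLocal fermion ℤ ≃⋆ₐ[ℂ] QuasiLocal fermion ℤ,
    IsMajSwapLayer 0 L₀ ∧ IsMajSwapLayer 1 L₁ ∧ IsCellwiseLayer U L ∧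
    ∀ a, T.aut a = L (L₁ (L₀ a))

/-- `U` is, up to a phase, `exp (i (2n+1) π/4 Z)` or `(X ± Y)/√2`. -/
def IsSpecialUnitary (U : CellAlg fermion) : Prop :=
  ∃ ζ : ℂ, ‖ζ‖ = 1 ∧
    ((∃ n : ℤ, U = ζ • NormedSpace.exp
        ((Complex.I * ((2 * n + 1) * (Real.pi : ℂ) / 4)) • majZ)) ∨
      U = ζ • ((1 / (Real.sqrt 2 : ℂ)) • (majX + majY)) ∨
      U = ζ • ((1 / (Real.sqrt 2 : ℂ)) • (majX - majY)))

/-- The projection `½ (I ± Z)` at the site `x`, with the sign `u`. -/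
noncomputable def projZ (u : ℤˣ) (x : ℤ) : QuasiLocal fermion ℤ :=
  cell x ((1 / 2 : ℂ) • (1 + ((u : ℤ) : ℂ) • majZ))

/-- The projection `Π` of the tile `{0, 1}` with `S† Π S = P`, where `S` is the Majorana swap of the
tile. -/
noncomputable def unswap (P : QuasiLocal fermion ℤ) : QuasiLocal fermion ℤ :=
  majSwap 0 * P * star (majSwap 0)

/-!
Write `X_x`, `Y_x` for the Majorana generators.  Conjugation by the homogeneous unitary `U` acts on
the real plane spanned by `X` and `Y` as an orthogonal map, `X ↦ a X + b Y` and
`Y ↦ s (b X - a Y)` with `a² + b² = 1` and `s = ±1`; the listed unitaries are exactly those with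
`a = 0` (`exists_orthogonal_action`).  The two layers of swaps send `X_x` to `Y_{x+1}` and
`Y_x` to `X_{x-1}`, up to signs, so the Forking automaton is a quantum walk of free Majorana
generators, in which the gate decides how much of a generator turns around at each step
(`IsForking.aut_gen`).

*Necessity.*  If `b = 0`, every generator turns around at each step, and two steps are cell-wise
(`IsForking.isTrivialAfter`).  Suppose `a b ≠ 0` and let a renormalisation with isometry `e` be
given.  On a large ring the isometry maps `1` to the product `Q` of the tile projections
`P = e 1`, so the intertwining relation says that the two-step map `W` of the wrapped automaton fixes `Q`.
Consequently `z ↦ tr (Q z)` is invariant under `W`, where `tr` is the trace of left multiplication;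
it is also a product over the tiles.  Testing this invariance on suitable products of generators
gives algebraic relations between the coefficients of `P` in the monomials of its four generators
(`tileCoeff_relations`), and `a b ≠ 0` makes them strong enough that the even part of the corner
`P A P` is `ℂ P` (`exists_smul_of_tileCoeff_relations`); positivity enters through the
nonvanishing of the constant coefficient (`tileCoeff_one_ne_zero`).  Since the even part of a
graded matrix algebra with at least two basis vectors is not one-dimensional, the coarse cell is
`ℂ` (`IsTileIsometry.dim_lt_two`).

*Sufficiency.*  If `a = 0`, the `X`s only move right and the `Y`s only move left, up to signs.
For `ν² = -1` the generators `h₀`, `h₁` of one type in a tile define the pairing projection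
`(1 + ν h₀ h₁) / 2`.  Both generators of a tile move together to the neighbouring tile in two
steps, so the product of the pairing projections is fixed.  The two generators of the other type
commute with `h₀ h₁`, and the pairing projection times the algebra they generate is a copy of the
one-mode algebra (`isTileIsometry_pairEmb`), on which two steps act as a shift
(`isRenormalisation_pairProj`).  The swap of the tile carries `(1 ± Z) / 2` on one of its sites to a
pairing projection (`unswap_projZ`).

Three technical tools are used throughout.  The algebra of a ring of `n` modes is generated by `2 n`
anticommuting involutions and has dimension at least `4 ^ n`, hence it has the universal property
of a Clifford algebra (`IsClifford.exists_algHom`); this constructs the wrapped automata.  A local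
operator is determined by its placement at distinct sites (`LocOp.place_injective`), which
makes a transition rule readable from the automaton.  Finally, the shift on the infinite chain is
conjugation by the translation of the configurations.
-/

/-! ### Cells of the lattice as operators on Fock space -/

section FockSpace

variable {C : Cell} {G : Type} [LinearOrder G]

theorem parSign_add (p q : ZMod 2) : parSign (p + q) = parSign p * parSign q := by
  revert p q
  have h : ∀ p q : ZMod 2, (p = 0 ∨ p = 1) ∧ (q = 0 ∨ q = 1) := by decide
  intro p q
  obtain ⟨rfl | rfl, rfl | rfl⟩ := h p q <;> simp [parSign, show (1 + 1 : ZMod 2) = 0 from rfl]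

theorem parSign_ne_zero (p : ZMod 2) : parSign p ≠ 0 := by
  unfold parSign; split_ifs <;> simp

theorem star_parSign (p : ZMod 2) : star (parSign p) = parSign p := by
  unfold parSign; split_ifs <;> simp

/-- Changing the entry at `x` changes the Jordan-Wigner string at every later site. -/
theorem stringPar_update (x y : G) (j : Fin C.dim) (σ : Config C G) :
    stringPar y (σ.update x j) =
      stringPar y σ + if x < y then C.par (σ x) + C.par j else 0 := by
  have key : ∀ (τ : Config C G) (s : Finset G), τ.support ⊆ s →
      stringPar y τ = ∑ z ∈ s, if z < y then C.par (τ z) else 0 := by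
    intro τ s hs
    rw [stringPar, Finset.sum_filter]
    refine Finset.sum_subset hs fun z _ hz => ?_
    rw [Finsupp.notMem_support_iff.mp hz, C.par_zero, ite_self]
  have hx : x ∈ insert x (σ.support ∪ (σ.update x j).support) := Finset.mem_insert_self _ _
  rw [key σ (insert x (σ.support ∪ (σ.update x j).support)) (fun z hz => by simp_all),
    key (σ.update x j) (insert x (σ.support ∪ (σ.update x j).support)) (fun z hz => by simp_all),
    ← Finset.add_sum_erase _ _ hx, ← Finset.add_sum_erase _ _ hx]
  have h2 : ∑ z ∈ (insert x (σ.support ∪ (σ.update x j).support)).erase x,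
      (if z < y then C.par ((σ.update x j) z) else 0) =
      ∑ z ∈ (insert x (σ.support ∪ (σ.update x j).support)).erase x,
      (if z < y then C.par (σ z) else 0) :=
    Finset.sum_congr rfl fun z hz => by
      rw [Finsupp.update_apply, if_neg (Finset.ne_of_mem_erase hz)]
  rw [h2, Finsupp.update_apply, if_pos rfl]
  split_ifs
  · have := CharTwo.add_self_eq_zero (C.par (σ x))
    linear_combination this.symm
  · simp

theorem stringPar_update_self (x : G) (j : Fin C.dim) (σ : Config C G) :
    stringPar x (σ.update x j) = stringPar x σ := by
  simp [stringPar_update]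

theorem cellOp_mul (x : G) (m m' : CellAlg C) :
    cellOp x (m * m') = cellOp x m * cellOp x m' := by
  ext ψ σ
  change cellOp x (m * m') ψ σ = cellOp x m (cellOp x m' ψ) σ
  rw [cellOp_apply, cellOp_apply]
  simp only [cellOp_apply, stringPar_update_self, Finsupp.update_apply, if_true,
    Finsupp.update_idem, Matrix.mul_apply, Finset.sum_mul, Finset.mul_sum]
  rw [Finset.sum_comm]
  refine Finset.sum_congr rfl fun j _ => Finset.sum_congr rfl fun k _ => ?_
  have h : parSign ((C.par (σ x) + C.par k) * stringPar x σ) =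
      parSign ((C.par (σ x) + C.par j) * stringPar x σ) *
        parSign ((C.par j + C.par k) * stringPar x σ) := by
    rw [← parSign_add]
    congr 1
    have := CharTwo.add_self_eq_zero (C.par j)
    linear_combination -stringPar x σ * this
  rw [h]; ring

theorem cellOp_one (x : G) : cellOp x (1 : CellAlg C) = 1 := by
  ext ψ σ
  rw [cellOp_apply, Finset.sum_eq_single (σ x)]
  · simp [CharTwo.add_self_eq_zero, parSign]
  · intro j _ hj
    simp [Matrix.one_apply_ne hj.symm]
  · simp

theorem cellOp_add (x : G) (m m' : CellAlg C) :
    cellOp x (m + m') = cellOp x m + cellOp x m' := by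
  ext ψ σ
  simp [cellOp_apply, add_mul, Finset.sum_add_distrib]

theorem cellOp_smul (x : G) (c : ℂ) (m : CellAlg C) :
    cellOp x (c • m) = c • cellOp x m := by
  ext ψ σ
  simp [cellOp_apply, mul_assoc, Finset.mul_sum]

/-- The basis vector of a configuration. -/
noncomputable def ket (σ : Config C G) : Fock C G := lp.single 2 σ (1 : ℂ)

theorem ket_apply (σ τ : Config C G) :
    ket σ τ = if τ = σ then 1 else 0 := by
  rw [ket, lp.single_apply, Pi.single_apply]

/-- Bounded operators are determined by their matrix entries in the basis of configurations. -/
theorem op_ext {A B : Fock C G →L[ℂ] Fock C G} (h : ∀ σ τ, A (ket τ) σ = B (ket τ) σ) : A = B := by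
  have hk : ∀ τ, A (ket τ) = B (ket τ) := fun τ => by
    ext σ; exact h σ τ
  ext1 ψ
  have h1 := lp.hasSum_single (E := fun _ : Config C G => ℂ) (p := 2) (by simp) ψ
  have h2 : ∀ τ, lp.single (E := fun _ : Config C G => ℂ) 2 τ (ψ τ) = ψ τ • ket τ := fun τ => by
    ext σ
    rw [lp.coeFn_smul, Pi.smul_apply, ket, lp.single_apply, lp.single_apply, Pi.single_apply,
      Pi.single_apply]
    split_ifs <;> simp
  simp only [h2] at h1
  have hA := A.hasSum h1
  have hB := B.hasSum h1
  simp only [map_smul, hk] at hA hB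
  exact hA.unique hB

theorem star_apply_ket (A : Fock C G →L[ℂ] Fock C G) (σ τ : Config C G) :
    (star A) (ket τ) σ = star (A (ket σ) τ) := by
  have e1 : inner ℂ (ket σ) ((star A) (ket τ)) = (star A) (ket τ) σ := by
    rw [ket, lp.inner_single_left]; simp
  have e2 : inner ℂ (ket τ) (A (ket σ)) = A (ket σ) τ := by
    rw [ket, lp.inner_single_left]; simp
  rw [← e1, ← e2, ContinuousLinearMap.star_eq_adjoint, ContinuousLinearMap.adjoint_inner_right,
    ← inner_conj_symm]
  rfl

theorem cellOp_conjTranspose (x : G) (m : CellAlg C) :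
    cellOp x mᴴ = star (cellOp x m) := by
  refine op_ext fun σ τ => ?_
  rw [star_apply_ket, cellOp_apply, cellOp_apply, star_sum]
  simp only [ket_apply, mul_ite, mul_one, mul_zero, apply_ite star, star_zero, star_mul', star_parSign,
    Matrix.conjTranspose_apply]
  by_cases hστ : ∀ y, y ≠ x → σ y = τ y
  · have e1 : ∀ j, σ.update x j = τ ↔ j = τ x := fun j => by
      constructor
      · intro h; rw [← h]; simp [Finsupp.update_apply]
      · rintro rfl; ext1 y; rw [Finsupp.update_apply]
        split_ifs with hy
        · rw [hy]
        · exact hστ y hy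
    have e2 : ∀ j, τ.update x j = σ ↔ j = σ x := fun j => by
      constructor
      · intro h; rw [← h]; simp [Finsupp.update_apply]
      · rintro rfl; ext1 y; rw [Finsupp.update_apply]
        split_ifs with hy
        · rw [hy]
        · exact (hστ y hy).symm
    have e3 : stringPar x σ = stringPar x τ := by
      rw [← (e1 (τ x)).mpr rfl, stringPar_update_self]
    simp only [e1, e2, Finset.sum_ite_eq', Finset.mem_univ, if_true, e3]
    rw [add_comm (C.par (σ x))]
  · push Not at hστ
    obtain ⟨y, hy, hne⟩ := hστ
    rw [Finset.sum_eq_zero, Finset.sum_eq_zero]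
    · intro j _
      rw [if_neg]
      intro h
      apply hne
      rw [← h, Finsupp.update_apply, if_neg hy]
    · intro j _
      rw [if_neg]
      intro h
      apply hne
      rw [← h, Finsupp.update_apply, if_neg hy]

/-- Homogeneous elements of different cells commute up to the sign of the product of their degrees. -/
theorem cellOp_comm {x y : G} (hxy : x ≠ y) {p q : ZMod 2} {m m' : CellAlg C}
    (hm : IsHomog C p m) (hm' : IsHomog C q m') :
    cellOp x m * cellOp y m' = parSign (p * q) • (cellOp y m' * cellOp x m) := by
  wlog hlt : x < y generalizing x y p q m m'
  · rw [this hxy.symm hm' hm (lt_of_le_of_ne (not_lt.mp hlt) hxy.symm), smul_smul, mul_comm q p,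
      ← parSign_add, CharTwo.add_self_eq_zero]
    simp [parSign]
  ext ψ σ
  change cellOp x m (cellOp y m' ψ) σ = parSign (p * q) * cellOp y m' (cellOp x m ψ) σ
  rw [cellOp_apply, cellOp_apply]
  simp only [cellOp_apply, stringPar_update, Finsupp.update_apply, if_neg hxy, if_neg hxy.symm,
    if_pos hlt, if_neg hlt.asymm, Finset.mul_sum, add_zero]
  rw [Finset.sum_comm]
  refine Finset.sum_congr rfl fun k _ => Finset.sum_congr rfl fun j _ => ?_
  by_cases h1 : m (σ x) j = 0
  · simp [h1]
  by_cases h2 : m' (σ y) k = 0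
  · simp [h2]
  have e1 := hm _ _ h1
  have e2 := hm' _ _ h2
  have e3 : (σ.update y k).update x j = (σ.update x j).update y k := by
    ext1 z
    simp only [Finsupp.update_apply]
    split_ifs with ha hb <;> simp_all
  rw [e1, e2, e3, mul_add, parSign_add, mul_comm p q]
  ring

end FockSpace

section CellMaps

variable {C : Cell} {G : Type} [LinearOrder G]

theorem cell_mul (x : G) (m m' : CellAlg C) : cell x (m * m') = cell x m * cell x m' :=
  Subtype.ext (cellOp_mul x m m')

theorem cell_one (x : G) : cell x (1 : CellAlg C) = 1 := Subtype.ext (cellOp_one x)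

theorem cell_add (x : G) (m m' : CellAlg C) : cell x (m + m') = cell x m + cell x m' :=
  Subtype.ext (cellOp_add x m m')

theorem cell_smul (x : G) (c : ℂ) (m : CellAlg C) : cell x (c • m) = c • cell x m :=
  Subtype.ext (cellOp_smul x c m)

theorem cell_star (x : G) (m : CellAlg C) : cell x mᴴ = star (cell x m) :=
  Subtype.ext (cellOp_conjTranspose x m)

theorem cell_comm {x y : G} (hxy : x ≠ y) {p q : ZMod 2} {m m' : CellAlg C}
    (hm : IsHomog C p m) (hm' : IsHomog C q m') :
    cell x m * cell y m' = parSign (p * q) • (cell y m' * cell x m) :=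
  Subtype.ext (cellOp_comm hxy hm hm')

/-- The cell at `x`, embedded into the quasi-local algebra as a linear map. -/
noncomputable def cellLin (C : Cell) (x : G) : CellAlg C →ₗ[ℂ] QuasiLocal C G where
  toFun := cell x
  map_add' := cell_add x
  map_smul' := cell_smul x

@[simp] theorem cellLin_apply (x : G) (m : CellAlg C) : cellLin C x m = cell x m := rfl

end CellMaps

/-! ### Local operators and their placement on the lattice -/

section ListProducts

variable {F M : Type*} [Monoid M]

theorem List.prod_map_eq_single {l : List F} (hl : l.Nodup) {z : F} (hz : z ∈ l) {f : F → M}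
    (hf : ∀ w, w ≠ z → f w = 1) : (l.map f).prod = f z := by
  induction l with
  | nil => simp at hz
  | cons a l ih =>
    rw [List.nodup_cons] at hl
    rw [List.map_cons, List.prod_cons]
    by_cases ha : a = z
    · subst ha
      rw [List.prod_eq_one, mul_one]
      intro x hx
      obtain ⟨w, hw, rfl⟩ := List.mem_map.mp hx
      exact hf w (by rintro rfl; exact hl.1 hw)
    · rw [hf a ha, one_mul]
      exact ih hl.2 ((List.mem_cons.mp hz).resolve_left (Ne.symm ha))

theorem List.prod_map_eq_pair [LinearOrder F] {l : List F} (hl : l.Pairwise (· < ·)) {y z : F}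
    (hyz : y < z) (hy : y ∈ l) (hz : z ∈ l) {f : F → M} (hf : ∀ w, w ≠ y → w ≠ z → f w = 1) :
    (l.map f).prod = f y * f z := by
  induction l with
  | nil => simp at hz
  | cons a l ih =>
    rw [List.pairwise_cons] at hl
    rw [List.map_cons, List.prod_cons]
    by_cases ha : a = y
    · subst ha
      have hz' := (List.mem_cons.mp hz).resolve_left hyz.ne'
      congr 1
      rw [← List.map_congr_left (f := fun w => if w = z then f w else 1)]
      · rw [List.prod_map_eq_single (hl.2.imp fun h => h.ne) hz' fun w hw => if_neg hw, if_pos rfl]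
      · intro w hw
        split_ifs with h
        · rfl
        · exact (hf w (hl.1 w hw).ne' h).symm
    · have hy' := (List.mem_cons.mp hy).resolve_left (Ne.symm ha)
      have hz' := (List.mem_cons.mp hz).resolve_left (hyz.trans' (hl.1 y hy')).ne'
      rw [hf a ha (hyz.trans' (hl.1 y hy')).ne, one_mul]
      exact ih hl.2 hy' hz'

theorem List.prod_map_mul_of_commute {l : List F} {f g : F → M}
    (h : ∀ x ∈ l, ∀ y ∈ l, Commute (g x) (f y)) :
    (l.map fun x => f x * g x).prod = (l.map f).prod * (l.map g).prod := by
  induction l with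
  | nil => simp
  | cons a l ih =>
    have hc : Commute (g a) (l.map f).prod := by
      refine Commute.list_prod_right _ _ fun x hx => ?_
      obtain ⟨y, hy, rfl⟩ := List.mem_map.mp hx
      exact h a List.mem_cons_self y (List.mem_cons_of_mem _ hy)
    simp only [List.map_cons, List.prod_cons]
    rw [ih fun x hx y hy => h x (List.mem_cons_of_mem _ hx) y (List.mem_cons_of_mem _ hy)]
    rw [mul_assoc, ← mul_assoc (g a), hc.eq]
    simp only [mul_assoc]

end ListProducts

section Overwrite

variable {C : Cell} {G : Type} [LinearOrder G] {F : Type}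

/-- `σ` with the entries at the sites `s y`, for `y` in the list, replaced by `τ y`. -/
noncomputable def overwrite (s : F → G) (τ : F → Fin C.dim) :
    List F → Config C G → Config C G
  | [], ρ => ρ
  | y :: l, ρ => overwrite s τ l (ρ.update (s y) (τ y))

theorem overwrite_apply_of_notMem (s : F → G) (τ : F → Fin C.dim) (l : List F)
    (ρ : Config C G) (x : G) (hx : ∀ y ∈ l, s y ≠ x) : overwrite s τ l ρ x = ρ x := by
  induction l generalizing ρ with
  | nil => rfl
  | cons a l ih =>
    rw [overwrite, ih _ fun y hy => hx y (List.mem_cons_of_mem _ hy), Finsupp.update_apply,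
      if_neg (hx a List.mem_cons_self).symm]

theorem overwrite_apply {s : F → G} (hs : Function.Injective s) (τ : F → Fin C.dim) {l : List F}
    (hl : l.Nodup) (ρ : Config C G) {y : F} (hy : y ∈ l) : overwrite s τ l ρ (s y) = τ y := by
  induction l generalizing ρ with
  | nil => simp at hy
  | cons a l ih =>
    rw [List.nodup_cons] at hl
    rw [overwrite]
    by_cases h : y ∈ l
    · exact ih hl.2 _ h
    · obtain rfl := (List.mem_cons.mp hy).resolve_right h
      rw [overwrite_apply_of_notMem, Finsupp.update_apply, if_pos rfl]
      intro z hz hzy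
      exact h (hs hzy ▸ hz)

end Overwrite

section Placing

variable {C : Cell} {G : Type} [LinearOrder G] {F : Type} [Fintype F] [LinearOrder F]

/-- The product `⊠ M y` as a multilinear map of its factors. -/
noncomputable def boxProdMulti (C : Cell) (s : F → G) :
    MultilinearMap ℂ (fun _ : F => CellAlg C) (QuasiLocal C G) where
  toFun := boxProd s
  map_update_add' {inst} M y v w := by
    have key : ∀ l : List F, l.Nodup → y ∈ l →
        (l.map fun z => cell (s z) (Function.update M y (v + w) z)).prod =
        (l.map fun z => cell (s z) (Function.update M y v z)).prod +
        (l.map fun z => cell (s z) (Function.update M y w z)).prod := by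
      intro l
      induction l with
      | nil => simp
      | cons a l ih =>
        intro hl hy
        rw [List.nodup_cons] at hl
        simp only [List.map_cons, List.prod_cons]
        by_cases ha : a = y
        · subst ha
          have e : ∀ u : CellAlg C, (l.map fun z => cell (s z) (Function.update M a u z)) =
              l.map fun z => cell (s z) (M z) := fun u =>
            List.map_congr_left fun z hz => by
              rw [Function.update_of_ne (by rintro rfl; exact hl.1 hz)]
          simp only [e, Function.update_self, cell_add, add_mul]
        · rw [ih hl.2 ((List.mem_cons.mp hy).resolve_left (Ne.symm ha))]
          simp only [Function.update_of_ne ha, mul_add]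
    exact key _ (Finset.sort_nodup Finset.univ (fun a b : F => a ≤ b)) (by simp)
  map_update_smul' {inst} M y c v := by
    have key : ∀ l : List F, l.Nodup → y ∈ l →
        (l.map fun z => cell (s z) (Function.update M y (c • v) z)).prod =
        c • (l.map fun z => cell (s z) (Function.update M y v z)).prod := by
      intro l
      induction l with
      | nil => simp
      | cons a l ih =>
        intro hl hy
        rw [List.nodup_cons] at hl
        simp only [List.map_cons, List.prod_cons]
        by_cases ha : a = y
        · subst ha
          have e : ∀ u : CellAlg C, (l.map fun z => cell (s z) (Function.update M a u z)) =
              l.map fun z => cell (s z) (M z) := fun u =>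
            List.map_congr_left fun z hz => by
              rw [Function.update_of_ne (by rintro rfl; exact hl.1 hz)]
          simp only [e, Function.update_self, cell_smul, smul_mul_assoc]
        · rw [ih hl.2 ((List.mem_cons.mp hy).resolve_left (Ne.symm ha))]
          simp only [Function.update_of_ne ha, mul_smul_comm]
    exact key _ (Finset.sort_nodup Finset.univ (fun a b : F => a ≤ b)) (by simp)

/-- The local operator `⊠_{y ∈ F} M y`. -/
def LocOp.tensor (M : F → CellAlg C) : LocOp C F := fun σ τ => ∏ y, M y (σ y) (τ y)

theorem LocOp.place_tensor (M : F → CellAlg C) (s : F → G) :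
    (LocOp.tensor M).place s = boxProd s M := by
  have h1 : M = fun y => ∑ p : Fin C.dim × Fin C.dim, M y p.1 p.2 • Matrix.single p.1 p.2 1 := by
    funext y
    rw [Fintype.sum_prod_type]
    conv_lhs => rw [Matrix.matrix_eq_sum_single (M y)]
    refine Finset.sum_congr rfl fun i _ => Finset.sum_congr rfl fun j _ => ?_
    rw [Matrix.smul_single, smul_eq_mul, mul_one]
  have h2 : boxProd s M = boxProdMulti C s M := rfl
  rw [h2]
  conv_rhs => rw [h1]
  rw [MultilinearMap.map_sum, LocOp.place, ← Fintype.sum_prod_type',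
    ← (Equiv.arrowProdEquivProdArrow F (fun _ => Fin C.dim) (fun _ => Fin C.dim)).sum_comp]
  refine Finset.sum_congr rfl fun r _ => ?_
  rw [MultilinearMap.map_smul_univ]
  rfl

/-- Placing local operators on the sites `s` as a linear map. -/
noncomputable def placeLin (C : Cell) (s : F → G) : LocOp C F →ₗ[ℂ] QuasiLocal C G where
  toFun c := c.place s
  map_add' c d := by
    simp only [LocOp.place, Matrix.add_apply, add_smul, Finset.sum_add_distrib]
  map_smul' a c := by
    simp only [LocOp.place, Matrix.smul_apply, smul_eq_mul, mul_smul, Finset.smul_sum,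
      RingHom.id_apply]

@[simp] theorem placeLin_apply (s : F → G) (c : LocOp C F) : placeLin C s c = c.place s := rfl

theorem boxProd_one (s : F → G) : boxProd s (1 : F → CellAlg C) = 1 := by
  refine List.prod_eq_one fun a ha => ?_
  obtain ⟨y, -, rfl⟩ := List.mem_map.mp ha
  exact cell_one _

/-- The local operator which is `m` in the cell `y`. -/
def LocOp.oneSite (y : F) (m : CellAlg C) : LocOp C F := LocOp.tensor (Pi.mulSingle y m)

theorem LocOp.place_oneSite (y : F) (m : CellAlg C) (s : F → G) :
    (LocOp.oneSite y m).place s = cell (s y) m := by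
  rw [LocOp.oneSite, LocOp.place_tensor, boxProd,
    List.prod_map_eq_single (z := y) (Finset.sort_nodup _ _) (by simp), Pi.mulSingle_eq_same]
  intro w hw
  rw [Pi.mulSingle_eq_of_ne hw, cell_one]

/-- The local operator which is `m` in the cell `y` and `m'` in the cell `z`. -/
def LocOp.twoSite (y z : F) (m m' : CellAlg C) : LocOp C F :=
  LocOp.tensor (Function.update (Pi.mulSingle y m) z m')

theorem LocOp.place_twoSite {y z : F} (h : y < z) (m m' : CellAlg C) (s : F → G) :
    (LocOp.twoSite y z m m').place s = cell (s y) m * cell (s z) m' := by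
  rw [LocOp.twoSite, LocOp.place_tensor, boxProd,
    List.prod_map_eq_pair (y := y) (z := z) (Finset.sortedLT_sort _).pairwise h (by simp) (by simp),
    Function.update_self, Function.update_of_ne h.ne, Pi.mulSingle_eq_same]
  intro w hy hz
  rw [Function.update_of_ne hz, Pi.mulSingle_eq_of_ne hy, cell_one]

/-- A product of matrix units in distinct cells acts on Fock space, up to signs, as the matrix unit of
the corresponding configurations. -/
theorem prod_single_apply {s : F → G} (hs : Function.Injective s) (σ τ : F → Fin C.dim)
    {l : List F} (hl : l.Nodup) (ρ : Config C G) :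
    ∃ ε : ℂ, ε ≠ 0 ∧ ∀ ψ : Fock C G,
      (l.map fun y => cellOp (s y) (Matrix.single (σ y) (τ y) (1 : ℂ))).prod ψ ρ =
        if ∀ y ∈ l, ρ (s y) = σ y then ε * ψ (overwrite s τ l ρ) else 0 := by
  induction l generalizing ρ with
  | nil => exact ⟨1, one_ne_zero, fun ψ => by simp [overwrite]⟩
  | cons a l ih =>
    rw [List.nodup_cons] at hl
    obtain ⟨ε, hε, h⟩ := ih hl.2 (ρ.update (s a) (τ a))
    refine ⟨parSign ((C.par (ρ (s a)) + C.par (τ a)) * stringPar (s a) ρ) * ε,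
      mul_ne_zero (parSign_ne_zero _) hε, fun ψ => ?_⟩
    rw [List.map_cons, List.prod_cons]
    change cellOp (s a) (Matrix.single (σ a) (τ a) (1 : ℂ))
      ((l.map fun y => cellOp (s y) (Matrix.single (σ y) (τ y) (1 : ℂ))).prod ψ) ρ = _
    rw [cellOp_apply, Finset.sum_eq_single (τ a)]
    · rw [h ψ]
      have e : (∀ y ∈ l, (ρ.update (s a) (τ a)) (s y) = σ y) ↔ ∀ y ∈ l, ρ (s y) = σ y := by
        refine forall₂_congr fun y hy => ?_
        rw [Finsupp.update_apply, if_neg]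
        intro hya
        exact hl.1 (hs hya ▸ hy)
      by_cases h1 : ρ (s a) = σ a
      · simp only [e, List.forall_mem_cons, h1, true_and, Matrix.single_apply_same, one_mul,
          overwrite]
        split_ifs <;> ring
      · rw [Matrix.single_apply_of_row_ne (Ne.symm h1), zero_mul, zero_mul]
        simp only [List.forall_mem_cons, h1, false_and, if_false]
    · intro j _ hj
      rw [Matrix.single_apply_of_col_ne _ _ (Ne.symm hj), zero_mul, zero_mul]
    · simp

/-- A local operator is determined by its placement on distinct sites. -/
theorem LocOp.place_injective {s : F → G} (hs : Function.Injective s) :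
    Function.Injective fun c : LocOp C F => c.place s := by
  suffices h : ∀ c : LocOp C F, c.place s = 0 → c = 0 by
    intro c d hcd
    refine sub_eq_zero.mp (h _ ?_)
    have := map_sub (placeLin C s) c d
    simp only [placeLin_apply] at this
    rw [this, sub_eq_zero]
    exact hcd
  intro c hc
  ext σ₀ τ₀
  set l : List F := Finset.univ.sort (fun a b : F => a ≤ b) with hl
  have hmem : ∀ y, y ∈ l := fun y => by simp [hl]
  have hnd : l.Nodup := Finset.sort_nodup _ _
  set ρ : Config C G := overwrite s σ₀ l 0 with hρ
  have hρσ : ∀ y, ρ (s y) = σ₀ y := fun y => overwrite_apply hs σ₀ hnd 0 (hmem y)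
  choose ε hε h using fun σ τ => prod_single_apply (C := C) hs σ τ hnd ρ
  have h0 := congrArg (fun a : QuasiLocal C G =>
    (a : Fock C G →L[ℂ] Fock C G) (ket (overwrite s τ₀ l ρ)) ρ) hc
  have hcoe : ∀ σ τ : F → Fin C.dim,
      ((boxProd s (fun y => Matrix.single (σ y) (τ y) 1) : QuasiLocal C G) :
        Fock C G →L[ℂ] Fock C G) =
      (l.map fun y => cellOp (s y) (Matrix.single (σ y) (τ y) (1 : ℂ))).prod := by
    intro σ τ
    rw [boxProd]
    have := map_list_prod (StarSubalgebra.subtype (StarAlgebra.adjoin ℂ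
      {a : Fock C G →L[ℂ] Fock C G | ∃ x m, a = cellOp x m}).topologicalClosure)
      (l.map fun y => cell (s y) (Matrix.single (σ y) (τ y) (1 : ℂ)))
    rw [List.map_map] at this
    exact this
  have hsum : ((c.place s : QuasiLocal C G) : Fock C G →L[ℂ] Fock C G) =
      ∑ σ : F → Fin C.dim, ∑ τ : F → Fin C.dim, c σ τ •
        (l.map fun y => cellOp (s y) (Matrix.single (σ y) (τ y) (1 : ℂ))).prod := by
    rw [LocOp.place, AddSubmonoidClass.coe_finsetSum]
    refine Finset.sum_congr rfl fun σ _ => ?_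
    rw [AddSubmonoidClass.coe_finsetSum]
    refine Finset.sum_congr rfl fun τ _ => ?_
    rw [← hcoe]
    rfl
  have hval : ∀ σ τ : F → Fin C.dim, (l.map fun y => cellOp (s y)
      (Matrix.single (σ y) (τ y) (1 : ℂ))).prod (ket (overwrite s τ₀ l ρ)) ρ =
      if σ = σ₀ ∧ τ = τ₀ then ε σ τ else 0 := by
    intro σ τ
    rw [h σ τ, ket_apply]
    have e1 : (∀ y ∈ l, ρ (s y) = σ y) ↔ σ = σ₀ := by
      simp only [hmem, forall_true_left, hρσ]
      exact ⟨fun hh => funext fun y => (hh y).symm, fun hh y => by rw [hh]⟩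
    have e2 : overwrite s τ l ρ = overwrite s τ₀ l ρ ↔ τ = τ₀ := by
      refine ⟨fun hh => funext fun y => ?_, fun hh => by rw [hh]⟩
      rw [← overwrite_apply hs τ hnd ρ (hmem y), hh, overwrite_apply hs τ₀ hnd ρ (hmem y)]
    simp only [e1, e2]
    split_ifs <;> simp_all
  simp only [hsum] at h0
  have h1 : (∑ σ : F → Fin C.dim, ∑ τ : F → Fin C.dim, c σ τ •
        (l.map fun y => cellOp (s y) (Matrix.single (σ y) (τ y) (1 : ℂ))).prod :
          Fock C G →L[ℂ] Fock C G) (ket (overwrite s τ₀ l ρ)) ρ =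
      ∑ σ : F → Fin C.dim, ∑ τ : F → Fin C.dim, c σ τ *
        (l.map fun y => cellOp (s y) (Matrix.single (σ y) (τ y) (1 : ℂ))).prod
          (ket (overwrite s τ₀ l ρ)) ρ := by
    simp only [sum_apply, lp.coeFn_sum, Finset.sum_apply]
    rfl
  rw [h1] at h0
  simp only [hval, mul_ite, mul_zero] at h0
  rw [Finset.sum_eq_single σ₀ (fun σ _ hσ => Finset.sum_eq_zero fun τ _ => by simp [hσ]) (by simp),
    Finset.sum_eq_single τ₀ (fun τ _ hτ => by simp [hτ]) (by simp)] at h0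
  simp only [and_self, if_true] at h0
  exact (mul_eq_zero.mp h0).resolve_right (hε _ _)

end Placing

/-! ### Clifford generators and the one-mode algebra -/

section Clifford

/-- A Clifford family: the members square to one and anticommute pairwise. -/
structure IsClifford {ι A : Type*} [Ring A] (γ : ι → A) : Prop where
  sq : ∀ k, γ k * γ k = 1
  anti : ∀ k l, k ≠ l → γ k * γ l = -(γ l * γ k)

section

variable {ι A : Type*} [Ring A]

theorem IsClifford.mul_mul_left {γ : ι → A} (hγ : IsClifford γ) (k : ι) (a : A) :
    γ k * (γ k * a) = a := by rw [← mul_assoc, hγ.sq, one_mul]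

/-- The product of two distinct Clifford generators squares to `-1`. -/
theorem IsClifford.pair_sq {γ : ι → A} (hγ : IsClifford γ) {k l : ι} (h : k ≠ l) :
    γ k * γ l * (γ k * γ l) = -1 := by
  rw [mul_assoc, ← mul_assoc (γ l), hγ.anti l k h.symm, neg_mul, mul_neg, mul_assoc,
    hγ.mul_mul_left, hγ.sq]

theorem IsClifford.pair_comm {γ : ι → A} (hγ : IsClifford γ) {k l n : ι} (h : k ≠ n)
    (h' : l ≠ n) : γ k * γ l * γ n = γ n * (γ k * γ l) := by
  rw [mul_assoc, hγ.anti l n h', mul_neg, ← mul_assoc, hγ.anti k n h, neg_mul, neg_neg, mul_assoc]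

theorem IsClifford.pair_mul_left {γ : ι → A} (hγ : IsClifford γ) {k l : ι}
    (h : k ≠ l) : γ k * γ l * γ k = -(γ k * (γ k * γ l)) := by
  rw [mul_assoc, hγ.anti l k h.symm, mul_neg]

theorem IsClifford.pair_mul_right {γ : ι → A} (hγ : IsClifford γ) {k l : ι}
    (h : k ≠ l) : γ k * γ l * γ l = -(γ l * (γ k * γ l)) := by
  rw [← mul_assoc, hγ.anti l k h.symm, neg_mul, neg_neg]

end

variable {ι A B : Type*} [Ring A] [Algebra ℂ A] [Ring B] [Algebra ℂ B]

theorem Algebra.adjoin_le_of_mul_mem {s : Set A} {N : Submodule ℂ A} (h1 : (1 : A) ∈ N)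
    (h : ∀ g ∈ s, ∀ n ∈ N, g * n ∈ N) : Subalgebra.toSubmodule (Algebra.adjoin ℂ s) ≤ N := by
  intro x hx
  have key : ∀ n ∈ N, x * n ∈ N := by
    refine Algebra.adjoin_induction (p := fun x _ => ∀ n ∈ N, x * n ∈ N) ?_ ?_ ?_ ?_ hx
    · exact h
    · intro r n hn
      rw [Algebra.algebraMap_eq_smul_one, smul_one_mul]
      exact N.smul_mem r hn
    · intro a b _ _ ha hb n hn
      rw [add_mul]
      exact N.add_mem (ha n hn) (hb n hn)
    · intro a b _ _ ha hb n hn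
      rw [mul_assoc]
      exact ha _ (hb n hn)
  simpa using key 1 h1

/-- Each Clifford generator at most doubles the dimension of the generated algebra `D`: the sum
`D + γ k D` is stable under multiplication by the generators. -/
theorem IsClifford.finrank_adjoin_image_le {γ : ι → A} (hγ : IsClifford γ) [DecidableEq ι]
    (S : Finset ι) :
    FiniteDimensional ℂ (Subalgebra.toSubmodule (Algebra.adjoin ℂ (γ '' S))) ∧
      Module.finrank ℂ (Subalgebra.toSubmodule (Algebra.adjoin ℂ (γ '' S))) ≤ 2 ^ S.card := by
  induction S using Finset.induction_on with
  | empty =>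
    have h : Subalgebra.toSubmodule (Algebra.adjoin ℂ (γ '' ((∅ : Finset ι) : Set ι))) =
        Submodule.span ℂ {(1 : A)} := by
      rw [Finset.coe_empty, Set.image_empty, Algebra.adjoin_empty, Algebra.toSubmodule_bot,
        Submodule.one_eq_span]
    rw [h]
    exact ⟨inferInstance, by simpa using finrank_span_le_card ({(1 : A)} : Set A)⟩
  | insert k S hk ih =>
    obtain ⟨hfin, hle⟩ := ih
    set D := Subalgebra.toSubmodule (Algebra.adjoin ℂ (γ '' (S : Set ι))) with hD
    set N := D ⊔ D.map (LinearMap.mulLeft ℂ (γ k)) with hN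
    have hsub : Subalgebra.toSubmodule (Algebra.adjoin ℂ (γ '' ((insert k S : Finset ι) : Set ι)))
        ≤ N := by
      refine Algebra.adjoin_le_of_mul_mem
        (Submodule.mem_sup_left (one_mem (Algebra.adjoin ℂ (γ '' (S : Set ι))))) ?_
      rintro g ⟨l, hl, rfl⟩ n hn
      obtain ⟨d, hd, d', hd', rfl⟩ := Submodule.mem_sup.mp hn
      obtain ⟨e, he, rfl⟩ := Submodule.mem_map.mp hd'
      rw [LinearMap.mulLeft_apply]
      rw [Finset.coe_insert, Set.mem_insert_iff] at hl
      by_cases hlk : l = k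
      · subst hlk
        rw [mul_add, ← mul_assoc, hγ.sq, one_mul, add_comm]
        exact Submodule.add_mem_sup he (Submodule.mem_map.mpr ⟨d, hd, rfl⟩)
      · have hlS := hl.resolve_left hlk
        have hm : ∀ x ∈ D, γ l * x ∈ D := fun x hx =>
          Subalgebra.mul_mem _ (Algebra.subset_adjoin ⟨l, hlS, rfl⟩) hx
        rw [mul_add, ← mul_assoc, hγ.anti l k hlk, neg_mul, mul_assoc]
        exact Submodule.add_mem_sup (hm d hd)
          (neg_mem (Submodule.mem_map.mpr ⟨_, hm e he, rfl⟩))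
    have hNfin : FiniteDimensional ℂ N := inferInstance
    refine ⟨Submodule.finiteDimensional_of_le hsub, ?_⟩
    calc _ ≤ Module.finrank ℂ N := Submodule.finrank_mono hsub
      _ ≤ Module.finrank ℂ D + Module.finrank ℂ (D.map (LinearMap.mulLeft ℂ (γ k))) :=
        Submodule.finrank_add_le_finrank_add_finrank _ _
      _ ≤ Module.finrank ℂ D + Module.finrank ℂ D := by
        gcongr
        exact Submodule.finrank_map_le _ _
      _ ≤ 2 ^ (insert k S).card := by
        rw [Finset.card_insert_of_notMem hk, pow_succ]
        omega

theorem IsClifford.finrank_adjoin_le {γ : ι → A} (hγ : IsClifford γ) [Fintype ι] :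
    FiniteDimensional ℂ (Algebra.adjoin ℂ (Set.range γ)) ∧
      Module.finrank ℂ (Algebra.adjoin ℂ (Set.range γ)) ≤ 2 ^ Fintype.card ι := by
  classical
  have := hγ.finrank_adjoin_image_le Finset.univ
  rw [Finset.coe_univ, Set.image_univ] at this
  exact this

/-- The universal property of an algebra which is generated by a Clifford family and has the maximal
dimension: the subalgebra of `A × B` generated by the pairs `(γ k, δ k)` has at most the dimension of
`A`, so it is the graph of a homomorphism. -/
theorem IsClifford.exists_algHom [Fintype ι] {γ : ι → A} {δ : ι → B} (hγ : IsClifford γ)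
    (hδ : IsClifford δ) (hgen : Algebra.adjoin ℂ (Set.range γ) = ⊤)
    (hdim : 2 ^ Fintype.card ι ≤ Module.finrank ℂ A) :
    ∃ φ : A →ₐ[ℂ] B, ∀ k, φ (γ k) = δ k := by
  have hp : IsClifford fun k => (γ k, δ k) :=
    ⟨fun k => Prod.ext (hγ.sq k) (hδ.sq k), fun k l h => Prod.ext (hγ.anti k l h) (hδ.anti k l h)⟩
  obtain ⟨hfin, hle⟩ := hp.finrank_adjoin_le
  set D := Algebra.adjoin ℂ (Set.range fun k => (γ k, δ k)) with hD
  let p : D →ₐ[ℂ] A := (AlgHom.fst ℂ A B).comp D.val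
  have hsurj : Function.Surjective p := by
    rw [← AlgHom.range_eq_top, AlgHom.range_comp, Subalgebra.range_val, AlgHom.map_adjoin,
      ← Set.range_comp]
    exact hgen
  have hge : Module.finrank ℂ A ≤ Module.finrank ℂ D :=
    LinearMap.finrank_le_finrank_of_surjective (f := p.toLinearMap) hsurj
  have hfinA : FiniteDimensional ℂ A := Module.Finite.of_surjective p.toLinearMap hsurj
  have hinj : Function.Injective p :=
    (LinearMap.injective_iff_surjective_of_finrank_eq_finrank (f := p.toLinearMap)
      (le_antisymm (hle.trans hdim) hge)).mpr hsurj
  let e := AlgEquiv.ofBijective p ⟨hinj, hsurj⟩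
  refine ⟨((AlgHom.snd ℂ A B).comp D.val).comp e.symm.toAlgHom, fun k => ?_⟩
  have h1 : e ⟨(γ k, δ k), Algebra.subset_adjoin ⟨k, rfl⟩⟩ = γ k := rfl
  have h2 : e.symm (γ k) = ⟨(γ k, δ k), Algebra.subset_adjoin ⟨k, rfl⟩⟩ := by
    rw [AlgEquiv.symm_apply_eq, h1]
  change ((e.symm (γ k) : D) : A × B).2 = δ k
  rw [h2]

/-- A signed permutation of a Clifford family. -/
theorem IsClifford.signed_perm {γ : ι → A} (hγ : IsClifford γ) (π : Equiv.Perm ι) {ε : ι → ℂ}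
    (hε : ∀ k, ε k = 1 ∨ ε k = -1) : IsClifford fun k => ε k • γ (π k) := by
  refine ⟨fun k => ?_, fun k l h => ?_⟩
  · rw [smul_mul_smul_comm, hγ.sq]
    rcases hε k with h | h <;> simp [h]
  · rw [smul_mul_smul_comm, smul_mul_smul_comm, hγ.anti _ _ (π.injective.ne h), smul_neg,
      mul_comm (ε k)]

/-- Signed permutations of self-adjoint Clifford generators extend to `*`-automorphisms. -/
theorem IsClifford.exists_starAlgEquiv [StarRing A] [StarModule ℂ A] [Fintype ι] {γ : ι → A}
    (hγ : IsClifford γ) (hstar : ∀ k, star (γ k) = γ k)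
    (hgen : Algebra.adjoin ℂ (Set.range γ) = ⊤)
    (hdim : 2 ^ Fintype.card ι ≤ Module.finrank ℂ A) (π : Equiv.Perm ι) {ε : ι → ℂ}
    (hε : ∀ k, ε k = 1 ∨ ε k = -1) :
    ∃ θ : A ≃⋆ₐ[ℂ] A, ∀ k, θ (γ k) = ε k • γ (π k) := by
  obtain ⟨φ, hφ⟩ := hγ.exists_algHom (hγ.signed_perm π hε) hgen hdim
  obtain ⟨ψ, hψ⟩ := hγ.exists_algHom
    (hγ.signed_perm π.symm (ε := fun k => ε (π.symm k)) fun k => hε _) hgen hdim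
  have hee : ∀ k, ε k * ε k = 1 := fun k => by rcases hε k with h | h <;> simp [h]
  have h1 : φ.comp ψ = AlgHom.id ℂ A := by
    refine AlgHom.ext_of_adjoin_eq_top hgen ?_
    rintro _ ⟨k, rfl⟩
    simp [hψ, hφ, smul_smul, hee]
  have h2 : ψ.comp φ = AlgHom.id ℂ A := by
    refine AlgHom.ext_of_adjoin_eq_top hgen ?_
    rintro _ ⟨k, rfl⟩
    simp [hψ, hφ, smul_smul, hee]
  have h3 : ∀ a, φ (star a) = star (φ a) := by
    intro a
    have ha : a ∈ Algebra.adjoin ℂ (Set.range γ) := by rw [hgen]; trivial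
    induction ha using Algebra.adjoin_induction with
    | mem x hx =>
      obtain ⟨k, rfl⟩ := hx
      have : star (ε k) = ε k := by rcases hε k with h | h <;> simp [h]
      rw [hstar, hφ, star_smul, hstar, this]
    | algebraMap r => rw [← algebraMap_star_comm, AlgHom.commutes, AlgHom.commutes,
        algebraMap_star_comm]
    | add x y _ _ hx hy => rw [star_add, map_add, hx, hy, map_add, star_add]
    | mul x y _ _ hx hy => rw [star_mul, map_mul, hx, hy, map_mul, star_mul]
  exact ⟨StarAlgEquiv.ofAlgEquiv (AlgEquiv.ofAlgHom φ ψ h1 h2) h3, hφ⟩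

end Clifford

section LeftTrace

variable (A : Type*) [Ring A] [Algebra ℂ A]

/-- The trace of the left multiplication, which on a full matrix algebra is a multiple of the trace. -/
noncomputable def leftTrace : A →ₗ[ℂ] ℂ := LinearMap.trace ℂ A ∘ₗ LinearMap.mul ℂ A

variable {A}

theorem leftTrace_apply (a : A) : leftTrace A a = LinearMap.trace ℂ A (LinearMap.mulLeft ℂ a) := rfl

theorem leftTrace_mul_comm (a b : A) : leftTrace A (a * b) = leftTrace A (b * a) := by
  simp only [leftTrace_apply, LinearMap.mulLeft_mul]
  exact LinearMap.trace_mul_comm ℂ _ _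

theorem leftTrace_algEquiv (θ : A ≃ₐ[ℂ] A) (a : A) : leftTrace A (θ a) = leftTrace A a := by
  rw [leftTrace_apply, leftTrace_apply, ← LinearMap.trace_conj' (LinearMap.mulLeft ℂ a)
    θ.toLinearEquiv]
  congr 1
  ext x
  simp [LinearEquiv.conj_apply]

theorem leftTrace_one_ne_zero [FiniteDimensional ℂ A] [Nontrivial A] : leftTrace A 1 ≠ 0 := by
  rw [leftTrace_apply, LinearMap.mulLeft_one, LinearMap.trace_id]
  exact_mod_cast Module.finrank_pos.ne'

end LeftTrace

section MajoranaPair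

variable {A : Type*} [Ring A] [Algebra ℂ A]

/-- The linear map sending the basis `1, X, Y, XY` of the one-mode algebra to `v, v', w, w'`. -/
noncomputable def majLin {V : Type*} [AddCommGroup V] [Module ℂ V] (v v' w w' : V) :
    CellAlg fermion →ₗ[ℂ] V where
  toFun (m : Matrix (Fin 2) (Fin 2) ℂ) :=
    ((m 0 0 + m 1 1) / 2) • v + ((m 0 1 + m 1 0) / 2) • v' +
      (Complex.I * (m 0 1 - m 1 0) / 2) • w + (-Complex.I * (m 0 0 - m 1 1) / 2) • w'
  map_add' (m n : Matrix (Fin 2) (Fin 2) ℂ) := by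
    change ((m 0 0 + n 0 0 + (m 1 1 + n 1 1)) / 2) • v +
      ((m 0 1 + n 0 1 + (m 1 0 + n 1 0)) / 2) • v' +
      (Complex.I * (m 0 1 + n 0 1 - (m 1 0 + n 1 0)) / 2) • w +
      (-Complex.I * (m 0 0 + n 0 0 - (m 1 1 + n 1 1)) / 2) • w' = _
    module
  map_smul' c (m : Matrix (Fin 2) (Fin 2) ℂ) := by
    change ((c * m 0 0 + c * m 1 1) / 2) • v + ((c * m 0 1 + c * m 1 0) / 2) • v' +
      (Complex.I * (c * m 0 1 - c * m 1 0) / 2) • w +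
      (-Complex.I * (c * m 0 0 - c * m 1 1) / 2) • w' = _
    rw [RingHom.id_apply]
    module

/-- The linear map sending the basis `1, X, Y, XY` of the one-mode algebra to `1, g, h, gh`. -/
noncomputable def majPair (g h : A) : CellAlg fermion →ₗ[ℂ] A := majLin 1 g h (g * h)

theorem majPair_apply (g h : A) (m : Matrix (Fin 2) (Fin 2) ℂ) :
    majPair g h m = ((m 0 0 + m 1 1) / 2) • 1 + ((m 0 1 + m 1 0) / 2) • g +
      (Complex.I * (m 0 1 - m 1 0) / 2) • h + (-Complex.I * (m 0 0 - m 1 1) / 2) • (g * h) := rfl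

theorem majX_sq : majX * majX = 1 := by
  have h : (!![0, 1; 1, 0] : Matrix (Fin 2) (Fin 2) ℂ) * !![0, 1; 1, 0] = 1 := by
    ext i j; fin_cases i <;> fin_cases j <;> simp
  exact h

theorem majY_sq : majY * majY = 1 := by
  have h : (!![0, -Complex.I; Complex.I, 0] : Matrix (Fin 2) (Fin 2) ℂ) *
      !![0, -Complex.I; Complex.I, 0] = 1 := by
    ext i j; fin_cases i <;> fin_cases j <;> simp
  exact h

theorem majX_mul_majY : majX * majY = Complex.I • majZ := by
  have h : (!![0, 1; 1, 0] : Matrix (Fin 2) (Fin 2) ℂ) * !![0, -Complex.I; Complex.I, 0] =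
      Complex.I • !![1, 0; 0, -1] := by
    ext i j; fin_cases i <;> fin_cases j <;> simp
  exact h

theorem majY_mul_majX : majY * majX = -(majX * majY) := by
  have h : (!![0, -Complex.I; Complex.I, 0] : Matrix (Fin 2) (Fin 2) ℂ) * !![0, 1; 1, 0] =
      -(!![0, 1; 1, 0] * !![0, -Complex.I; Complex.I, 0]) := by
    ext i j; fin_cases i <;> fin_cases j <;> simp
  exact h

theorem majX_conjTranspose : majXᴴ = majX := by
  have h : (!![0, 1; 1, 0] : Matrix (Fin 2) (Fin 2) ℂ)ᴴ = !![0, 1; 1, 0] := by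
    ext i j; fin_cases i <;> fin_cases j <;> simp
  exact h

theorem majY_conjTranspose : majYᴴ = majY := by
  have h : (!![0, -Complex.I; Complex.I, 0] : Matrix (Fin 2) (Fin 2) ℂ)ᴴ =
      !![0, -Complex.I; Complex.I, 0] := by
    ext i j; fin_cases i <;> fin_cases j <;> simp
  exact h

/-- The elements `1, X, Y, XY` span the one-mode algebra. -/
theorem exists_maj_expansion (m : CellAlg fermion) :
    ∃ p q r t : ℂ, m = p • 1 + q • majX + r • majY + t • (majX * majY) := by
  have h : ∀ m : Matrix (Fin 2) (Fin 2) ℂ, m = ((m 0 0 + m 1 1) / 2) • 1 +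
      ((m 0 1 + m 1 0) / 2) • !![0, 1; 1, 0] +
      (Complex.I * (m 0 1 - m 1 0) / 2) • !![0, -Complex.I; Complex.I, 0] +
      (-Complex.I * (m 0 0 - m 1 1) / 2) • (Complex.I • !![1, 0; 0, -1]) := by
    intro m
    have hI := Complex.I_mul_I
    ext i j
    fin_cases i <;> fin_cases j <;> simp <;> grind
  exact ⟨_, _, _, _, by rw [majX_mul_majY]; exact h m⟩

theorem majLin_basis {V : Type*} [AddCommGroup V] [Module ℂ V] (v v' w w' : V) :
    majLin v v' w w' 1 = v ∧ majLin v v' w w' majX = v' ∧ majLin v v' w w' majY = w ∧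
      majLin v v' w w' (majX * majY) = w' := by
  have h : ∀ m : Matrix (Fin 2) (Fin 2) ℂ, majLin v v' w w' m =
      ((m 0 0 + m 1 1) / 2) • v + ((m 0 1 + m 1 0) / 2) • v' +
      (Complex.I * (m 0 1 - m 1 0) / 2) • w + (-Complex.I * (m 0 0 - m 1 1) / 2) • w' := fun _ => rfl
  have hI := Complex.I_mul_I
  refine ⟨?_, ?_, ?_, ?_⟩
  · refine (h 1).trans ?_
    simp
  · refine (h !![0, 1; 1, 0]).trans ?_
    simp
  · refine (h !![0, -Complex.I; Complex.I, 0]).trans ?_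
    have : Complex.I * (-Complex.I - Complex.I) / 2 = 1 := by grind
    simp [this]
  · rw [majX_mul_majY, map_smul]
    refine (congrArg _ (h !![1, 0; 0, -1])).trans ?_
    have : Complex.I * (-(Complex.I * 2) / 2) = 1 := by grind
    norm_num [smul_smul, this]

theorem majPair_one (g h : A) : majPair g h 1 = 1 := (majLin_basis _ _ _ _).1

theorem majPair_X (g h : A) : majPair g h majX = g := (majLin_basis _ _ _ _).2.1

theorem majPair_Y (g h : A) : majPair g h majY = h := (majLin_basis _ _ _ _).2.2.1

theorem majPair_XY (g h : A) : majPair g h (majX * majY) = g * h := (majLin_basis _ _ _ _).2.2.2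

/-- Linear maps out of the one-mode algebra are determined by `1, X, Y, XY`. -/
theorem majLin_ext {V : Type*} [AddCommGroup V] [Module ℂ V] {f f' : CellAlg fermion →ₗ[ℂ] V}
    (h1 : f 1 = f' 1) (hX : f majX = f' majX) (hY : f majY = f' majY)
    (hXY : f (majX * majY) = f' (majX * majY)) : f = f' := by
  ext1 m
  obtain ⟨p, q, r, t, rfl⟩ := exists_maj_expansion m
  simp only [map_add, map_smul, h1, hX, hY, hXY]

/-- The one-mode algebra is the Clifford algebra of two generators. -/
theorem majPair_mul {g h : A} (hg : g * g = 1) (hh : h * h = 1) (hgh : h * g = -(g * h))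
    (m n : CellAlg fermion) : majPair g h (m * n) = majPair g h m * majPair g h n := by
  have a1 : g * (g * h) = h := by rw [← mul_assoc, hg, one_mul]
  have a2 : h * (g * h) = -g := by rw [← mul_assoc, hgh, neg_mul, mul_assoc, hh, mul_one]
  have a3 : g * h * g = -h := by rw [mul_assoc, hgh, mul_neg, a1]
  have a4 : g * h * h = g := by rw [mul_assoc, hh, mul_one]
  have a5 : g * h * (g * h) = -1 := by rw [mul_assoc, a2, mul_neg, hg]
  have key : ∀ m n : Matrix (Fin 2) (Fin 2) ℂ,
      majPair g h (m * n) = majPair g h m * majPair g h n := by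
    intro m n
    simp only [majPair_apply, mul_add, add_mul, smul_mul_smul_comm, hg, hh, hgh, a1, a2, a3, a4, a5,
      one_mul, mul_one, Matrix.mul_apply, Fin.sum_univ_two]
    match_scalars <;> ring_nf <;> simp only [Complex.I_sq] <;> ring
  exact key m n

theorem majPair_star [StarRing A] [StarModule ℂ A] {g h : A} (hg : star g = g) (hh : star h = h)
    (hgh : h * g = -(g * h)) (m : CellAlg fermion) :
    majPair g h mᴴ = star (majPair g h m) := by
  have key : ∀ m n : Matrix (Fin 2) (Fin 2) ℂ, (∀ i j, n i j = star (m j i)) →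
      majPair g h n = star (majPair g h m) := by
    intro m n hn
    simp only [majPair_apply, star_add, star_smul, hg, hh, star_mul, hgh, star_one, hn,
      Complex.star_def, Complex.conj_I, map_ofNat, map_div₀, map_add, map_sub, map_mul, map_neg]
    match_scalars <;> ring
  exact key m mᴴ fun i j => rfl

theorem cell_eq_majPair {G : Type} [LinearOrder G] (x : G) (m : CellAlg fermion) :
    cell x m = majPair (cell x majX) (cell x majY) m := by
  have : cellLin fermion x = majPair (cell x majX) (cell x majY) := by
    refine majLin_ext ?_ ?_ ?_ ?_
    · rw [cellLin_apply, cell_one, majPair_one]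
    · rw [cellLin_apply, majPair_X]
    · rw [cellLin_apply, majPair_Y]
    · rw [cellLin_apply, cell_mul, majPair_XY]
  exact DFunLike.congr_fun this m

theorem map_majPair {B F : Type*} [Ring B] [Algebra ℂ B] [FunLike F A B] [AlgHomClass F ℂ A B]
    (φ : F) (g h : A) (m : CellAlg fermion) :
    φ (majPair g h m) = majPair (φ g) (φ h) m := by
  have key : ∀ m : Matrix (Fin 2) (Fin 2) ℂ, φ (majPair g h m) = majPair (φ g) (φ h) m := by
    intro m
    simp only [majPair_apply, map_add, map_smul, map_mul, map_one]
  exact key m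

end MajoranaPair

/-! ### Majorana generators of the lattice -/

section MajoranaGenerators

variable {G : Type} [LinearOrder G]

/-- The two Majorana generators of a cell: `X` for `true`, `Y` for `false`. -/
def majGen : Bool → CellAlg fermion
  | true => majX
  | false => majY

/-- The Majorana generators of the lattice. -/
noncomputable def gen (k : G × Bool) : QuasiLocal fermion G := cell k.1 (majGen k.2)

theorem isHomog_majX : IsHomog fermion 1 majX := by
  have h : ∀ i j : Fin 2, (!![0, 1; 1, 0] : Matrix (Fin 2) (Fin 2) ℂ) i j ≠ 0 →
      ((i.val : ZMod 2) + (j.val : ZMod 2)) = 1 := by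
    intro i j
    fin_cases i <;> fin_cases j <;> simp
  exact h

theorem isHomog_majY : IsHomog fermion 1 majY := by
  have h : ∀ i j : Fin 2, (!![0, -Complex.I; Complex.I, 0] : Matrix (Fin 2) (Fin 2) ℂ) i j ≠ 0 →
      ((i.val : ZMod 2) + (j.val : ZMod 2)) = 1 := by
    intro i j
    fin_cases i <;> fin_cases j <;> simp
  exact h

theorem isHomog_majGen (κ : Bool) : IsHomog fermion 1 (majGen κ) := by
  cases κ
  exacts [isHomog_majY, isHomog_majX]

theorem majGen_sq (κ : Bool) : majGen κ * majGen κ = 1 := by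
  cases κ
  exacts [majY_sq, majX_sq]

theorem majGen_anti {κ κ' : Bool} (h : κ ≠ κ') :
    majGen κ * majGen κ' = -(majGen κ' * majGen κ) := by
  cases κ <;> cases κ' <;> simp_all [majGen, majY_mul_majX]

theorem majGen_conjTranspose (κ : Bool) : (majGen κ)ᴴ = majGen κ := by
  cases κ
  exacts [majY_conjTranspose, majX_conjTranspose]

theorem cell_neg {C : Cell} (x : G) (m : CellAlg C) : cell x (-m) = -cell x m :=
  map_neg (cellLin C x) m

theorem isClifford_gen : IsClifford (gen : G × Bool → QuasiLocal fermion G) := by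
  refine ⟨fun k => ?_, fun k l h => ?_⟩
  · rw [gen, ← cell_mul, majGen_sq, cell_one]
  · by_cases hkl : k.1 = l.1
    · rw [gen, gen, hkl, ← cell_mul, majGen_anti, cell_neg, cell_mul]
      exact fun h' => h (Prod.ext hkl h')
    · rw [gen, gen, cell_comm hkl (isHomog_majGen _) (isHomog_majGen _)]
      simp [parSign]

theorem star_gen (k : G × Bool) : star (gen k) = gen k := by
  rw [gen, ← cell_star, majGen_conjTranspose]

theorem cell_majX (x : G) : cell x majX = gen (x, true) := rfl

theorem cell_majY (x : G) : cell x majY = gen (x, false) := rfl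

theorem cell_eq_majPair_gen (x : G) (m : CellAlg fermion) :
    cell x m = majPair (gen (x, true)) (gen (x, false)) m := cell_eq_majPair x m

theorem majPair_mem {A : Type*} [Ring A] [Algebra ℂ A] (D : Subalgebra ℂ A) {g h : A} (hg : g ∈ D)
    (hh : h ∈ D) (m : CellAlg fermion) : majPair g h m ∈ D := by
  have key : ∀ m : Matrix (Fin 2) (Fin 2) ℂ, majPair g h m ∈ D := by
    intro m
    rw [majPair_apply]
    exact add_mem (add_mem (add_mem (D.smul_mem (one_mem D) _) (D.smul_mem hg _))
      (D.smul_mem hh _)) (D.smul_mem (mul_mem hg hh) _)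
  exact key m

theorem cell_mem_adjoin_gen (x : G) (m : CellAlg fermion) :
    cell x m ∈ Algebra.adjoin ℂ (Set.range (gen : G × Bool → QuasiLocal fermion G)) := by
  have h : ∀ κ, gen (x, κ) ∈ Algebra.adjoin ℂ
      (Set.range (gen : G × Bool → QuasiLocal fermion G)) := fun κ =>
    Algebra.subset_adjoin ⟨_, rfl⟩
  rw [cell_eq_majPair_gen]
  exact majPair_mem _ (h true) (h false) m

/-- On a finite lattice the Majorana generators generate the quasi-local algebra, as the algebra they
generate is finite-dimensional, hence closed. -/
theorem adjoin_gen_eq_top [Fintype G] :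
    Algebra.adjoin ℂ (Set.range (gen : G × Bool → QuasiLocal fermion G)) = ⊤ := by
  obtain ⟨hfin, -⟩ := (isClifford_gen (G := G)).finrank_adjoin_le
  set D := Algebra.adjoin ℂ (Set.range (gen : G × Bool → QuasiLocal fermion G)) with hD
  set B := StarAlgebra.adjoin ℂ
    {a : Fock fermion G →L[ℂ] Fock fermion G | ∃ x m, a = cellOp x m} with hB
  let ι : QuasiLocal fermion G →ₐ[ℂ] (Fock fermion G →L[ℂ] Fock fermion G) :=
    B.topologicalClosure.toSubalgebra.val
  have hcell : ∀ (x : G) (m : CellAlg fermion), cellOp x m ∈ D.map ι := fun x m =>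
    Subalgebra.mem_map.mpr ⟨cell x m, cell_mem_adjoin_gen x m, rfl⟩
  have hle : B.toSubalgebra ≤ D.map ι := by
    rw [hB, StarAlgebra.adjoin_toSubalgebra, Algebra.adjoin_le_iff]
    rintro a (⟨x, m, rfl⟩ | ⟨x, m, hm⟩)
    · exact hcell x m
    · rw [← star_star a, hm, ← cellOp_conjTranspose]
      exact hcell x _
  have hclosed : IsClosed ((D.map ι : Subalgebra ℂ _) : Set (Fock fermion G →L[ℂ] Fock fermion G)) := by
    have : FiniteDimensional ℂ (Subalgebra.toSubmodule (D.map ι)) := by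
      have : FiniteDimensional ℂ (Subalgebra.toSubmodule D) := hfin
      rw [Subalgebra.map_toSubmodule]
      infer_instance
    exact Submodule.closed_of_finiteDimensional (Subalgebra.toSubmodule (D.map ι))
  rw [eq_top_iff]
  intro a _
  have ha : (a : Fock fermion G →L[ℂ] Fock fermion G) ∈ closure (B : Set _) := a.2
  obtain ⟨d, hd, hda⟩ := Subalgebra.mem_map.mp (closure_minimal hle hclosed ha)
  rw [← show d = a from Subtype.ext hda]
  exact hd

instance finiteDimensional_quasiLocal [Fintype G] : FiniteDimensional ℂ (QuasiLocal fermion G) := by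
  obtain ⟨hfin, -⟩ := (isClifford_gen (G := G)).finrank_adjoin_le
  rw [adjoin_gen_eq_top] at hfin
  exact Module.Finite.equiv (Subalgebra.topEquiv (R := ℂ) (A := QuasiLocal fermion G)).toLinearEquiv

/-- Local operators on all sites of a finite lattice embed into its algebra, which bounds the
dimension of the latter from below. -/
theorem two_pow_le_finrank [Fintype G] :
    2 ^ Fintype.card (G × Bool) ≤ Module.finrank ℂ (QuasiLocal fermion G) := by
  have h := LinearMap.finrank_le_finrank_of_injective (f := placeLin fermion (id : G → G))
    (LocOp.place_injective Function.injective_id)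
  refine le_trans (le_of_eq ?_) h
  rw [Module.finrank_matrix, Module.finrank_self, mul_one, Fintype.card_fun, Fintype.card_prod,
    Fintype.card_bool]
  change _ = Fintype.card (Fin 2) ^ _ * Fintype.card (Fin 2) ^ _
  rw [Fintype.card_fin, ← pow_add, mul_two]

instance nontrivial_quasiLocal {C : Cell} : Nontrivial (QuasiLocal C G) := by
  refine ⟨⟨1, 0, fun h => ?_⟩⟩
  have h1 : (LocOp.tensor (1 : Fin 0 → CellAlg C)).place (Fin.elim0 : Fin 0 → G) =
      (0 : LocOp C (Fin 0)).place Fin.elim0 := by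
    rw [LocOp.place_tensor, boxProd_one, h]
    exact (map_zero (placeLin C (Fin.elim0 : Fin 0 → G))).symm
  have h2 := LocOp.place_injective (fun i => i.elim0) h1
  have h3 := congrFun (congrFun h2 Fin.elim0) Fin.elim0
  rw [LocOp.tensor, Fintype.prod_empty] at h3
  exact one_ne_zero h3

/-- The universal property of the algebra of a finite fermionic lattice. -/
theorem exists_algHom_of_isClifford [Fintype G] {B : Type*} [Ring B] [Algebra ℂ B]
    {δ : G × Bool → B} (hδ : IsClifford δ) :
    ∃ φ : QuasiLocal fermion G →ₐ[ℂ] B, ∀ k, φ (gen k) = δ k :=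
  isClifford_gen.exists_algHom hδ adjoin_gen_eq_top two_pow_le_finrank

theorem exists_signedPerm_aut [Fintype G] (π : Equiv.Perm (G × Bool)) {ε : G × Bool → ℂ}
    (hε : ∀ k, ε k = 1 ∨ ε k = -1) :
    ∃ θ : QuasiLocal fermion G ≃⋆ₐ[ℂ] QuasiLocal fermion G, ∀ k, θ (gen k) = ε k • gen (π k) :=
  isClifford_gen.exists_starAlgEquiv star_gen adjoin_gen_eq_top two_pow_le_finrank π hε

theorem algHom_ext_gen [Fintype G] {B : Type*} [Ring B] [Algebra ℂ B]
    {φ ψ : QuasiLocal fermion G →ₐ[ℂ] B} (h : ∀ k, φ (gen k) = ψ (gen k)) : φ = ψ := by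
  refine AlgHom.ext_of_adjoin_eq_top adjoin_gen_eq_top ?_
  rintro _ ⟨k, rfl⟩
  exact h k

end MajoranaGenerators

/-! ### The Majorana swaps and the Forking automaton -/

section MajoranaSwap

theorem exp_smul_of_mul_self_eq_neg_one {A : Type*} [NormedRing A] [NormedAlgebra ℂ A]
    [CompleteSpace A] {w : A} (hw : w * w = -1) (t : ℝ) :
    NormedSpace.exp ((t : ℂ) • w) = (Real.cos t : ℂ) • 1 + (Real.sin t : ℂ) • w := by
  let : NormedAlgebra ℝ A := NormedAlgebra.restrictScalars ℝ ℂ A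
  let : NormedAlgebra ℚ A := NormedAlgebra.restrictScalars ℚ ℝ A
  have hf : ∀ z : ℂ, Complex.liftAux w hw z = (z.re : ℂ) • 1 + (z.im : ℂ) • w := fun z => by
    rw [Complex.liftAux_apply, Algebra.algebraMap_eq_smul_one]
    rfl
  have h := NormedSpace.map_exp (Complex.liftAux w hw)
    (LinearMap.continuous_of_finiteDimensional (Complex.liftAux w hw).toLinearMap)
    (t * Complex.I)
  rw [hf, hf, ← Complex.exp_eq_exp_ℂ, Complex.exp_mul_I] at h
  simpa [← Complex.ofReal_cos, ← Complex.ofReal_sin] using h.symm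

variable {A : Type*} [Ring A] [Algebra ℂ A]

/-- Conjugation by `(1 + w) / √2` multiplies an element which anticommutes with `w` by `w`. -/
theorem conj_one_add_of_anticomm {r : ℂ} (hr : r * r = 1 / 2) {w a : A} (hw : w * w = -1)
    (h : w * a = -(a * w)) : r • (1 - w) * a * (r • (1 + w)) = a * w := by
  have e : (1 - w) * a * (1 + w) = (2 : ℂ) • (a * w) := by
    have : (1 - w) * a * (1 + w) = a + a * w - w * a - w * a * w := by noncomm_ring
    rw [this, h, neg_mul, mul_assoc a w w, hw, two_smul]
    noncomm_ring
  rw [smul_mul_assoc, smul_mul_smul_comm, e, hr, smul_smul]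
  norm_num

theorem conj_one_add_of_comm {r : ℂ} (hr : r * r = 1 / 2) {w a : A} (hw : w * w = -1)
    (h : w * a = a * w) : r • (1 - w) * a * (r • (1 + w)) = a := by
  have e : (1 - w) * a * (1 + w) = (2 : ℂ) • a := by
    have : (1 - w) * a * (1 + w) = a + a * w - w * a - w * a * w := by noncomm_ring
    rw [this, h, mul_assoc a w w, hw, two_smul]
    noncomm_ring
  rw [smul_mul_assoc, smul_mul_smul_comm, e, hr, smul_smul]
  norm_num

/-- The generator of the Majorana swap of the sites `x`, `x + 1`. -/
noncomputable def swapGen (x : ℤ) : QuasiLocal fermion ℤ := gen (x, true) * gen (x + 1, false)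

theorem swapGen_sq (x : ℤ) : swapGen x * swapGen x = -1 :=
  isClifford_gen.pair_sq (by simp)

theorem star_swapGen (x : ℤ) : star (swapGen x) = -swapGen x := by
  rw [swapGen, star_mul, star_gen, star_gen, isClifford_gen.anti _ _ (by simp)]

/-- `cos (π/4) = sin (π/4)`, as a complex number. -/
noncomputable def invSqrtTwo : ℂ := ((√2 / 2 : ℝ) : ℂ)

theorem invSqrtTwo_mul_self : invSqrtTwo * invSqrtTwo = 1 / 2 := by
  rw [invSqrtTwo, ← Complex.ofReal_mul, div_mul_div_comm, Real.mul_self_sqrt (by norm_num)]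
  norm_num

theorem majSwap_eq (x : ℤ) : majSwap x = invSqrtTwo • (1 + swapGen x) := by
  have h := exp_smul_of_mul_self_eq_neg_one (swapGen_sq x) (Real.pi / 4)
  rw [Real.cos_pi_div_four, Real.sin_pi_div_four, ← smul_add] at h
  exact h

theorem star_majSwap (x : ℤ) : star (majSwap x) = invSqrtTwo • (1 - swapGen x) := by
  have h : star invSqrtTwo = invSqrtTwo := Complex.conj_ofReal _
  rw [majSwap_eq, star_smul, star_add, star_one, star_swapGen, h, sub_eq_add_neg]

theorem majSwap_conj_left (x : ℤ) :
    star (majSwap x) * gen (x, true) * majSwap x = gen (x + 1, false) := by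
  rw [star_majSwap, majSwap_eq, conj_one_add_of_anticomm invSqrtTwo_mul_self (swapGen_sq x)
    (isClifford_gen.pair_mul_left (by simp)), swapGen, isClifford_gen.mul_mul_left]

theorem majSwap_conj_right (x : ℤ) :
    star (majSwap x) * gen (x + 1, false) * majSwap x = -gen (x, true) := by
  rw [star_majSwap, majSwap_eq, conj_one_add_of_anticomm invSqrtTwo_mul_self (swapGen_sq x)
    (isClifford_gen.pair_mul_right (by simp)), swapGen, isClifford_gen.anti (x, true) _ (by simp),
    mul_neg, isClifford_gen.mul_mul_left]

theorem majSwap_conj_of_ne (x : ℤ) {k : ℤ × Bool} (h : (x, true) ≠ k) (h' : (x + 1, false) ≠ k) :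
    star (majSwap x) * gen k * majSwap x = gen k := by
  rw [star_majSwap, majSwap_eq, conj_one_add_of_comm invSqrtTwo_mul_self (swapGen_sq x)
    (isClifford_gen.pair_comm h h')]

theorem IsMajSwapLayer.gen_apply {r : ℤ} {L : QuasiLocal fermion ℤ ≃⋆ₐ[ℂ] QuasiLocal fermion ℤ}
    (hL : IsMajSwapLayer r L) {x y : ℤ} (hx : y = 2 * x + r) :
    L (gen (y, true)) = gen (y + 1, false) ∧ L (gen (y, false)) = gen (y, false) ∧
      L (gen (y + 1, true)) = gen (y + 1, true) ∧ L (gen (y + 1, false)) = -gen (y, true) := by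
  subst hx
  have h1 : ∀ κ, L (gen (2 * x + r, κ)) = star (majSwap (2 * x + r)) * gen (2 * x + r, κ) *
      majSwap (2 * x + r) := fun κ => (hL x (majGen κ)).1
  have h2 : ∀ κ, L (gen (2 * x + r + 1, κ)) = star (majSwap (2 * x + r)) *
      gen (2 * x + r + 1, κ) * majSwap (2 * x + r) := fun κ => (hL x (majGen κ)).2
  rw [h1, h1, h2, h2, majSwap_conj_left, majSwap_conj_right, majSwap_conj_of_ne _ (by simp) (by simp),
    majSwap_conj_of_ne _ (by simp) (by simp)]
  exact ⟨rfl, rfl, rfl, rfl⟩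

/-- The Forking automaton moves the generators `X` to the right and the generators `Y` to the left. -/
theorem IsForking.aut_gen {U : CellAlg fermion} {T : FCA fermion} (hT : IsForking U T) (x : ℤ) :
    T.aut (gen (x, true)) = cell (x + 1) (Uᴴ * majY * U) ∧
      T.aut (gen (x, false)) = -cell (x - 1) (Uᴴ * majX * U) := by
  obtain ⟨-, L₀, L₁, L, h0, h1, hL, hT⟩ := hT
  rw [hT, hT]
  have hLX : ∀ y, L (gen (y, true)) = cell y (Uᴴ * majX * U) := fun y => hL y majX
  have hLY : ∀ y, L (gen (y, false)) = cell y (Uᴴ * majY * U) := fun y => hL y majY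
  obtain ⟨k, hk | hk⟩ := Int.even_or_odd' x
  · have a := h0.gen_apply (x := k) (y := x) (by omega)
    have b := h1.gen_apply (x := k) (y := x + 1) (by omega)
    have c := h1.gen_apply (x := k - 1) (y := x - 1) (by omega)
    rw [sub_add_cancel] at c
    rw [a.1, b.2.1, a.2.1, c.2.2.2, map_neg, hLX, hLY]
    exact ⟨rfl, rfl⟩
  · have a := h0.gen_apply (x := k) (y := x - 1) (by omega)
    have b := h1.gen_apply (x := k) (y := x) (by omega)
    have c := h1.gen_apply (x := k - 1) (y := x - 2) (by omega)
    rw [sub_add_cancel] at a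
    rw [show x - 2 + 1 = x - 1 by ring] at c
    rw [a.2.2.1, b.1, a.2.2.2, map_neg, map_neg, c.2.2.1, hLX, hLY]
    exact ⟨rfl, rfl⟩

end MajoranaSwap

/-! ### The action of the cell-wise gate on the Majorana generators -/

section LocalUnitary

open Complex in
theorem exp_smul_majZ (t : ℂ) : NormedSpace.exp (t • majZ) =
    (!![exp t, 0; 0, exp (-t)] : Matrix (Fin 2) (Fin 2) ℂ) := by
  have h : NormedSpace.exp (Matrix.diagonal ![t, -t]) = Matrix.diagonal ![exp t, exp (-t)] := by
    rw [Matrix.exp_diagonal]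
    congr 1
    ext i
    rw [Pi.coe_exp]
    fin_cases i <;> simp [Complex.exp_eq_exp_ℂ]
  have e1 : t • (!![1, 0; 0, -1] : Matrix (Fin 2) (Fin 2) ℂ) = Matrix.diagonal ![t, -t] := by
    ext i j; fin_cases i <;> fin_cases j <;> simp
  have e2 : (!![exp t, 0; 0, exp (-t)] : Matrix (Fin 2) (Fin 2) ℂ) =
      Matrix.diagonal ![exp t, exp (-t)] := by
    ext i j; fin_cases i <;> fin_cases j <;> simp
  rw [e2, ← h, ← e1]
  rfl

theorem exp_I_mul_pi_div_four : Complex.exp (Complex.I * (Real.pi / 4 : ℂ)) =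
    invSqrtTwo * (1 + Complex.I) := by
  have h : Complex.I * (Real.pi / 4 : ℂ) = ((Real.pi / 4 : ℝ) : ℂ) * Complex.I := by
    push_cast; ring
  rw [h, Complex.exp_mul_I, ← Complex.ofReal_cos, ← Complex.ofReal_sin, Real.cos_pi_div_four,
    Real.sin_pi_div_four, invSqrtTwo]
  ring

theorem exp_neg_I_mul_pi_div_four : Complex.exp (-(Complex.I * (Real.pi / 4 : ℂ))) =
    invSqrtTwo * (1 - Complex.I) := by
  have h : -(Complex.I * (Real.pi / 4 : ℂ)) = ((-(Real.pi / 4) : ℝ) : ℂ) * Complex.I := by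
    push_cast; ring
  rw [h, Complex.exp_mul_I, ← Complex.ofReal_cos, ← Complex.ofReal_sin, Real.cos_neg, Real.sin_neg,
    Real.cos_pi_div_four, Real.sin_pi_div_four, invSqrtTwo]
  push_cast
  ring

theorem norm_invSqrtTwo_mul {p z : ℂ} (hp : ‖p‖ = 1) (hz : Complex.normSq z = 2) :
    ‖p * (invSqrtTwo * z)‖ = 1 := by
  have h : ‖invSqrtTwo * z‖ ^ 2 = 1 := by
    rw [← Complex.normSq_eq_norm_sq, map_mul, hz, invSqrtTwo, Complex.normSq_ofReal,
      div_mul_div_comm, Real.mul_self_sqrt (by norm_num)]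
    norm_num
  rw [norm_mul, hp, one_mul]
  exact (pow_eq_one_iff_of_nonneg (norm_nonneg _) (by norm_num)).mp h

theorem one_div_sqrt_two : (1 / (Real.sqrt 2 : ℂ)) = invSqrtTwo := by
  rw [invSqrtTwo, ← Complex.ofReal_one, ← Complex.ofReal_div]
  congr 1
  rw [div_eq_div_iff (by positivity) (by norm_num), Real.mul_self_sqrt (by norm_num)]
  norm_num

/-- Membership in the list of special unitaries, in terms of matrices. -/
theorem isSpecialUnitary_iff (U : Matrix (Fin 2) (Fin 2) ℂ) : IsSpecialUnitary U ↔
    ∃ ζ : ℂ, ‖ζ‖ = 1 ∧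
    ((∃ n : ℤ, U = !![ζ * Complex.exp (Complex.I * ((2 * n + 1) * (Real.pi : ℂ) / 4)), 0; 0,
        ζ * Complex.exp (-(Complex.I * ((2 * n + 1) * (Real.pi : ℂ) / 4)))]) ∨
      U = !![0, ζ * (invSqrtTwo * (1 - Complex.I)); ζ * (invSqrtTwo * (1 + Complex.I)), 0] ∨
      U = !![0, ζ * (invSqrtTwo * (1 + Complex.I)); ζ * (invSqrtTwo * (1 - Complex.I)), 0]) := by
  have e1 : ∀ (ζ : ℂ) (n : ℤ), (ζ • NormedSpace.exp
      ((Complex.I * ((2 * n + 1) * (Real.pi : ℂ) / 4)) • majZ) : CellAlg fermion) =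
      (!![ζ * Complex.exp (Complex.I * ((2 * n + 1) * (Real.pi : ℂ) / 4)), 0; 0,
        ζ * Complex.exp (-(Complex.I * ((2 * n + 1) * (Real.pi : ℂ) / 4)))] :
          Matrix (Fin 2) (Fin 2) ℂ) := by
    intro ζ n
    rw [exp_smul_majZ]
    have : ∀ z w : ℂ, ζ • (!![z, 0; 0, w] : Matrix (Fin 2) (Fin 2) ℂ) = !![ζ * z, 0; 0, ζ * w] := by
      intro z w
      ext i j; fin_cases i <;> fin_cases j <;> simp
    exact this _ _
  have e2 : ∀ ζ : ℂ, (ζ • ((1 / (Real.sqrt 2 : ℂ)) • (majX + majY)) : CellAlg fermion) =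
      (!![0, ζ * (invSqrtTwo * (1 - Complex.I)); ζ * (invSqrtTwo * (1 + Complex.I)), 0] :
        Matrix (Fin 2) (Fin 2) ℂ) := by
    intro ζ
    rw [one_div_sqrt_two]
    have : ζ • (invSqrtTwo • ((!![0, 1; 1, 0] : Matrix (Fin 2) (Fin 2) ℂ) +
        !![0, -Complex.I; Complex.I, 0])) =
        !![0, ζ * (invSqrtTwo * (1 - Complex.I)); ζ * (invSqrtTwo * (1 + Complex.I)), 0] := by
      ext i j; fin_cases i <;> fin_cases j <;> simp [sub_eq_add_neg]
    exact this
  have e3 : ∀ ζ : ℂ, (ζ • ((1 / (Real.sqrt 2 : ℂ)) • (majX - majY)) : CellAlg fermion) =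
      (!![0, ζ * (invSqrtTwo * (1 + Complex.I)); ζ * (invSqrtTwo * (1 - Complex.I)), 0] :
        Matrix (Fin 2) (Fin 2) ℂ) := by
    intro ζ
    rw [one_div_sqrt_two]
    have : ζ • (invSqrtTwo • ((!![0, 1; 1, 0] : Matrix (Fin 2) (Fin 2) ℂ) -
        !![0, -Complex.I; Complex.I, 0])) =
        !![0, ζ * (invSqrtTwo * (1 + Complex.I)); ζ * (invSqrtTwo * (1 - Complex.I)), 0] := by
      ext i j; fin_cases i <;> fin_cases j <;> simp [sub_eq_add_neg]
    exact this
  simp only [IsSpecialUnitary, e1, e2, e3]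
  exact Iff.rfl

theorem re_eq_zero_of_isSpecialUnitary {U : Matrix (Fin 2) (Fin 2) ℂ} (h : IsSpecialUnitary U) :
    (star (U 0 1) * U 1 0 + star (U 1 1) * U 0 0).re = 0 := by
  have hI := Complex.I_mul_I
  have hr := invSqrtTwo_mul_self
  have hr' : (starRingEnd ℂ) invSqrtTwo = invSqrtTwo := Complex.conj_ofReal _
  obtain ⟨ζ, hζ, ⟨n, rfl⟩ | rfl | rfl⟩ := (isSpecialUnitary_iff U).mp h
  all_goals
    have hζ' : (starRingEnd ℂ) ζ * ζ = 1 := by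
      rw [mul_comm, Complex.mul_conj, Complex.normSq_eq_norm_sq, hζ]; norm_num
  · have h1 : star (ζ * Complex.exp (-(Complex.I * ((2 * n + 1) * (Real.pi : ℂ) / 4)))) *
        (ζ * Complex.exp (Complex.I * ((2 * n + 1) * (Real.pi : ℂ) / 4))) =
        Complex.exp (((2 * n + 1) * Real.pi / 2 : ℝ) * Complex.I) := by
      have : (((2 * n + 1) * Real.pi / 2 : ℝ) : ℂ) * Complex.I =
          (starRingEnd ℂ) (-(Complex.I * ((2 * n + 1) * (Real.pi : ℂ) / 4))) +
            Complex.I * ((2 * n + 1) * (Real.pi : ℂ) / 4) := by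
        simp only [map_neg, map_mul, map_div₀, map_add, Complex.conj_I, Complex.conj_ofReal, map_ofNat,
          map_one, map_intCast]
        push_cast
        ring
      rw [this, Complex.exp_add, Complex.star_def, map_mul, ← Complex.exp_conj]
      linear_combination Complex.exp ((starRingEnd ℂ)
        (-(Complex.I * ((2 * n + 1) * (Real.pi : ℂ) / 4)))) *
        Complex.exp (Complex.I * ((2 * n + 1) * (Real.pi : ℂ) / 4)) * hζ'
    simp only [Matrix.of_apply, Matrix.cons_val', Matrix.cons_val_zero, Matrix.cons_val_one,
      Matrix.cons_val_fin_one, mul_zero, zero_add]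
    rw [h1, Complex.exp_ofReal_mul_I_re]
    exact Real.cos_eq_zero_iff.mpr ⟨n, rfl⟩
  · have h1 : star (ζ * (invSqrtTwo * (1 - Complex.I))) * (ζ * (invSqrtTwo * (1 + Complex.I))) =
        Complex.I := by
      simp only [Complex.star_def, map_mul, map_sub, map_one, Complex.conj_I, hr']
      linear_combination (invSqrtTwo * invSqrtTwo * (1 + Complex.I) ^ 2) * hζ' +
        (1 + Complex.I) ^ 2 * hr + (1 / 2 : ℂ) * hI
    simp only [Matrix.of_apply, Matrix.cons_val', Matrix.cons_val_zero, Matrix.cons_val_one,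
      Matrix.cons_val_fin_one, mul_zero, add_zero]
    rw [h1]
    simp
  · have h1 : star (ζ * (invSqrtTwo * (1 + Complex.I))) * (ζ * (invSqrtTwo * (1 - Complex.I))) =
        -Complex.I := by
      simp only [Complex.star_def, map_mul, map_add, map_one, Complex.conj_I, hr']
      linear_combination (invSqrtTwo * invSqrtTwo * (1 - Complex.I) ^ 2) * hζ' +
        (1 - Complex.I) ^ 2 * hr + (1 / 2 : ℂ) * hI
    simp only [Matrix.of_apply, Matrix.cons_val', Matrix.cons_val_zero, Matrix.cons_val_one,
      Matrix.cons_val_fin_one, mul_zero, add_zero]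
    rw [h1]
    simp

/-- The even gates that turn `X` into `±Y` are the exponentials `exp (i (2n+1) π/4 Z)`, up to a
phase. -/
theorem isSpecialUnitary_diagonal {p q : ℂ} (hp : ‖p‖ = 1) {b : ℂ} (hb : b = 1 ∨ b = -1)
    (h : q = -(b * Complex.I * p)) :
    IsSpecialUnitary (!![p, 0; 0, q] : Matrix (Fin 2) (Fin 2) ℂ) := by
  have hI := Complex.I_mul_I
  have hr := invSqrtTwo_mul_self
  rw [isSpecialUnitary_iff]
  rcases hb with rfl | rfl
  · refine ⟨p * (invSqrtTwo * (1 - Complex.I)), norm_invSqrtTwo_mul hp ?_, Or.inl ⟨0, ?_⟩⟩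
    · simp [Complex.normSq_apply]; norm_num
    · have e : Complex.I * ((2 * ((0 : ℤ) : ℂ) + 1) * (Real.pi : ℂ) / 4) =
        Complex.I * (Real.pi / 4 : ℂ) := by push_cast; ring
      have e1 : p = p * (invSqrtTwo * (1 - Complex.I)) * (invSqrtTwo * (1 + Complex.I)) := by
        linear_combination -p * (1 - Complex.I ^ 2) * hr + (1 / 2 : ℂ) * p * hI
      have e2 : q = p * (invSqrtTwo * (1 - Complex.I)) * (invSqrtTwo * (1 - Complex.I)) := by
        rw [h]
        linear_combination -p * (1 - Complex.I) ^ 2 * hr - (1 / 2 : ℂ) * p * hI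
      rw [e, exp_I_mul_pi_div_four, exp_neg_I_mul_pi_div_four, ← e1, ← e2]
  · refine ⟨p * (invSqrtTwo * (1 + Complex.I)), norm_invSqrtTwo_mul hp ?_, Or.inl ⟨-1, ?_⟩⟩
    · simp [Complex.normSq_apply]; norm_num
    · have e : Complex.I * ((2 * ((-1 : ℤ) : ℂ) + 1) * (Real.pi : ℂ) / 4) =
        -(Complex.I * (Real.pi / 4 : ℂ)) := by push_cast; ring
      have e1 : p = p * (invSqrtTwo * (1 + Complex.I)) * (invSqrtTwo * (1 - Complex.I)) := by
        linear_combination -p * (1 - Complex.I ^ 2) * hr + (1 / 2 : ℂ) * p * hI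
      have e2 : q = p * (invSqrtTwo * (1 + Complex.I)) * (invSqrtTwo * (1 + Complex.I)) := by
        rw [h]
        linear_combination -p * (1 + Complex.I) ^ 2 * hr - (1 / 2 : ℂ) * p * hI
      rw [e, neg_neg, exp_I_mul_pi_div_four, exp_neg_I_mul_pi_div_four, ← e1, ← e2]

theorem isSpecialUnitary_offDiagonal {p q : ℂ} (hp : ‖p‖ = 1) {b : ℂ} (hb : b = 1 ∨ b = -1)
    (h : q = b * Complex.I * p) :
    IsSpecialUnitary (!![0, p; q, 0] : Matrix (Fin 2) (Fin 2) ℂ) := by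
  have hI := Complex.I_mul_I
  have hr := invSqrtTwo_mul_self
  rw [isSpecialUnitary_iff]
  rcases hb with rfl | rfl
  · refine ⟨p * (invSqrtTwo * (1 + Complex.I)), norm_invSqrtTwo_mul hp ?_, Or.inr (Or.inl ?_)⟩
    · simp [Complex.normSq_apply]; norm_num
    · have e1 : p = p * (invSqrtTwo * (1 + Complex.I)) * (invSqrtTwo * (1 - Complex.I)) := by
        linear_combination -p * (1 - Complex.I ^ 2) * hr + (1 / 2 : ℂ) * p * hI
      have e2 : q = p * (invSqrtTwo * (1 + Complex.I)) * (invSqrtTwo * (1 + Complex.I)) := by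
        rw [h]
        linear_combination -p * (1 + Complex.I) ^ 2 * hr - (1 / 2 : ℂ) * p * hI
      rw [← e1, ← e2]
  · refine ⟨p * (invSqrtTwo * (1 - Complex.I)), norm_invSqrtTwo_mul hp ?_, Or.inr (Or.inr ?_)⟩
    · simp [Complex.normSq_apply]; norm_num
    · have e1 : p = p * (invSqrtTwo * (1 - Complex.I)) * (invSqrtTwo * (1 + Complex.I)) := by
        linear_combination -p * (1 - Complex.I ^ 2) * hr + (1 / 2 : ℂ) * p * hI
      have e2 : q = p * (invSqrtTwo * (1 - Complex.I)) * (invSqrtTwo * (1 - Complex.I)) := by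
        rw [h]
        linear_combination -p * (1 - Complex.I) ^ 2 * hr - (1 / 2 : ℂ) * p * hI
      rw [← e1, ← e2]

theorem norm_eq_one_of_star_mul_self {w : ℂ} (h : star w * w = 1) : ‖w‖ = 1 := by
  rw [Complex.star_def, mul_comm, Complex.mul_conj, Complex.normSq_eq_norm_sq] at h
  exact (pow_eq_one_iff_of_nonneg (norm_nonneg _) two_ne_zero).mp (by exact_mod_cast h)

theorem re_sq_add_im_sq_of_norm_eq_one {z : ℂ} (h : ‖z‖ = 1) : z.re ^ 2 + z.im ^ 2 = 1 := by
  have := Complex.sq_norm z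
  rw [h, Complex.normSq_apply] at this
  nlinarith

theorem eq_I_of_norm_eq_one {z : ℂ} (h : ‖z‖ = 1) (h0 : z.re = 0) :
    ∃ b : ℂ, (b = 1 ∨ b = -1) ∧ z = b * Complex.I := by
  have h2 := re_sq_add_im_sq_of_norm_eq_one h
  rw [h0] at h2
  refine ⟨z.im, ?_, by apply Complex.ext <;> simp [h0]⟩
  have h3 : (z.im - 1) * (z.im + 1) = 0 := by nlinarith
  rcases mul_eq_zero.mp h3 with h | h
  · left; exact_mod_cast sub_eq_zero.mp h
  · right; exact_mod_cast eq_neg_of_add_eq_zero_left h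

/-- The action of a homogeneous one-mode unitary on the Majorana generators is orthogonal, and the
unitary is one of the special ones exactly when `X` goes to a multiple of `Y`. -/
theorem exists_orthogonal_action {U : CellAlg fermion} (hU : U ∈ unitary (CellAlg fermion))
    (hpar : ∃ p : ZMod 2, IsHomog fermion p U) :
    ∃ a b s : ℝ, a ^ 2 + b ^ 2 = 1 ∧ s ^ 2 = 1 ∧
      Uᴴ * majX * U = (a : ℂ) • majX + (b : ℂ) • majY ∧
      Uᴴ * majY * U = (s : ℂ) • ((b : ℂ) • majX - (a : ℂ) • majY) ∧
      (IsSpecialUnitary U ↔ a = 0) := by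
  obtain ⟨p, hp⟩ := hpar
  have key : ∀ U : Matrix (Fin 2) (Fin 2) ℂ, Uᴴ * U = 1 →
      (∀ i j : Fin 2, U i j ≠ 0 → ((i.val : ZMod 2) + (j.val : ZMod 2)) = p) →
      ∃ a b s : ℝ, a ^ 2 + b ^ 2 = 1 ∧ s ^ 2 = 1 ∧
      Uᴴ * !![0, 1; 1, 0] * U = (a : ℂ) • !![0, 1; 1, 0] +
        (b : ℂ) • !![0, -Complex.I; Complex.I, 0] ∧
      Uᴴ * !![0, -Complex.I; Complex.I, 0] * U =
        (s : ℂ) • ((b : ℂ) • !![0, 1; 1, 0] - (a : ℂ) • !![0, -Complex.I; Complex.I, 0]) ∧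
      (IsSpecialUnitary U ↔ a = 0) := by
    intro U hU hp
    have hI := Complex.I_mul_I
    have hU00 := congrFun (congrFun hU 0) 0
    have hU11 := congrFun (congrFun hU 1) 1
    simp only [Matrix.mul_apply, Fin.sum_univ_two, Matrix.conjTranspose_apply,
      Matrix.one_apply_eq] at hU00 hU11
    have hre : ∀ z : ℂ, (z.re : ℂ) + z.im * Complex.I = z := Complex.re_add_im
    have hcj : ∀ z : ℂ, (z.re : ℂ) - z.im * Complex.I = (starRingEnd ℂ) z := fun z => by
      apply Complex.ext <;> simp
    have hA : ∀ a b : ℂ, a • (!![0, 1; 1, 0] : Matrix (Fin 2) (Fin 2) ℂ) +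
        b • !![0, -Complex.I; Complex.I, 0] = !![0, a - b * Complex.I; a + b * Complex.I, 0] := by
      intro a b
      ext i j; fin_cases i <;> fin_cases j <;> simp [sub_eq_add_neg]
    have hB : ∀ a b s : ℂ, s • (b • (!![0, 1; 1, 0] : Matrix (Fin 2) (Fin 2) ℂ) -
        a • !![0, -Complex.I; Complex.I, 0]) =
        !![0, s * (b + a * Complex.I); s * (b - a * Complex.I), 0] := by
      intro a b s
      ext i j; fin_cases i <;> fin_cases j <;> simp
    have hc : ∀ x y z w : ℂ, (!![x, y; z, w] : Matrix (Fin 2) (Fin 2) ℂ)ᴴ =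
        !![star x, star z; star y, star w] := by
      intro x y z w
      ext i j; fin_cases i <;> fin_cases j <;> rfl
    obtain ⟨x, y, z, w, rfl⟩ : ∃ x y z w : ℂ, U = !![x, y; z, w] :=
      ⟨_, _, _, _, Matrix.eta_fin_two U⟩
    simp only [Matrix.of_apply, Matrix.cons_val', Matrix.cons_val_zero, Matrix.cons_val_one,
      Matrix.cons_val_fin_one] at hU00 hU11
    have h01 : (p = 0 ∨ p = 1) := by
      have : ∀ p : ZMod 2, p = 0 ∨ p = 1 := by decide
      exact this p
    rcases h01 with rfl | rfl
    · have e1 : y = 0 := by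
        by_contra h
        simpa using hp 0 1 h
      have e2 : z = 0 := by
        by_contra h
        simpa using hp 1 0 h
      subst e1 e2
      simp only [star_zero, mul_zero, add_zero, zero_add] at hU00 hU11
      have hx := norm_eq_one_of_star_mul_self hU00
      have hw := norm_eq_one_of_star_mul_self hU11
      have hz : ‖star w * x‖ = 1 := by rw [norm_mul, norm_star, hx, hw, one_mul]
      have h1 := hre (star w * x)
      have h2 := hcj (star w * x)
      rw [map_mul, ← Complex.star_def, star_star] at h2
      refine ⟨(star w * x).re, (star w * x).im, -1, re_sq_add_im_sq_of_norm_eq_one hz, by norm_num,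
        ?_, ?_, fun h => ?_, fun h => ?_⟩
      · generalize (star w * x).re = a at *
        generalize (star w * x).im = b at *
        rw [hc, hA, h1, h2, Matrix.mul_fin_two, Matrix.mul_fin_two]
        congr 2 <;> simp [mul_comm]
      · generalize (star w * x).re = a at *
        generalize (star w * x).im = b at *
        rw [hc, hB, Matrix.mul_fin_two, Matrix.mul_fin_two]
        rw [Complex.star_def] at h1 h2
        congr 2 <;> simp
        · linear_combination Complex.I * h2 + b * hI
        · linear_combination -Complex.I * h1 + b * hI
      · simpa using re_eq_zero_of_isSpecialUnitary h
      · obtain ⟨b, hb, hb'⟩ := eq_I_of_norm_eq_one hz h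
        refine isSpecialUnitary_diagonal hx hb ?_
        have hb2 : b * b = 1 := by rcases hb with rfl | rfl <;> norm_num
        have h3 : x = b * Complex.I * w := by rw [← hb', mul_right_comm, hU11, one_mul]
        rw [h3]
        linear_combination w * b ^ 2 * hI - w * hb2
    · have e1 : x = 0 := by
        by_contra h
        simpa using hp 0 0 h
      have e2 : w = 0 := by
        by_contra h
        have := hp 1 1 h
        exact absurd this (by decide)
      subst e1 e2
      simp only [star_zero, mul_zero, add_zero, zero_add] at hU00 hU11
      have hx := norm_eq_one_of_star_mul_self hU00
      have hw := norm_eq_one_of_star_mul_self hU11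
      have hz : ‖star y * z‖ = 1 := by rw [norm_mul, norm_star, hx, hw, one_mul]
      have h1 := hre (star y * z)
      have h2 := hcj (star y * z)
      rw [map_mul, ← Complex.star_def, star_star] at h2
      refine ⟨(star y * z).re, (star y * z).im, 1, re_sq_add_im_sq_of_norm_eq_one hz, by norm_num,
        ?_, ?_, fun h => ?_, fun h => ?_⟩
      · generalize (star y * z).re = a at *
        generalize (star y * z).im = b at *
        rw [hc, hA, h1, h2, Matrix.mul_fin_two, Matrix.mul_fin_two]
        congr 2 <;> simp [mul_comm]
      · generalize (star y * z).re = a at *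
        generalize (star y * z).im = b at *
        rw [hc, hB, Matrix.mul_fin_two, Matrix.mul_fin_two]
        rw [Complex.star_def] at h1 h2
        congr 2 <;> simp
        · linear_combination -Complex.I * h2 - b * hI
        · linear_combination Complex.I * h1 - b * hI
      · simpa using re_eq_zero_of_isSpecialUnitary h
      · obtain ⟨b, hb, hb'⟩ := eq_I_of_norm_eq_one hz h
        refine isSpecialUnitary_offDiagonal hw hb ?_
        rw [← hb', mul_right_comm, hU11, one_mul]
  exact key U (Unitary.mem_iff.mp hU).1 hp

end LocalUnitary

/-! ### Invariant product states on a ring -/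

section TileCoefficients

variable {A : Type*} [Ring A] [Algebra ℂ A]

/-- The coefficients of an even element of the algebra of a tile of two modes in the basis of
products of Majorana generators: the scalar part and the coefficients of `X₀X₁`, `Y₀Y₁`,
`X₀X₁Y₀Y₁` and `X_i Y_j`. -/
structure TileCoeff where
  one : ℂ
  xx : ℂ
  yy : ℂ
  xxyy : ℂ
  xy : Fin 2 → Fin 2 → ℂ

/-- The even element with coefficients `k` in the algebra generated by the Majorana operators
`c (i, true) = X_i` and `c (i, false) = Y_i`. -/
noncomputable def tileOp (k : TileCoeff) (c : Fin 2 × Bool → A) : A :=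
  k.one • 1 + k.xx • (c (0, true) * c (1, true)) + k.yy • (c (0, false) * c (1, false)) +
    k.xxyy • (c (0, true) * c (1, true) * (c (0, false) * c (1, false))) +
    ∑ i, ∑ j, k.xy i j • (c (i, true) * c (j, false))

/-- A functional which is invariant under conjugation by the Majorana generators of a tile reads off
the coefficients of an even element of the tile. -/
theorem tileOp_coeff {c : Fin 2 × Bool → A} (hc : IsClifford c) (k : TileCoeff) {f : A →ₗ[ℂ] ℂ}
    (hf : ∀ i a, f (c i * (a * c i)) = f a) :
    f (tileOp k c) = k.one * f 1 ∧
    f (tileOp k c * (c (0, true) * c (1, true))) = -k.xx * f 1 ∧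
    f (tileOp k c * (c (0, false) * c (1, false))) = -k.yy * f 1 ∧
    f (tileOp k c * (c (0, false) * c (1, false) * (c (0, true) * c (1, true)))) = k.xxyy * f 1 ∧
    ∀ i j, f (tileOp k c * (c (j, false) * c (i, true))) = k.xy i j * f 1 := by
  obtain ⟨x0, hx0⟩ : ∃ x, x = c (0, true) := ⟨_, rfl⟩
  obtain ⟨x1, hx1⟩ : ∃ x, x = c (1, true) := ⟨_, rfl⟩
  obtain ⟨y0, hy0⟩ : ∃ x, x = c (0, false) := ⟨_, rfl⟩
  obtain ⟨y1, hy1⟩ : ∃ x, x = c (1, false) := ⟨_, rfl⟩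
  have s1 := hc.sq (0, true); have s2 := hc.sq (1, true)
  have s3 := hc.sq (0, false); have s4 := hc.sq (1, false)
  have a1 := hc.anti (1, true) (0, true) (by simp)
  have a2 := hc.anti (0, false) (0, true) (by simp)
  have a3 := hc.anti (1, false) (0, true) (by simp)
  have a4 := hc.anti (0, false) (1, true) (by simp)
  have a5 := hc.anti (1, false) (1, true) (by simp)
  have a6 := hc.anti (1, false) (0, false) (by simp)
  have f1 := hf (0, true); have f2 := hf (1, true)
  have f3 := hf (0, false)
  simp only [Fin.forall_fin_two, tileOp, Fin.sum_univ_two]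
  rw [← hx0, ← hx1, ← hy0, ← hy1] at *
  have left : ∀ {p q : A}, p * q = -(q * p) → ∀ a, p * (q * a) = -(q * (p * a)) := fun h a => by
    rw [← mul_assoc, h, neg_mul, mul_assoc]
  have left' : ∀ {p : A}, p * p = 1 → ∀ a, p * (p * a) = a := fun h a => by
    rw [← mul_assoc, h, one_mul]
  have b1 := left a1; have b2 := left a2; have b3 := left a3
  have b4 := left a4; have b5 := left a5; have b6 := left a6
  have t1 := left' s1; have t2 := left' s2; have t3 := left' s3
  have neg : ∀ {z : ℂ}, -z = z → z = 0 := fun h => self_eq_neg.mp h.symm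
  have z1 : f (x0 * x1) = 0 := neg (by simpa [mul_assoc, a1, t1] using f1 (x0 * x1))
  have z2 : f (x0 * y0) = 0 := neg (by simpa [mul_assoc, a2, t1] using f1 (x0 * y0))
  have z3 : f (x0 * y1) = 0 := neg (by simpa [mul_assoc, a3, t1] using f1 (x0 * y1))
  have z4 : f (x1 * y0) = 0 := neg (by simpa [mul_assoc, a4, t2] using f2 (x1 * y0))
  have z5 : f (x1 * y1) = 0 := neg (by simpa [mul_assoc, a5, t2] using f2 (x1 * y1))
  have z6 : f (y0 * y1) = 0 := neg (by simpa [mul_assoc, a6, t3] using f3 (y0 * y1))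
  have z7 : f (x0 * (x1 * (y0 * y1))) = 0 :=
    neg (by simpa [mul_assoc, a3, b2, b1, t1] using f1 (x0 * (x1 * (y0 * y1))))
  refine ⟨?_, ?_, ?_, ?_, ⟨?_, ?_⟩, ?_, ?_⟩ <;>
    simp [mul_assoc, add_mul, s1, s2, s3, s4, t1, t2, t3, a1, a2, a3, a4, a5, a6,
      b1, b2, b3, b4, b5, b6, z1, z2, z3, z4, z5, z6, z7]

end TileCoefficients

section ProductState

variable {A : Type*} [Ring A] {ι : Type*}

/-- A product of two elements anticommuting with `z` commutes with `z`. -/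
theorem commute_mul_of_anti {z p q : A} (hp : z * p = -(p * z)) (hq : z * q = -(q * z)) :
    Commute z (p * q) := by
  rw [Commute, SemiconjBy, ← mul_assoc, hp, neg_mul, mul_assoc, hq, mul_neg, neg_neg, mul_assoc]

/-- The product of the four Majorana generators of a tile. -/
noncomputable def tileParity (c : Fin 2 × Bool → A) : A :=
  c (0, true) * c (1, true) * (c (0, false) * c (1, false))

theorem tileParity_sq {c : Fin 2 × Bool → A} (hc : IsClifford c) :
    tileParity c * tileParity c = 1 := by
  have h1 := hc.pair_sq (k := (0, true)) (l := (1, true)) (by simp)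
  have h2 := hc.pair_sq (k := (0, false)) (l := (1, false)) (by simp)
  have h3 : Commute (c (0, false) * c (1, false)) (c (0, true) * c (1, true)) :=
    Commute.mul_right (hc.pair_comm (by simp) (by simp)) (hc.pair_comm (by simp) (by simp))
  unfold tileParity
  rw [mul_assoc, ← mul_assoc _ (c (0, true) * c (1, true)), h3.eq,
    mul_assoc _ (c (0, false) * c (1, false)), h2, mul_neg, mul_one, mul_neg, h1, neg_neg]

theorem tileParity_anti {c : Fin 2 × Bool → A} (hc : IsClifford c) (i : Fin 2 × Bool) :
    tileParity c * c i = -(c i * tileParity c) := by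
  have hcomm : ∀ i j l, i ≠ l → j ≠ l → c i * c j * c l = c l * (c i * c j) := fun i j l =>
    hc.pair_comm
  unfold tileParity
  obtain ⟨i, κ⟩ := i
  cases κ
  · have h1 : c (0, false) * c (1, false) * c (i, false) =
        -(c (i, false) * (c (0, false) * c (1, false))) := by
      fin_cases i
      · exact hc.pair_mul_left (by simp)
      · exact hc.pair_mul_right (by simp)
    rw [mul_assoc, h1, mul_neg, ← mul_assoc, hcomm _ _ _ (by simp) (by simp), mul_assoc]
  · have h1 : c (0, true) * c (1, true) * c (i, true) =
        -(c (i, true) * (c (0, true) * c (1, true))) := by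
      fin_cases i
      · exact hc.pair_mul_left (by simp)
      · exact hc.pair_mul_right (by simp)
    rw [mul_assoc, hcomm (0, false) (1, false) _ (by simp) (by simp), ← mul_assoc, h1, neg_mul,
      mul_assoc]

theorem tileParity_commute {z : A} {c : Fin 2 × Bool → A} (h : ∀ i, z * c i = -(c i * z)) :
    Commute (tileParity c) z :=
  ((commute_mul_of_anti (h _) (h _)).mul_right (commute_mul_of_anti (h _) (h _))).symm

/-- The generators of the tile `t`. -/
def tileGen (γ : ι × Fin 2 × Bool → A) (t : ι) : Fin 2 × Bool → A := fun i => γ (t, i)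

theorem IsClifford.tileGen {γ : ι × Fin 2 × Bool → A} (hγ : IsClifford γ) (t : ι) :
    IsClifford (tileGen γ t) :=
  ⟨fun _ => hγ.sq _, fun _ _ h => hγ.anti _ _ fun h' => h (Prod.ext_iff.mp h').2⟩

theorem IsClifford.tileGen_anti {γ : ι × Fin 2 × Bool → A} (hγ : IsClifford γ) {t t' : ι}
    (h : t ≠ t') (i j : Fin 2 × Bool) :
    _root_.tileGen γ t i * _root_.tileGen γ t' j = -(_root_.tileGen γ t' j * _root_.tileGen γ t i) :=
  hγ.anti _ _ fun h' => h (Prod.ext_iff.mp h').1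

variable [Algebra ℂ A]

/-- An element which commutes with every generator of a tile commutes with its even elements. -/
theorem Commute.tileOp_right {z : A} {c : Fin 2 × Bool → A} (h : ∀ i, Commute z (c i))
    (k : TileCoeff) : Commute z (tileOp k c) := by
  unfold tileOp
  refine ((((((Commute.one_right z).smul_right _).add_right (((h _).mul_right (h _)).smul_right _)).add_right
    (((h _).mul_right (h _)).smul_right _)).add_right
    ((((h _).mul_right (h _)).mul_right ((h _).mul_right (h _))).smul_right _)).add_right ?_)
  exact Commute.sum_right _ _ _ fun i _ => Commute.sum_right _ _ _ fun j _ =>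
    ((h _).mul_right (h _)).smul_right _

theorem commute_tileOp_of_anti {z : A} {c : Fin 2 × Bool → A} (h : ∀ i, z * c i = -(c i * z))
    (k : TileCoeff) : Commute z (tileOp k c) := by
  have hp : ∀ i j, Commute z (c i * c j) := fun i j => commute_mul_of_anti (h i) (h j)
  unfold tileOp
  refine ((((((Commute.one_right z).smul_right _).add_right ((hp _ _).smul_right _)).add_right
    ((hp _ _).smul_right _)).add_right
    (((hp _ _).mul_right (hp _ _)).smul_right _)).add_right ?_)
  exact Commute.sum_right _ _ _ fun i _ => Commute.sum_right _ _ _ fun j _ =>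
    (hp _ _).smul_right _

theorem IsClifford.commute_tileOp {γ : ι × Fin 2 × Bool → A} (hγ : IsClifford γ) {t t' : ι}
    (h : t ≠ t') (i : Fin 2 × Bool) (k : TileCoeff) :
    Commute (_root_.tileGen γ t i) (tileOp k (_root_.tileGen γ t')) :=
  commute_tileOp_of_anti (fun j => hγ.tileGen_anti h i j) k

/-- `a ↦ τ (a R)` is invariant under conjugation by involutions which commute with `R`. -/
theorem trace_conj_invariant {τ : A →ₗ[ℂ] ℂ} (hτ : ∀ a b, τ (a * b) = τ (b * a)) {u R : A}
    (hu : u * u = 1) (h : Commute u R) (a : A) : τ (u * (a * u) * R) = τ (a * R) := by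
  rw [mul_assoc, hτ, mul_assoc, mul_assoc, ← h.eq, ← mul_assoc u u, hu, one_mul]

/-- The trace of a product over distinct tiles factorises. -/
theorem trace_prod_tileOp {τ : A →ₗ[ℂ] ℂ} (hτ : ∀ a b, τ (a * b) = τ (b * a))
    {γ : ι × Fin 2 × Bool → A} (hγ : IsClifford γ) (k : TileCoeff) {l : List ι} (hl : l.Nodup) :
    τ (l.map fun t => tileOp k (tileGen γ t)).prod = k.one ^ l.length * τ 1 := by
  induction l with
  | nil => simp
  | cons t l ih =>
    rw [List.nodup_cons] at hl
    rw [List.map_cons, List.prod_cons, List.length_cons, pow_succ', mul_assoc, ← ih hl.2]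
    set R := (l.map fun t => tileOp k (tileGen γ t)).prod with hR
    have hcomm : ∀ i, Commute (tileGen γ t i) R := fun i => by
      refine Commute.list_prod_right _ _ fun x hx => ?_
      obtain ⟨t', ht', rfl⟩ := List.mem_map.mp hx
      exact hγ.commute_tileOp (by rintro rfl; exact hl.1 ht') i k
    have := (tileOp_coeff (f := τ ∘ₗ LinearMap.mulRight ℂ R) (hγ.tileGen t) k
      fun i a => trace_conj_invariant hτ ((hγ.tileGen t).sq i) (hcomm i) a).1
    simpa using this

/-- The relations between the coefficients of the tile projections which follow from the invariance of
their product `Q` under an automorphism `W` acting on the Majorana generators as a quantum walk with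
both amplitudes `a`, `b` nonzero.  In each of the three cases an element `z` is chosen whose image
`W z` contains a single odd generator in the tile `t₂`, so that the traces of `Q (W z) = W (Q z)` and
of `Q z` vanish; the latter, computed from the coefficients, gives the relation. -/
theorem tileCoeff_relations {τ : A →ₗ[ℂ] ℂ} (hτ : ∀ a b, τ (a * b) = τ (b * a))
    {γ : ι × Fin 2 × Bool → A} (hγ : IsClifford γ) {W : A →ₐ[ℂ] A} (hW : ∀ a, τ (W a) = τ a)
    {a b s : ℂ} (ha : a ≠ 0) (hb : b ≠ 0) (hs : s ^ 2 = 1) (hab : a ^ 2 + b ^ 2 = 1)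
    {t₀ t₁ t₂ : ι} (h02 : t₀ ≠ t₂) (h12 : t₁ ≠ t₂)
    (hWX : ∀ i, W (γ (t₁, i, true)) = b • (b • γ (t₂, i, true) - a • γ (t₂, i, false)) +
      (s * a) • (a • γ (t₁, i, true) + b • γ (t₁, i, false)))
    (hWY : ∀ i, W (γ (t₂, i, false)) = b • (a • γ (t₁, i, true) + b • γ (t₁, i, false)) -
      (s * a) • (b • γ (t₂, i, true) - a • γ (t₂, i, false)))
    (hWY' : ∀ i, W (γ (t₁, i, false)) = b • (a • γ (t₀, i, true) + b • γ (t₀, i, false)) -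
      (s * a) • (b • γ (t₁, i, true) - a • γ (t₁, i, false)))
    {k : TileCoeff} (hk : k.one ≠ 0) {R : A} (hR : τ R ≠ 0)
    (hR1 : ∀ i, Commute (tileGen γ t₁ i) R) (hR2 : ∀ i, Commute (tileGen γ t₂ i) R)
    (hQ : W (tileOp k (tileGen γ t₁) * (tileOp k (tileGen γ t₂) * R)) =
      tileOp k (tileGen γ t₁) * (tileOp k (tileGen γ t₂) * R)) :
    (∀ i j, k.xy i j = 0) ∧ k.xx = k.yy ∧ k.xxyy * k.one = k.yy ^ 2 := by
  set c₁ := tileGen γ t₁ with hc1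
  set c₂ := tileGen γ t₂ with hc2
  set P₁ := tileOp k c₁ with hP1
  set P₂ := tileOp k c₂ with hP2
  set Q := P₁ * (P₂ * R) with hQdef
  have hsa : s * a ≠ 0 := by
    refine mul_ne_zero ?_ ha
    rintro rfl
    norm_num at hs
  have hC1 : IsClifford c₁ := hγ.tileGen t₁
  have hC2 : IsClifford c₂ := hγ.tileGen t₂
  have hanti : ∀ i j, c₁ i * c₂ j = -(c₂ j * c₁ i) := fun i j => hγ.tileGen_anti h12 i j
  set K := tileParity c₂ with hK
  have hKK : K * K = 1 := tileParity_sq hC2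
  have hKne : ∀ t, t ≠ t₂ → ∀ i κ, Commute K (γ (t, i, κ)) := fun t ht i κ =>
    tileParity_commute fun j => hγ.tileGen_anti (t := t) (t' := t₂) ht (i, κ) j
  have hK2 : ∀ i κ, K * γ (t₂, i, κ) = -(γ (t₂, i, κ) * K) := fun i κ => tileParity_anti hC2 (i, κ)
  have hKR : Commute K R :=
    (((hR2 _).mul_left (hR2 _)).mul_left ((hR2 _).mul_left (hR2 _)))
  have hKP1 : Commute K P₁ := Commute.tileOp_right (fun i => hKne t₁ h12 i.1 i.2) k
  have hKP2 : Commute K P₂ := commute_tileOp_of_anti (fun i => tileParity_anti hC2 i) k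
  have hKQ : Commute K Q := hKP1.mul_right (hKP2.mul_right hKR)
  -- elements odd in the tile `t₂` have vanishing expectation value
  have hodd : ∀ w, K * w = -(w * K) → τ (Q * w) = 0 := by
    intro w hw
    have h1 : τ (K * (Q * w * K)) = τ (Q * w * K * K) := hτ _ _
    have h2 : K * (Q * w * K) = -(Q * w) := by
      rw [← mul_assoc, ← mul_assoc, hKQ.eq, mul_assoc Q, hw, mul_neg, neg_mul, mul_assoc,
        mul_assoc w, hKK, mul_one]
    rw [h2, mul_assoc _ K K, hKK, mul_one, map_neg] at h1
    exact self_eq_neg.mp h1.symm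
  have oddL : ∀ {p w}, Commute K p → K * w = -(w * K) → K * (p * w) = -(p * w * K) := by
    intro p w hp hw
    rw [← mul_assoc, hp.eq, mul_assoc, hw, mul_neg, mul_assoc]
  have oddR : ∀ {p w}, Commute K p → K * w = -(w * K) → K * (w * p) = -(w * p * K) := by
    intro p w hp hw
    rw [← mul_assoc, hw, neg_mul, mul_assoc, hp.eq, mul_assoc]
  have hinv : ∀ z, τ (Q * W z) = τ (Q * z) := fun z => by
    conv_lhs => rw [← hQ, ← map_mul, hW]
  -- the value of the product state on a product of even elements of the two tiles
  have hfac : ∀ z₁ z₂, (∀ i, Commute z₁ (c₂ i)) → Commute z₁ R → Commute R z₂ →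
      Q * (z₁ * z₂) = P₁ * z₁ * (P₂ * z₂ * R) := by
    intro z₁ z₂ h1 h2 h4
    have h3 : Commute z₁ P₂ := Commute.tileOp_right h1 k
    rw [mul_assoc P₂, ← h4.eq, hQdef, mul_assoc P₁, mul_assoc P₁, mul_assoc P₂, ← mul_assoc R,
      ← h2.eq, mul_assoc z₁, ← mul_assoc P₂, ← h3.eq, mul_assoc z₁]
  have hcoeff1 : ∀ {B : A}, (∀ i, Commute (c₁ i) B) → _ := fun {B} hB =>
    tileOp_coeff (f := τ ∘ₗ LinearMap.mulRight ℂ B) hC1 k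
      fun i z => trace_conj_invariant hτ (hC1.sq i) (hB i) z
  have hcoeff2 : ∀ {B : A}, (∀ i, Commute (c₂ i) B) → _ := fun {B} hB =>
    tileOp_coeff (f := τ ∘ₗ LinearMap.mulRight ℂ B) hC2 k
      fun i z => trace_conj_invariant hτ (hC2.sq i) (hB i) z
  simp only [LinearMap.comp_apply, LinearMap.mulRight_apply, one_mul] at hcoeff1 hcoeff2
  have hc1P2 : ∀ i, Commute (c₁ i) P₂ := fun i => hγ.commute_tileOp h12 i k
  have hB1 : ∀ i, Commute (c₁ i) (P₂ * R) := fun i => (hc1P2 i).mul_right (hR1 i)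
  have hev12 : ∀ i j l, Commute (c₁ l) (c₂ i * c₂ j) := fun i j l =>
    commute_mul_of_anti (hanti _ _) (hanti _ _)
  have hev21 : ∀ i j l, Commute (c₁ i * c₁ j) (c₂ l) := fun i j l =>
    (commute_mul_of_anti (by rw [hanti, neg_neg]) (by rw [hanti, neg_neg])).symm
  have hPR : τ (P₂ * R) = k.one * τ R := (hcoeff2 hR2).1
  have hone : b * b + (s * a) * (s * a) = 1 := by linear_combination a ^ 2 * hs + hab
  have hWu : ∀ i, W (b • γ (t₁, i, true) - (s * a) • γ (t₂, i, false)) =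
      b • γ (t₂, i, true) - a • γ (t₂, i, false) := fun i => by
    rw [map_sub, map_smul, map_smul, hWX, hWY]
    calc _ = (b * b + (s * a) * (s * a)) • (b • γ (t₂, i, true) - a • γ (t₂, i, false)) := by module
      _ = _ := by rw [hone, one_smul]
  have hWv : ∀ i, W ((s * a) • γ (t₁, i, true) + b • γ (t₂, i, false)) =
      a • γ (t₁, i, true) + b • γ (t₁, i, false) := fun i => by
    rw [map_add, map_smul, map_smul, hWX, hWY]
    calc _ = (b * b + (s * a) * (s * a)) • (a • γ (t₁, i, true) + b • γ (t₁, i, false)) := by module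
      _ = _ := by rw [hone, one_smul]
  have hKu : ∀ i, K * (b • γ (t₂, i, true) - a • γ (t₂, i, false)) =
      -((b • γ (t₂, i, true) - a • γ (t₂, i, false)) * K) := fun i => by
    rw [mul_sub, mul_smul_comm, mul_smul_comm, hK2, hK2, sub_mul, smul_mul_assoc, smul_mul_assoc]
    module
  have hKv : ∀ t, t ≠ t₂ → ∀ i (p q : ℂ), Commute K (p • γ (t, i, true) + q • γ (t, i, false)) :=
    fun t ht i p q => ((hKne t ht i _).smul_right _).add_right ((hKne t ht i _).smul_right _)
  have hKv' : ∀ t, t ≠ t₂ → ∀ i (p q : ℂ), Commute K (p • γ (t, i, true) - q • γ (t, i, false)) :=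
    fun t ht i p q => ((hKne t ht i _).smul_right _).sub_right ((hKne t ht i _).smul_right _)
  have hKWY : ∀ i, Commute K (W (γ (t₁, i, false))) := fun i => by
    rw [hWY']
    exact ((hKv t₀ h02 i _ _).smul_right _).sub_right ((hKv' t₁ h12 i _ _).smul_right _)
  have hRYY : Commute R (c₂ (0, false) * c₂ (1, false)) := ((hR2 _).mul_left (hR2 _)).symm
  have hBYY : ∀ i, Commute (c₁ i) (P₂ * (c₂ (0, false) * c₂ (1, false)) * R) := fun i =>
    ((hc1P2 i).mul_right (hev12 _ _ i)).mul_right (hR1 i)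
  have hXX : τ (Q * (γ (t₁, 0, true) * γ (t₁, 1, true))) = -k.xx * (k.one * τ R) := by
    have h := hfac (c₁ (0, true) * c₁ (1, true)) 1 (hev21 _ _) ((hR1 _).mul_left (hR1 _))
      (Commute.one_right _)
    rw [mul_one, mul_one] at h
    rw [← hPR, ← (hcoeff1 hB1).2.1, ← h]
    rfl
  have hYYXX : τ (Q * (γ (t₁, 0, false) * γ (t₁, 1, false) *
      (γ (t₁, 0, true) * γ (t₁, 1, true)))) = k.xxyy * (k.one * τ R) := by
    have h := hfac (c₁ (0, false) * c₁ (1, false) * (c₁ (0, true) * c₁ (1, true))) 1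
      (fun l => (hev21 _ _ l).mul_left (hev21 _ _ l))
      (((hR1 _).mul_left (hR1 _)).mul_left ((hR1 _).mul_left (hR1 _))) (Commute.one_right _)
    rw [mul_one, mul_one] at h
    rw [← hPR, ← (hcoeff1 hB1).2.2.2.1, ← h]
    rfl
  have hYY : τ (Q * (γ (t₂, 0, false) * γ (t₂, 1, false))) = k.one * (-k.yy * τ R) := by
    have h := hfac 1 (c₂ (0, false) * c₂ (1, false)) (fun i => Commute.one_left _)
      (Commute.one_left _) hRYY
    rw [mul_one, one_mul] at h
    rw [← (hcoeff2 hR2).2.2.1, ← (hcoeff1 hBYY).1, ← h]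
    rfl
  have hYYYY : τ (Q * (γ (t₁, 0, false) * γ (t₁, 1, false) *
      (γ (t₂, 0, false) * γ (t₂, 1, false)))) = -k.yy * (-k.yy * τ R) := by
    have h := hfac (c₁ (0, false) * c₁ (1, false)) (c₂ (0, false) * c₂ (1, false)) (hev21 _ _)
      ((hR1 _).mul_left (hR1 _)) hRYY
    rw [← (hcoeff2 hR2).2.2.1, ← (hcoeff1 hBYY).2.2.1, ← h]
    rfl
  refine ⟨fun i j => ?_, ?_, ?_⟩
  · have h1 := hinv (γ (t₁, j, false) * (b • γ (t₁, i, true) - (s * a) • γ (t₂, i, false)))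
    rw [map_mul W, hWu, hodd _ (oddL (hKWY j) (hKu i)), mul_sub, mul_smul_comm, mul_smul_comm, mul_sub,
      mul_smul_comm, mul_smul_comm, map_sub, map_smul, map_smul,
      hodd _ (oddL (hKne t₁ h12 j _) (hK2 i _)), smul_zero, sub_zero, smul_eq_mul] at h1
    have h2 : Q * (γ (t₁, j, false) * γ (t₁, i, true)) =
        P₁ * (c₁ (j, false) * c₁ (i, true)) * (P₂ * R) := by
      have := hfac (c₁ (j, false) * c₁ (i, true)) 1 (hev21 _ _)
        ((hR1 _).mul_left (hR1 _)) (Commute.one_right _)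
      rwa [mul_one, mul_one] at this
    rw [h2, (hcoeff1 hB1).2.2.2.2 i j, hPR] at h1
    have h3 := (mul_eq_zero.mp h1.symm).resolve_left hb
    exact (mul_eq_zero.mp h3).resolve_right (mul_ne_zero hk hR)
  · have h1 := hinv ((b • γ (t₁, 0, true) - (s * a) • γ (t₂, 0, false)) *
      ((s * a) • γ (t₁, 1, true) + b • γ (t₂, 1, false)))
    rw [map_mul W, hWu, hWv, hodd _ (oddR (hKv t₁ h12 1 _ _) (hKu 0))] at h1
    simp only [sub_mul, mul_add, mul_sub, smul_mul_assoc, mul_smul_comm, map_add, map_sub,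
      map_smul, smul_eq_mul, hodd _ (oddL (hKne t₁ h12 _ _) (hK2 _ _)),
      hodd _ (oddR (hKne t₁ h12 _ _) (hK2 _ _)), hXX, hYY, mul_zero] at h1
    have h2 : b * (s * a) * (k.one * τ R) * (k.xx - k.yy) = 0 := by linear_combination h1
    exact sub_eq_zero.mp ((mul_eq_zero.mp h2).resolve_left
      (mul_ne_zero (mul_ne_zero hb hsa) (mul_ne_zero hk hR)))
  · have h1 := hinv (γ (t₁, 0, false) * γ (t₁, 1, false) *
      ((b • γ (t₁, 0, true) - (s * a) • γ (t₂, 0, false)) *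
      ((s * a) • γ (t₁, 1, true) + b • γ (t₂, 1, false))))
    have hKYY : Commute K (γ (t₁, 0, false) * γ (t₁, 1, false)) :=
      (hKne t₁ h12 _ _).mul_right (hKne t₁ h12 _ _)
    rw [map_mul W, map_mul W, map_mul W, hWu, hWv, hodd _ (oddL ((hKWY 0).mul_right (hKWY 1))
      (oddR (hKv t₁ h12 1 _ _) (hKu 0)))] at h1
    simp only [sub_mul, mul_add, mul_sub, smul_mul_assoc, mul_smul_comm, map_add, map_sub,
      map_smul, smul_eq_mul, hodd _ (oddL hKYY (oddL (hKne t₁ h12 _ _) (hK2 _ _))),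
      hodd _ (oddL hKYY (oddR (hKne t₁ h12 _ _) (hK2 _ _))), hYYXX, hYYYY, mul_zero] at h1
    have h2 : b * (s * a) * τ R * (k.xxyy * k.one - k.yy ^ 2) = 0 := by linear_combination -h1
    exact sub_eq_zero.mp ((mul_eq_zero.mp h2).resolve_left
      (mul_ne_zero (mul_ne_zero hb hsa) hR))

end ProductState

/-! ### Even projections of a tile -/

section EvenTileOperators

theorem ZMod.two_cases (p : ZMod 2) : p = 0 ∨ p = 1 := by
  revert p; decide

theorem exists_even_expansion {m : CellAlg fermion} (hm : IsHomog fermion 0 m) :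
    ∃ p q : ℂ, m = p • 1 + q • (majX * majY) := by
  have h : ∀ m : Matrix (Fin 2) (Fin 2) ℂ, m 0 1 = 0 → m 1 0 = 0 →
      m = ((m 0 0 + m 1 1) / 2) • 1 +
        (-Complex.I * (m 0 0 - m 1 1) / 2) • (Complex.I • !![1, 0; 0, -1]) := by
    intro m h1 h2
    have hI := Complex.I_mul_I
    ext i j
    fin_cases i <;> fin_cases j <;> simp [h1, h2] <;> grind
  have h1 : (m : Matrix (Fin 2) (Fin 2) ℂ) 0 1 = 0 := by
    by_contra h0
    exact absurd (hm _ _ h0) (by decide)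
  have h2 : (m : Matrix (Fin 2) (Fin 2) ℂ) 1 0 = 0 := by
    by_contra h0
    exact absurd (hm _ _ h0) (by decide)
  exact ⟨_, _, by rw [majX_mul_majY]; exact h m h1 h2⟩

theorem exists_odd_expansion {m : CellAlg fermion} (hm : IsHomog fermion 1 m) :
    ∃ p q : ℂ, m = p • majX + q • majY := by
  have h : ∀ m : Matrix (Fin 2) (Fin 2) ℂ, m 0 0 = 0 → m 1 1 = 0 →
      m = ((m 0 1 + m 1 0) / 2) • !![0, 1; 1, 0] +
        (Complex.I * (m 0 1 - m 1 0) / 2) • !![0, -Complex.I; Complex.I, 0] := by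
    intro m h1 h2
    have hI := Complex.I_mul_I
    ext i j
    fin_cases i <;> fin_cases j <;> simp [h1, h2] <;> grind
  refine ⟨_, _, h m ?_ ?_⟩
  · by_contra h0
    exact absurd (hm _ _ h0) (by decide)
  · by_contra h0
    exact absurd (hm _ _ h0) (by decide)

theorem isHomog_single {C : Cell} (i j : Fin C.dim) :
    IsHomog C (C.par i + C.par j) (Matrix.single i j (1 : ℂ)) := by
  intro i' j' h
  have := Matrix.single_apply (i := i) (j := j) (c := (1 : ℂ)) i' j'
  rw [this] at h
  obtain ⟨rfl, rfl⟩ : i = i' ∧ j = j' := by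
    by_contra h'
    exact h (if_neg h')
  rfl

theorem place_single {C : Cell} {G : Type} [LinearOrder G] {F : Type} [Fintype F] [LinearOrder F]
    (σ τ : F → Fin C.dim) (s : F → G) :
    LocOp.place (Matrix.single σ τ (1 : ℂ) : LocOp C F) s =
      boxProd s fun y => Matrix.single (σ y) (τ y) 1 := by
  rw [LocOp.place, Finset.sum_eq_single σ, Finset.sum_eq_single τ]
  · rw [Matrix.single_apply_same, one_smul]
  · intro τ' _ h
    rw [Matrix.single_apply_of_col_ne _ _ h.symm, zero_smul]
  · simp
  · intro σ' _ h
    refine Finset.sum_eq_zero fun τ' _ => ?_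
    rw [Matrix.single_apply_of_row_ne h.symm, zero_smul]
  · simp

theorem boxProd_fin_two {C : Cell} {G : Type} [LinearOrder G] (s : Fin 2 → G)
    (M : Fin 2 → CellAlg C) : boxProd s M = cell (s 0) (M 0) * cell (s 1) (M 1) := by
  rw [boxProd, List.prod_map_eq_pair (y := 0) (z := 1) (Finset.sortedLT_sort _).pairwise (by simp)
    (by simp) (by simp)]
  intro w h0 h1
  omega

/-- The generators of the cells at the sites `s 0`, `s 1`. -/
noncomputable def pairGen {G : Type} [LinearOrder G] (s : Fin 2 → G) :
    Fin 2 × Bool → QuasiLocal fermion G := fun i => gen (s i.1, i.2)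

theorem isClifford_pairGen {G : Type} [LinearOrder G] {s : Fin 2 → G} (hs : Function.Injective s) :
    IsClifford (pairGen s) :=
  ⟨fun _ => isClifford_gen.sq _, fun _ _ h => isClifford_gen.anti _ _ fun h' =>
    h (Prod.ext (hs (Prod.ext_iff.mp h').1) (Prod.ext_iff.mp h').2)⟩

/-- An even operator of a tile of two modes is a combination of even products of Majorana generators,
with coefficients which do not depend on where the tile is placed. -/
theorem exists_tileCoeff {c : LocOp fermion (Fin 2)} (hc : c.IsHomog 0) :
    ∃ k : TileCoeff, ∀ (G : Type) [LinearOrder G] (s : Fin 2 → G), Function.Injective s →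
      c.place s = tileOp k (pairGen s) := by
  let S : Submodule ℂ (LocOp fermion (Fin 2)) :=
    { carrier := {c | ∃ k : TileCoeff, ∀ (G : Type) [LinearOrder G] (s : Fin 2 → G),
        Function.Injective s → c.place s = tileOp k (pairGen s)}
      add_mem' := by
        rintro c d ⟨k, hk⟩ ⟨l, hl⟩
        refine ⟨⟨k.one + l.one, k.xx + l.xx, k.yy + l.yy, k.xxyy + l.xxyy, k.xy + l.xy⟩, ?_⟩
        intro G _ s hs
        have h := map_add (placeLin fermion s) c d
        simp only [placeLin_apply, hk G s hs, hl G s hs] at h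
        rw [h]
        simp only [tileOp, Fin.sum_univ_two, Pi.add_apply]
        module
      zero_mem' := by
        refine ⟨⟨0, 0, 0, 0, 0⟩, fun G _ s hs => ?_⟩
        have h := map_zero (placeLin fermion s)
        rw [placeLin_apply] at h
        rw [h]
        simp [tileOp]
      smul_mem' := by
        rintro a c ⟨k, hk⟩
        refine ⟨⟨a * k.one, a * k.xx, a * k.yy, a * k.xxyy, fun i j => a * k.xy i j⟩, ?_⟩
        intro G _ s hs
        have h := map_smul (placeLin fermion s) a c
        simp only [placeLin_apply, hk G s hs] at h
        rw [h]
        simp only [tileOp, Fin.sum_univ_two]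
        module }
  change c ∈ S
  rw [Matrix.matrix_eq_sum_single c]
  refine S.sum_mem fun σ _ => S.sum_mem fun τ _ => ?_
  by_cases h0 : c σ τ = 0
  · rw [h0, Matrix.single_zero]
    exact S.zero_mem
  have hpar := hc σ τ h0
  rw [← mul_one (c σ τ), ← smul_eq_mul, ← Matrix.smul_single]
  refine S.smul_mem _ ?_
  rw [Fin.sum_univ_two] at hpar
  have h0 := isHomog_single (C := fermion) (σ 0) (τ 0)
  have h1 := isHomog_single (C := fermion) (σ 1) (τ 1)
  have hpl : ∀ (G : Type) [LinearOrder G] (s : Fin 2 → G),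
      LocOp.place (Matrix.single σ τ (1 : ℂ) : LocOp fermion (Fin 2)) s =
        cell (s 0) (Matrix.single (σ 0) (τ 0) 1) * cell (s 1) (Matrix.single (σ 1) (τ 1) 1) :=
    fun G _ s => by rw [place_single, boxProd_fin_two]
  rcases ZMod.two_cases (fermion.par (σ 0) + fermion.par (τ 0)) with hp | hp
  · rw [hp, zero_add] at hpar
    rw [hp] at h0
    rw [hpar] at h1
    obtain ⟨p, q, e0⟩ := exists_even_expansion h0
    obtain ⟨p', q', e1⟩ := exists_even_expansion h1
    refine ⟨⟨p * p', 0, 0, -(q * q'), !![q * p', 0; 0, p * q']⟩, fun G _ s hs => ?_⟩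
    rw [hpl, e0, e1]
    have hanti := (isClifford_pairGen hs).anti (0, false) (1, true) (by simp)
    simp only [cell_add, cell_smul, cell_mul, cell_one, tileOp, Fin.sum_univ_two]
    change (p • 1 + q • (pairGen s (0, true) * pairGen s (0, false))) *
      (p' • 1 + q' • (pairGen s (1, true) * pairGen s (1, false))) = _
    have e : pairGen s (0, true) * pairGen s (0, false) *
        (pairGen s (1, true) * pairGen s (1, false)) =
        -(pairGen s (0, true) * pairGen s (1, true) *
          (pairGen s (0, false) * pairGen s (1, false))) := by
      rw [mul_assoc, ← mul_assoc (pairGen s (0, false)), hanti]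
      noncomm_ring
    simp only [mul_add, add_mul, smul_mul_smul_comm, one_mul, mul_one, e, Matrix.of_apply,
      Matrix.cons_val', Matrix.cons_val_zero, Matrix.cons_val_one, Matrix.cons_val_fin_one]
    module
  · rw [hp] at hpar h0
    have hp1 : fermion.par (σ 1) + fermion.par (τ 1) = 1 := by
      rcases ZMod.two_cases (fermion.par (σ 1) + fermion.par (τ 1)) with h | h
      · rw [h] at hpar; exact absurd hpar (by decide)
      · exact h
    rw [hp1] at h1
    obtain ⟨p, q, e0⟩ := exists_odd_expansion h0
    obtain ⟨p', q', e1⟩ := exists_odd_expansion h1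
    refine ⟨⟨0, p * p', q * q', 0, !![0, p * q'; -(q * p'), 0]⟩, fun G _ s hs => ?_⟩
    rw [hpl, e0, e1]
    have hanti := (isClifford_pairGen hs).anti (0, false) (1, true) (by simp)
    simp only [cell_add, cell_smul, tileOp, Fin.sum_univ_two]
    change (p • pairGen s (0, true) + q • pairGen s (0, false)) *
      (p' • pairGen s (1, true) + q' • pairGen s (1, false)) = _
    simp only [mul_add, add_mul, smul_mul_smul_comm, hanti, Matrix.of_apply,
      Matrix.cons_val', Matrix.cons_val_zero, Matrix.cons_val_one, Matrix.cons_val_fin_one]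
    module

end EvenTileOperators

section Projections

open ContinuousLinearMap in
/-- A nonzero projection of a tile has a nonzero scalar part: averaging it over conjugations by
Majorana generators gives a multiple of the scalar part, and cannot cancel its positive expectation
values. -/
theorem tileCoeff_one_ne_zero {k : TileCoeff} {s : Fin 2 → ℤ} (hs : Function.Injective s)
    (hstar : star (tileOp k (pairGen s)) = tileOp k (pairGen s))
    (hmul : tileOp k (pairGen s) * tileOp k (pairGen s) = tileOp k (pairGen s))
    (hne : tileOp k (pairGen s) ≠ 0) : k.one ≠ 0 := by
  intro h0
  apply hne
  set P := tileOp k (pairGen s) with hP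
  set c := pairGen s with hc
  have hC : IsClifford c := isClifford_pairGen hs
  let op : QuasiLocal fermion ℤ →ₐ[ℂ] (Fock fermion ℤ →L[ℂ] Fock fermion ℤ) :=
    (StarAlgebra.adjoin ℂ {a : Fock fermion ℤ →L[ℂ] Fock fermion ℤ |
      ∃ x m, a = cellOp x m}).topologicalClosure.toSubalgebra.val
  let q : QuasiLocal fermion ℤ → Fock fermion ℤ → ℝ := fun a ψ => (inner ℂ (op a ψ) ψ).re
  have hadj : ∀ a ψ φ, inner ℂ (op (star a) ψ) φ = inner ℂ ψ (op a φ) := fun a ψ φ =>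
    adjoint_inner_left (op a) φ ψ
  have hconj : ∀ i a ψ, q (a + c i * (a * c i)) ψ = q a ψ + q a (op (c i) ψ) := by
    intro i a ψ
    have h1 : inner ℂ (op (c i * (a * c i)) ψ) ψ = inner ℂ (op a (op (c i) ψ)) (op (c i) ψ) := by
      have h2 := hadj (c i) (op (a * c i) ψ) ψ
      rw [show star (c i) = c i from star_gen _] at h2
      rw [map_mul]
      change inner ℂ (op (c i) (op (a * c i) ψ)) ψ = _
      rw [h2, map_mul]
      rfl
    change (inner ℂ (op (a + c i * (a * c i)) ψ) ψ).re = _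
    rw [map_add, add_apply, inner_add_left, h1, Complex.add_re]
  have hqP : ∀ ψ, q P ψ = ‖op P ψ‖ ^ 2 := by
    intro ψ
    have h1 := hadj P (op P ψ) ψ
    rw [hstar] at h1
    have h2 : op P (op P ψ) = op P ψ := by
      change (op P * op P) ψ = _
      rw [← map_mul, hmul]
    rw [h2] at h1
    have h3 : inner ℂ (op P ψ) (op P ψ) = inner ℂ (op P ψ) ψ := by
      have := hadj P (op P ψ) ψ
      rw [hstar, h2] at this
      exact this.symm
    change (inner ℂ (op P ψ) ψ).re = _
    rw [← h3, inner_self_eq_norm_sq_to_K]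
    norm_cast
  have step : ∀ i a, (∀ ψ, 0 ≤ q a ψ) → (∀ ψ, q (a + c i * (a * c i)) ψ = 0) → ∀ ψ, q a ψ = 0 := by
    intro i a ha h ψ
    have h1 := h ψ
    rw [hconj] at h1
    linarith [ha ψ, ha (op (c i) ψ)]
  have pos : ∀ i a, (∀ ψ, 0 ≤ q a ψ) → ∀ ψ, 0 ≤ q (a + c i * (a * c i)) ψ := by
    intro i a ha ψ
    rw [hconj]
    exact add_nonneg (ha _) (ha _)
  have hpos : ∀ ψ, 0 ≤ q P ψ := fun ψ => by rw [hqP]; positivity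
  set a₁ := P + c (0, true) * (P * c (0, true)) with ha1
  set a₂ := a₁ + c (1, true) * (a₁ * c (1, true)) with ha2
  set a₃ := a₂ + c (0, false) * (a₂ * c (0, false)) with ha3
  have h3 : a₃ = 0 := by
    obtain ⟨x0, hx0⟩ : ∃ x, x = c (0, true) := ⟨_, rfl⟩
    obtain ⟨x1, hx1⟩ : ∃ x, x = c (1, true) := ⟨_, rfl⟩
    obtain ⟨y0, hy0⟩ : ∃ x, x = c (0, false) := ⟨_, rfl⟩
    obtain ⟨y1, hy1⟩ : ∃ x, x = c (1, false) := ⟨_, rfl⟩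
    have s1 := hC.sq (0, true); have s2 := hC.sq (1, true)
    have s3 := hC.sq (0, false)
    have b1 := hC.anti (1, true) (0, true) (by simp)
    have b2 := hC.anti (0, false) (0, true) (by simp)
    have b3 := hC.anti (1, false) (0, true) (by simp)
    have b4 := hC.anti (0, false) (1, true) (by simp)
    have b5 := hC.anti (1, false) (1, true) (by simp)
    have b6 := hC.anti (1, false) (0, false) (by simp)
    rw [ha3, ha2, ha1, hP]
    simp only [tileOp, Fin.sum_univ_two, h0, zero_smul, zero_add]
    rw [← hx0, ← hx1, ← hy0, ← hy1] at *
    have left : ∀ {p q : QuasiLocal fermion ℤ}, p * q = -(q * p) →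
        ∀ a, p * (q * a) = -(q * (p * a)) := fun h a => by
      rw [← mul_assoc, h, neg_mul, mul_assoc]
    have left' : ∀ {p : QuasiLocal fermion ℤ}, p * p = 1 → ∀ a, p * (p * a) = a := fun h a => by
      rw [← mul_assoc, h, one_mul]
    have d1 := left b1; have d2 := left b2
    have d4 := left b4
    have t1 := left' s1; have t2 := left' s2; have t3 := left' s3
    simp only [mul_assoc, add_mul, mul_add, smul_mul_assoc, mul_smul_comm, s2, s3, t1, t2, t3,
      b1, b2, b3, b4, b5, b6, d1, d2, d4, mul_neg, neg_mul, neg_neg, mul_one, smul_neg]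
    module
  have hq3 : ∀ ψ, q a₃ ψ = 0 := fun ψ => by
    change (inner ℂ (op a₃ ψ) ψ).re = 0
    rw [h3, map_zero]
    simp
  have hq2 := step _ _ (pos _ _ (pos _ _ hpos)) hq3
  have hq1 := step _ _ (pos _ _ hpos) hq2
  have hq0 := step _ _ hpos hq1
  have hop : op P = 0 := by
    ext1 ψ
    have := hq0 ψ
    rw [hqP] at this
    exact norm_eq_zero.mp (pow_eq_zero_iff two_ne_zero |>.mp this)
  exact Subtype.ext hop

end Projections

/-! ### Corners of rank one -/

section RankOne

variable {A : Type*} [Ring A] [Algebra ℂ A]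

theorem eq_zero_of_smul_one_add_smul [Nontrivial A] {z a : A} (hz : z * z = 1)
    (ha : a * a = -1) (hza : z * a = -(a * z)) {p q : ℂ} (h : p • (1 : A) + q • a = 0) :
    p = 0 ∧ q = 0 := by
  have h1 : z * ((p • (1 : A) + q • a) * z) = p • (1 : A) - q • a := by
    rw [add_mul, mul_add, smul_mul_assoc, smul_mul_assoc, one_mul, mul_smul_comm, mul_smul_comm, hz,
      ← mul_assoc, hza, neg_mul, mul_assoc, hz, mul_one, smul_neg, sub_eq_add_neg]
  rw [h, zero_mul, mul_zero] at h1
  have h2 : (2 * p) • (1 : A) = 0 := by linear_combination (norm := module) h - h1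
  have hp : p = 0 := by simpa using h2
  refine ⟨hp, ?_⟩
  rw [hp, zero_smul, zero_add] at h
  have h3 : q • (a * a) = 0 := by rw [← smul_mul_assoc, h, zero_mul]
  rw [ha] at h3
  simpa using h3

/-- A projection of a tile other than the identity, subject to the relations of
`tileCoeff_relations`, has even corner `ℂ P`: it is the joint spectral projection of `X₀X₁` and
`Y₀Y₁` for the same eigenvalue. -/
theorem exists_smul_of_tileCoeff_relations [Nontrivial A] {c : Fin 2 × Bool → A}
    (hc : IsClifford c) {k : TileCoeff} (hk : k.one ≠ 0) (hxy : ∀ i j, k.xy i j = 0)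
    (hxx : k.xx = k.yy) (hxxyy : k.xxyy * k.one = k.yy ^ 2)
    (hmul : tileOp k c * tileOp k c = tileOp k c) (hne : tileOp k c ≠ 1) (k' : TileCoeff) :
    ∃ r : ℂ, tileOp k c * tileOp k' c * tileOp k c = r • tileOp k c := by
  obtain ⟨a, ha⟩ : ∃ a, a = c (0, true) * c (1, true) := ⟨_, rfl⟩
  obtain ⟨b, hb⟩ : ∃ b, b = c (0, false) * c (1, false) := ⟨_, rfl⟩
  have haa : a * a = -1 := by rw [ha]; exact hc.pair_sq (by simp)
  have hbb : b * b = -1 := by rw [hb]; exact hc.pair_sq (by simp)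
  have hax : ∀ i, a * c (i, true) = -(c (i, true) * a) := by
    rw [ha, Fin.forall_fin_two]
    exact ⟨hc.pair_mul_left (by simp), hc.pair_mul_right (by simp)⟩
  have hay : ∀ i, a * c (i, false) = c (i, false) * a := fun i => by
    rw [ha]; exact hc.pair_comm (by simp) (by simp)
  have hby : ∀ i, b * c (i, false) = -(c (i, false) * b) := by
    rw [hb, Fin.forall_fin_two]
    exact ⟨hc.pair_mul_left (by simp), hc.pair_mul_right (by simp)⟩
  have hbx : ∀ i, b * c (i, true) = c (i, true) * b := fun i => by
    rw [hb]; exact hc.pair_comm (by simp) (by simp)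
  have hab : a * b = b * a := by
    rw [hb, ← mul_assoc, hay, mul_assoc, hay, ← mul_assoc]
  obtain ⟨P, hP⟩ : ∃ P, P = tileOp k c := ⟨_, rfl⟩
  rw [← hP] at hmul hne ⊢
  have hP' : P = k.one • 1 + k.yy • a + k.yy • b + k.xxyy • (a * b) := by
    rw [hP, tileOp]
    simp only [hxy, hxx, zero_smul, Finset.sum_const_zero, add_zero, ha, hb]
  have r1 : b * (a * b) = -a := by rw [hab, ← mul_assoc, hbb, neg_one_mul]
  have r2 : a * (a * b) = -b := by rw [← mul_assoc, haa, neg_one_mul]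
  have r3 : a * b * a = -b := by rw [mul_assoc, ← hab, r2]
  have r4 : a * b * b = -a := by rw [mul_assoc, hbb, mul_neg_one]
  have r5 : a * b * (a * b) = 1 := by rw [mul_assoc, r1, mul_neg, haa, neg_neg]
  have hPP : (k.one ^ 2 - 2 * k.yy ^ 2 + k.xxyy ^ 2 - k.one) • (1 : A) +
      (2 * k.yy * (k.one - k.xxyy) - k.yy) • b +
      a * ((2 * k.yy * (k.one - k.xxyy) - k.yy) • (1 : A) +
        (2 * k.one * k.xxyy + 2 * k.yy ^ 2 - k.xxyy) • b) = 0 := by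
    have h1 : P * P - P = 0 := by rw [hmul, sub_self]
    rw [← h1, hP']
    simp only [mul_add, add_mul, smul_mul_assoc, mul_smul_comm, mul_one, one_mul, haa, hbb, ← hab,
      r1, r2, r3, r4, r5]
    module
  obtain ⟨x, hx⟩ : ∃ x, x = c (0, true) := ⟨_, rfl⟩
  have hxx1 : x * x = 1 := by rw [hx]; exact hc.sq _
  have hxa : x * a = -(a * x) := by rw [hx, hax, neg_neg]
  have hxb : x * b = b * x := by rw [hx, hbx]
  obtain ⟨y, hy⟩ : ∃ x, x = c (0, false) := ⟨_, rfl⟩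
  have hyy1 : y * y = 1 := by rw [hy]; exact hc.sq _
  have hyb : y * b = -(b * y) := by rw [hy, hby, neg_neg]
  obtain ⟨e1, e2, e3⟩ : k.one ^ 2 - 2 * k.yy ^ 2 + k.xxyy ^ 2 - k.one = 0 ∧
      2 * k.yy * (k.one - k.xxyy) - k.yy = 0 ∧
      2 * k.one * k.xxyy + 2 * k.yy ^ 2 - k.xxyy = 0 := by
    have split : ∀ p q r s : ℂ, p • (1 : A) + q • b + a * (r • (1 : A) + s • b) = 0 →
        p = 0 ∧ q = 0 ∧ r = 0 ∧ s = 0 := by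
      intro p q r s h
      have hu : x * (p • (1 : A) + q • b) = (p • (1 : A) + q • b) * x := by
        simp only [mul_add, add_mul, mul_smul_comm, smul_mul_assoc, hxb, mul_one, one_mul]
      have hv : x * (r • (1 : A) + s • b) = (r • (1 : A) + s • b) * x := by
        simp only [mul_add, add_mul, mul_smul_comm, smul_mul_assoc, hxb, mul_one, one_mul]
      obtain ⟨u, hu'⟩ : ∃ u, u = p • (1 : A) + q • b := ⟨_, rfl⟩
      obtain ⟨v, hv'⟩ : ∃ v, v = r • (1 : A) + s • b := ⟨_, rfl⟩
      rw [← hu', ← hv'] at h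
      rw [← hu'] at hu
      rw [← hv'] at hv
      have h1 : x * ((u + a * v) * x) = u - a * v := by
        rw [add_mul, mul_add, ← mul_assoc, hu, mul_assoc, hxx1, mul_one, mul_assoc, ← hv,
          ← mul_assoc a, ← mul_assoc, ← mul_assoc, hxa, neg_mul, mul_assoc a, hxx1, mul_one, neg_mul,
          sub_eq_add_neg]
      rw [h, zero_mul, mul_zero] at h1
      have hu0 : u = 0 := by
        have h2 : (2 : ℂ) • u = 0 := by linear_combination (norm := module) h - h1
        simpa using h2
      have hv0 : v = 0 := by
        rw [hu0, zero_add] at h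
        have h2 : a * (a * v) = 0 := by rw [h, mul_zero]
        rwa [← mul_assoc, haa, neg_one_mul, neg_eq_zero] at h2
      obtain ⟨h3, h4⟩ := eq_zero_of_smul_one_add_smul hyy1 hbb hyb (hu' ▸ hu0)
      obtain ⟨h5, h6⟩ := eq_zero_of_smul_one_add_smul hyy1 hbb hyb (hv' ▸ hv0)
      exact ⟨h3, h4, h5, h6⟩
    obtain ⟨e1, e2, -, e3⟩ := split _ _ _ _ hPP
    exact ⟨e1, e2, e3⟩
  have h4 : k.xxyy * (4 * k.one - 1) = 0 := by linear_combination e3 + 2 * hxxyy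
  have hd : k.xxyy ≠ 0 := by
    intro h0
    rw [h0, zero_mul] at hxxyy
    have hy0 : k.yy = 0 := pow_eq_zero_iff two_ne_zero |>.mp hxxyy.symm
    rw [h0, hy0] at e1
    have h1 : k.one * (k.one - 1) = 0 := by linear_combination e1
    have h2 : k.one = 1 := sub_eq_zero.mp ((mul_eq_zero.mp h1).resolve_left hk)
    exact hne (by rw [hP', h0, hy0, h2]; simp)
  have hone : k.one = 1 / 4 := by
    linear_combination (1 / 4 : ℂ) * (mul_eq_zero.mp h4).resolve_left hd
  have hyy : k.yy ≠ 0 := by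
    intro h0
    rw [h0, hone] at hxxyy
    exact hd (by linear_combination 4 * hxxyy)
  have hxxyy' : k.xxyy = -1 / 4 := by
    have h1 : k.yy * (2 * (k.one - k.xxyy) - 1) = 0 := by linear_combination e2
    have h2 := (mul_eq_zero.mp h1).resolve_left hyy
    rw [hone] at h2
    linear_combination (-1 / 2 : ℂ) * h2
  obtain ⟨q, hq⟩ : ∃ q, k.yy = q / 4 := ⟨4 * k.yy, by ring⟩
  have hqq : q * q = -1 := by
    rw [hone, hxxyy', hq] at hxxyy
    linear_combination (-16 : ℂ) * hxxyy
  have hq0 : q ≠ 0 := by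
    rintro rfl
    exact hyy (by rw [hq, zero_div])
  have hP4 : P = (1 / 4 : ℂ) • (1 + q • a + q • b - a * b) := by
    rw [hP', hone, hxxyy', hq]
    module
  have haP : a * P = -q • P := by
    rw [hP4, smul_comm, mul_smul_comm]
    congr 1
    simp only [mul_add, mul_sub, smul_add, smul_sub, mul_smul_comm, smul_smul, haa, mul_one, r2,
      neg_mul, hqq]
    module
  have hbP : b * P = -q • P := by
    rw [hP4, smul_comm, mul_smul_comm]
    congr 1
    simp only [mul_add, mul_sub, smul_add, smul_sub, mul_smul_comm, smul_smul, hbb, mul_one, r1,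
      neg_mul, hqq, ← hab]
    module
  have hPa : P * a = -q • P := by
    rw [← haP, hP4]
    simp only [mul_add, mul_sub, add_mul, sub_mul, mul_smul_comm, smul_mul_assoc, r2, r3, ← hab,
      one_mul, mul_one]
  have hmix : ∀ i j, P * (c (i, true) * c (j, false)) * P = 0 := by
    intro i j
    obtain ⟨z, hz⟩ : ∃ z, z = c (i, true) * c (j, false) := ⟨_, rfl⟩
    have h1 : a * z = -(z * a) := by
      rw [hz, ← mul_assoc, hax, neg_mul, mul_assoc, hay, mul_assoc]
    rw [← hz]
    have h2 : P * (z * a) * P = -q • (P * z * P) := by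
      rw [mul_assoc, mul_assoc, haP, mul_smul_comm, mul_smul_comm, mul_assoc]
    have h3 : P * (z * a) * P = q • (P * z * P) := by
      rw [← neg_eq_iff_eq_neg.mpr h1, mul_neg, ← mul_assoc, hPa]
      simp only [smul_mul_assoc, neg_mul, neg_smul, neg_neg]
    rw [h2] at h3
    have h4 : (2 * q) • (P * z * P) = 0 := by linear_combination (norm := module) -h3
    exact (smul_eq_zero.mp h4).resolve_left (mul_ne_zero two_ne_zero hq0)
  refine ⟨k'.one - q * k'.xx - q * k'.yy - k'.xxyy, ?_⟩
  have expand : tileOp k' c = k'.one • 1 + k'.xx • a + k'.yy • b + k'.xxyy • (a * b) +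
      ∑ i, ∑ j, k'.xy i j • (c (i, true) * c (j, false)) := by rw [tileOp, ha, hb]
  have habP : a * b * P = -P := by
    rw [mul_assoc, hbP, mul_smul_comm, haP, smul_smul, neg_mul_neg, hqq, neg_one_smul]
  rw [expand]
  simp only [mul_add, add_mul, Finset.mul_sum, Finset.sum_mul, mul_smul_comm, smul_mul_assoc, hmix,
    smul_zero, Finset.sum_const_zero, add_zero]
  rw [mul_assoc P a P, mul_assoc P b P, mul_assoc P (a * b) P, haP, hbP, habP]
  simp only [mul_smul_comm, mul_neg, hmul, mul_one]
  module

end RankOne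

section NoGoDimension

theorem isHomog_one (C : Cell) : IsHomog C 0 1 := by
  intro i j h
  obtain rfl : i = j := by
    by_contra h'
    exact h (Matrix.one_apply_ne h')
  exact CharTwo.add_self_eq_zero _

/-- If all even elements of the corner of the tile projection are multiples of the projection, then
the coarse-grained cell is trivial. -/
theorem IsTileIsometry.dim_lt_two {C C' : Cell} {N : ℕ} {e : CellAlg C' →ₗ[ℂ] LocOp C (Fin N)}
    (he : IsTileIsometry e)
    (h : ∀ c : LocOp C (Fin N), c.IsHomog 0 → ∃ r : ℂ, (e 1).place (tileSite N) *
      c.place (tileSite N) * (e 1).place (tileSite N) = r • (e 1).place (tileSite N)) :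
    C'.dim < 2 := by
  by_contra! hdim
  obtain ⟨a, ha⟩ : ∃ a : CellAlg C', a = Matrix.single 0 0 1 := ⟨_, rfl⟩
  have ha0 : IsHomog C' 0 a := by
    have := isHomog_single (C := C') 0 0
    rwa [CharTwo.add_self_eq_zero, ← ha] at this
  obtain ⟨r, hr⟩ := h (e a) (he.graded 0 a ha0)
  rw [← he.map_mul, ← he.map_mul, one_mul, mul_one] at hr
  have h1 : (e (a - r • 1)).place (tileSite N) = 0 := by
    have h2 := map_sub (placeLin C (tileSite N)) (e a) (r • e 1)
    rw [map_smul, placeLin_apply, placeLin_apply, placeLin_apply] at h2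
    rw [map_sub, map_smul, h2, hr, sub_self]
  have h3 := he.injective _ h1
  have h00 : (a - r • (1 : CellAlg C')) 0 0 = 0 := by rw [h3]; rfl
  have h11 : (a - r • (1 : CellAlg C')) ⟨1, hdim⟩ ⟨1, hdim⟩ = 0 := by rw [h3]; rfl
  have hne : (0 : Fin C'.dim) ≠ ⟨1, hdim⟩ := by
    intro h'
    have := congrArg Fin.val h'
    simp at this
  rw [Matrix.sub_apply, Matrix.smul_apply, Matrix.one_apply_eq, ha] at h00 h11
  rw [Matrix.single_apply_same] at h00
  rw [Matrix.single_apply_of_row_ne hne] at h11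
  simp only [smul_eq_mul, mul_one, zero_sub, neg_eq_zero] at h00 h11
  rw [h11] at h00
  norm_num at h00

end NoGoDimension

/-! ### The Forking automaton on rings, and the necessity of a special gate -/

section Wrappings

theorem ringSite_eq_iff {n : ℕ} [NeZero n] {x y : ℤ} :
    ringSite n x = ringSite n y ↔ (n : ℤ) ∣ x - y := by
  have hn : (0 : ℤ) < n := by exact_mod_cast Nat.pos_of_ne_zero (NeZero.ne n)
  have hx := Int.emod_nonneg x hn.ne'
  have hy := Int.emod_nonneg y hn.ne'
  rw [ringSite, ringSite, Fin.mk.injEq, dvd_sub_comm, ← Int.modEq_iff_dvd, Int.ModEq]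
  omega

theorem ringTileSite_eq {m N : ℕ} [NeZero (m * N)] (x : Fin m) (j : Fin N) :
    ringTileSite m N x j = ringSite (m * N) (N * x.val + j.val) := by
  apply Fin.ext
  have h : (((ringTileSite m N x j).val : ℕ) : ℤ) = N * x.val + j.val := by
    rw [ringTileSite, finProdFinEquiv_apply_val]
    push_cast
    ring
  have hlt := (ringTileSite m N x j).isLt
  rw [ringSite, ← h]
  change _ = Int.toNat ((((ringTileSite m N x j).val : ℕ) : ℤ) % ((m * N : ℕ) : ℤ))
  rw [Int.emod_eq_of_lt (by positivity) (by exact_mod_cast hlt), Int.toNat_natCast]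

theorem ringTileSite_injective (m N : ℕ) :
    Function.Injective fun p : Fin m × Fin N => ringTileSite m N p.1 p.2 := finProdFinEquiv.injective

/-- All sufficiently long rings wrap a given neighbourhood scheme regularly. -/
theorem exists_forall_isRegularWrapping (𝒩 : Finset ℤ) :
    ∃ K : ℕ, ∀ (n : ℕ) [NeZero n], K ≤ n → IsRegularWrapping 𝒩 n := by
  obtain ⟨B, hB⟩ : ∃ B : ℕ, ∀ y ∈ 𝒩, |y| ≤ B := by
    refine ⟨𝒩.sup Int.natAbs, fun y hy => ?_⟩
    rw [Int.abs_eq_natAbs]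
    exact_mod_cast Finset.le_sup (f := Int.natAbs) hy
  -- sites in two overlapping neighbourhoods are at most `4 B` apart, so a longer ring cannot
  -- identify distinct ones
  refine ⟨4 * B + 1, fun n _ hn x y => ?_⟩
  have hmem : ∀ x z : ℤ, z ∈ nbhd 𝒩 x → |z - x| ≤ B := by
    rintro x _ ⟨w, hw, rfl⟩
    rw [add_sub_cancel_left]
    exact hB w hw
  have hring : ∀ z w : ℤ, ringSite n z = ringSite n w → |z - w| ≤ 4 * B → z = w := by
    intro z w h hzw
    rw [ringSite_eq_iff] at h
    have := Int.eq_zero_of_abs_lt_dvd h (by omega)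
    omega
  rintro ⟨v, hvx, hvy⟩
  have h1 := abs_le.mp (hmem x v hvx)
  have h2 := abs_le.mp (hmem y v hvy)
  ext z
  constructor
  · rintro ⟨⟨⟨z₁, hz₁, e₁⟩, ⟨z₂, hz₂, e₂⟩⟩, hz⟩
    have h3 := abs_le.mp (hmem x z₁ hz₁)
    have h4 := abs_le.mp (hmem y z₂ hz₂)
    have h5 : |z - x| ≤ 3 * B ∧ |z - y| ≤ 3 * B := by
      rcases hz with hz | hz
      · have := abs_le.mp (hmem x z hz)
        constructor <;> rw [abs_le] <;> omega
      · have := abs_le.mp (hmem y z hz)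
        constructor <;> rw [abs_le] <;> omega
    rw [abs_le, abs_le] at h5
    have e1 : z₁ = z := hring _ _ e₁ (by rw [abs_le]; omega)
    have e2 : z₂ = z := hring _ _ e₂ (by rw [abs_le]; omega)
    exact ⟨e1 ▸ hz₁, e2 ▸ hz₂⟩
  · rintro ⟨hx, hy⟩
    exact ⟨⟨⟨z, hx, rfl⟩, ⟨z, hy, rfl⟩⟩, Or.inl hx⟩

theorem FCA.rule_eq_oneSite {C : Cell} (T : FCA C) {y : ℤ} (hy : y ∈ T.scheme) {m m' : CellAlg C}
    (h : T.aut (cell 0 m) = cell y m') : T.rule m = LocOp.oneSite ⟨y, hy⟩ m' := by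
  have hinj : Function.Injective fun z : T.scheme => (0 : ℤ) + (z : ℤ) := fun z w hzw =>
    Subtype.ext (add_left_cancel hzw)
  refine LocOp.place_injective hinj ?_
  change (T.rule m).place _ = _
  rw [← T.aut_cell, h]
  refine Eq.trans ?_ (LocOp.place_oneSite _ _ _).symm
  rw [zero_add]

/-- If the automaton on the line maps an element of a cell to an element of a single cell, then so do
its wrappings. -/
theorem IsWrapping.apply_cell {C : Cell} {T : FCA C} {n : ℕ} [NeZero n]
    {Tw : QuasiLocal C (Fin n) ≃⋆ₐ[ℂ] QuasiLocal C (Fin n)} (h : IsWrapping T n Tw) {y : ℤ}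
    (hy : y ∈ T.scheme) {m m' : CellAlg C} (hm : T.aut (cell 0 m) = cell y m') (x : ℤ) :
    Tw (cell (ringSite n x) m) = cell (ringSite n (x + y)) m' := by
  rw [h, T.rule_eq_oneSite hy hm]
  exact LocOp.place_oneSite _ _ _

end Wrappings

section NoGo

/-- The square of the Forking automaton is trivial if the cell-wise gates preserve `X` and `Y` up to
signs. -/
theorem IsForking.isTrivialAfter {U : CellAlg fermion} {T : FCA fermion} (hT : IsForking U T)
    {a s : ℂ} (hX : Uᴴ * majX * U = a • majX)
    (hY : Uᴴ * majY * U = s • majY) : IsTrivialAfter T 2 := by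
  have h1 : ∀ x, T.aut (gen (x, true)) = s • gen (x + 1, false) := fun x => by
    rw [(hT.aut_gen x).1, hY, cell_smul, cell_majY]
  have h2 : ∀ x, T.aut (gen (x, false)) = -a • gen (x - 1, true) := fun x => by
    rw [(hT.aut_gen x).2, hX, cell_smul, cell_majX, neg_smul]
  refine ⟨0, fun x m => ⟨majPair ((-(s * a)) • majX) ((-(s * a)) • majY) m, ?_⟩⟩
  have h3 : ∀ m : CellAlg fermion, cell (x + 0) (majPair ((-(s * a)) • majX) ((-(s * a)) • majY) m) =
      majPair ((-(s * a)) • gen (x, true)) ((-(s * a)) • gen (x, false)) m := by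
    intro m
    rw [add_zero]
    have : (cellLin fermion x).comp (majPair ((-(s * a)) • majX) ((-(s * a)) • majY)) =
        majPair ((-(s * a)) • gen (x, true)) ((-(s * a)) • gen (x, false)) := by
      refine majLin_ext ?_ ?_ ?_ ?_ <;>
        simp only [LinearMap.comp_apply, cellLin_apply, majPair_one, majPair_X, majPair_Y,
          majPair_XY, cell_one, cell_smul, cell_mul, cell_majX, cell_majY]
    exact LinearMap.congr_fun this m
  rw [h3, cell_eq_majPair_gen]
  change T.aut (T.aut _) = _
  rw [map_majPair, map_majPair, h1, h2, map_smul, map_smul, h1, h2, smul_smul, smul_smul]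
  simp only [add_sub_cancel_right, sub_add_cancel, mul_neg, neg_mul, mul_comm a s]

/-- The `*`-automorphisms of a ring preserve the trace. -/
theorem leftTrace_starAlgEquiv {A : Type*} [Ring A] [StarRing A] [Algebra ℂ A] (θ : A ≃⋆ₐ[ℂ] A)
    (a : A) : leftTrace A (θ a) = leftTrace A a :=
  leftTrace_algEquiv (AlgEquiv.ofBijective (AlgHomClass.toAlgHom θ : A →ₐ[ℂ] A) θ.bijective) a

/-- A product of tile operators over all tiles of a ring, with two of the factors in front. -/
theorem IsClifford.exists_prod_tileOp_eq {A : Type*} [Ring A] [Algebra ℂ A] {m : ℕ}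
    {γ : Fin m × Fin 2 × Bool → A} (hγ : IsClifford γ) (k : TileCoeff) {t₁ t₂ : Fin m}
    (h12 : t₁ ≠ t₂) : ∃ l : List (Fin m), l.Nodup ∧ t₁ ∉ l ∧ t₂ ∉ l ∧
      ((Finset.univ.sort (fun a b : Fin m => a ≤ b)).map fun t =>
        tileOp k (_root_.tileGen γ t)).prod = tileOp k (_root_.tileGen γ t₁) *
          (tileOp k (_root_.tileGen γ t₂) * (l.map fun t => tileOp k (_root_.tileGen γ t)).prod) := by
  obtain ⟨l, hl⟩ : ∃ l, l = ((Finset.univ.sort (fun a b : Fin m => a ≤ b)).erase t₁).erase t₂ :=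
    ⟨_, rfl⟩
  have hperm : (Finset.univ.sort (fun a b : Fin m => a ≤ b)).Perm (t₁ :: t₂ :: l) := by
    rw [hl]
    refine (List.perm_cons_erase (by simp)).trans (List.Perm.cons _ (List.perm_cons_erase ?_))
    rw [List.mem_erase_of_ne h12.symm]
    simp
  have hnodup : (t₁ :: t₂ :: l).Nodup := hperm.nodup_iff.mp (Finset.sort_nodup _ _)
  rw [List.nodup_cons, List.nodup_cons] at hnodup
  obtain ⟨h1l, h2l, hlnodup⟩ := hnodup
  refine ⟨l, hlnodup, fun h => h1l (List.mem_cons_of_mem _ h), h2l, ?_⟩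
  have hcomm : ((Finset.univ.sort (fun a b : Fin m => a ≤ b)).map fun t =>
      tileOp k (_root_.tileGen γ t)).Pairwise Commute := by
    rw [List.pairwise_map]
    refine List.Pairwise.imp ?_ (Finset.sort_nodup _ _)
    intro t t' htt'
    exact Commute.tileOp_right (fun i => (hγ.commute_tileOp (Ne.symm htt') i k).symm) k
  rw [(hperm.map _).prod_eq' hcomm, List.map_cons, List.map_cons, List.prod_cons, List.prod_cons]

/-- The action of the wrapped Forking automaton on the Majorana generators. -/
theorem IsForking.wrapping_gen {U : CellAlg fermion} {T : FCA fermion} (hT : IsForking U T)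
    {a b s : ℂ} (hX : Uᴴ * majX * U = a • majX + b • majY)
    (hY : Uᴴ * majY * U = s • (b • majX - a • majY)) {n : ℕ} [NeZero n]
    {Tw : QuasiLocal fermion (Fin n) ≃⋆ₐ[ℂ] QuasiLocal fermion (Fin n)} (hTw : IsWrapping T n Tw)
    (x : ℤ) :
    Tw (gen (ringSite n x, true)) =
      s • (b • gen (ringSite n (x + 1), true) - a • gen (ringSite n (x + 1), false)) ∧
    Tw (gen (ringSite n x, false)) =
      -(a • gen (ringSite n (x - 1), true) + b • gen (ringSite n (x - 1), false)) := by
  have hscheme := hT.1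
  constructor
  · have h := (hT.aut_gen 0).1
    rw [zero_add, hY] at h
    have h2 := hTw.apply_cell (y := 1) (by rw [hscheme]; decide) h x
    refine h2.trans ?_
    rw [cell_smul, sub_eq_add_neg, cell_add, cell_neg, cell_smul, cell_smul, cell_majX, cell_majY,
      sub_eq_add_neg]
  · have h := (hT.aut_gen 0).2
    rw [zero_sub, hX, ← cell_neg] at h
    have h2 := hTw.apply_cell (y := -1) (by rw [hscheme]; decide) h x
    refine h2.trans ?_
    rw [cell_neg, cell_add, cell_smul, cell_smul, cell_majX, cell_majY, ← sub_eq_add_neg]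

/-- Two steps of the walk of the Majorana generators. -/
theorem two_steps {A : Type*} [Ring A] [Algebra ℂ A] {θ : A →ₐ[ℂ] A} {X Y : ℤ → A} {a b s : ℂ}
    (hs : s ^ 2 = 1) (hX : ∀ x, θ (X x) = s • (b • X (x + 1) - a • Y (x + 1)))
    (hY : ∀ x, θ (Y x) = -(a • X (x - 1) + b • Y (x - 1))) (x : ℤ) :
    θ (θ (X x)) = b • (b • X (x + 2) - a • Y (x + 2)) + (s * a) • (a • X x + b • Y x) ∧
    θ (θ (Y x)) = b • (a • X (x - 2) + b • Y (x - 2)) - (s * a) • (b • X x - a • Y x) := by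
  constructor
  · rw [hX, map_smul, map_sub, map_smul, map_smul, hX, hY, add_sub_cancel_right, add_assoc,
      one_add_one_eq_two]
    refine Eq.trans (b := s ^ 2 • _ + _) ?_ (by rw [hs, one_smul])
    module
  · rw [hY, map_neg, map_add, map_smul, map_smul, hX, hY, sub_add_cancel, sub_sub,
      one_add_one_eq_two]
    module

/-- The projection onto a renormalisable tile algebra satisfies the relations of
`tileCoeff_relations`, if the Forking automaton is not special and its square is not trivial: on a
large ring, the product of the tile projections is a fixed point of two steps of the automaton. -/
theorem IsForking.tileCoeff_relations {U : CellAlg fermion} {T : FCA fermion} (hT : IsForking U T)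
    {a b s : ℂ} (ha : a ≠ 0) (hb : b ≠ 0) (hs : s ^ 2 = 1) (hab : a ^ 2 + b ^ 2 = 1)
    (hX : Uᴴ * majX * U = a • majX + b • majY)
    (hY : Uᴴ * majY * U = s • (b • majX - a • majY)) {m : ℕ} (hm : 3 ≤ m) [NeZero (m * 2)]
    {Tw : QuasiLocal fermion (Fin (m * 2)) ≃⋆ₐ[ℂ] QuasiLocal fermion (Fin (m * 2))}
    (hTw : IsWrapping T (m * 2) Tw) {k : TileCoeff} (hk : k.one ≠ 0)
    {Q : QuasiLocal fermion (Fin (m * 2))} (hQ : Q = ((Finset.univ.sort (fun a b : Fin m => a ≤ b)).map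
      fun t => tileOp k (pairGen (ringTileSite m 2 t))).prod) (hfix : Tw (Tw Q) = Q) :
    (∀ i j, k.xy i j = 0) ∧ k.xx = k.yy ∧ k.xxyy * k.one = k.yy ^ 2 := by
  let γ : Fin m × Fin 2 × Bool → QuasiLocal fermion (Fin (m * 2)) := fun p =>
    gen (ringTileSite m 2 p.1 p.2.1, p.2.2)
  have hγ : IsClifford γ := ⟨fun _ => isClifford_gen.sq _, fun p q hpq => isClifford_gen.anti _ _
    fun h => hpq ?_⟩
  swap
  · obtain ⟨h1, h2⟩ := Prod.ext_iff.mp h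
    have h3 := Prod.ext_iff.mp (ringTileSite_injective m 2 (a₁ := (p.1, p.2.1)) (a₂ := (q.1, q.2.1)) h1)
    exact Prod.ext h3.1 (Prod.ext h3.2 h2)
  have hgen : ∀ t i κ, γ (t, i, κ) = gen (ringSite (m * 2) (2 * t.val + i.val), κ) := fun t i κ =>
    congrArg (fun x => gen (x, κ)) (ringTileSite_eq t i)
  have hT' := hT.wrapping_gen hX hY hTw
  -- two steps
  let W : QuasiLocal fermion (Fin (m * 2)) →ₐ[ℂ] QuasiLocal fermion (Fin (m * 2)) :=
    (AlgHomClass.toAlgHom Tw).comp (AlgHomClass.toAlgHom Tw)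
  have hWapply : ∀ z, W z = Tw (Tw z) := fun _ => rfl
  have hWτ : ∀ z, leftTrace _ (W z) = leftTrace _ z := fun z => by
    rw [hWapply, leftTrace_starAlgEquiv, leftTrace_starAlgEquiv]
  have hW := two_steps (θ := AlgHomClass.toAlgHom Tw)
    (X := fun x => gen (ringSite (m * 2) x, true)) (Y := fun x => gen (ringSite (m * 2) x, false))
    hs (fun x => (hT' x).1) (fun x => (hT' x).2)
  obtain ⟨t₀, ht₀⟩ : ∃ t : Fin m, t.val = 0 := ⟨⟨0, by omega⟩, rfl⟩
  obtain ⟨t₁, ht₁⟩ : ∃ t : Fin m, t.val = 1 := ⟨⟨1, by omega⟩, rfl⟩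
  obtain ⟨t₂, ht₂⟩ : ∃ t : Fin m, t.val = 2 := ⟨⟨2, by omega⟩, rfl⟩
  have h02 : t₀ ≠ t₂ := by rw [Ne, Fin.ext_iff]; omega
  have h12 : t₁ ≠ t₂ := by rw [Ne, Fin.ext_iff]; omega
  obtain ⟨l, hlnodup, h1l, h2l, hprod⟩ := hγ.exists_prod_tileOp_eq k h12
  replace hQ := hQ.trans hprod
  clear_value γ
  have hQW : W Q = Q := by rw [hWapply, hfix]
  rw [hQ] at hQW
  refine _root_.tileCoeff_relations (τ := leftTrace _) leftTrace_mul_comm hγ (W := W)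
    (R := (l.map fun t => tileOp k (tileGen γ t)).prod) (t₀ := t₀)
    hWτ ha hb hs hab h02 h12
    ?_ ?_ ?_ hk ?_ ?_ ?_ hQW
  · intro i
    rw [hgen, hgen, hgen, hgen]
    have h := (hW (2 * t₁.val + i.val)).1
    rw [show 2 * (t₁.val : ℤ) + i.val + 2 = 2 * t₂.val + i.val by rw [ht₁, ht₂]; push_cast; ring] at h
    exact h
  · intro i
    rw [hgen, hgen, hgen, hgen]
    have h := (hW (2 * t₂.val + i.val)).2
    rw [show 2 * (t₂.val : ℤ) + i.val - 2 = 2 * t₁.val + i.val by rw [ht₁, ht₂]; push_cast; ring] at h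
    exact h
  · intro i
    rw [hgen, hgen, hgen, hgen]
    have h := (hW (2 * t₁.val + i.val)).2
    rw [show 2 * (t₁.val : ℤ) + i.val - 2 = 2 * t₀.val + i.val by rw [ht₁, ht₀]; push_cast; ring] at h
    exact h
  · rw [trace_prod_tileOp leftTrace_mul_comm hγ k hlnodup]
    exact mul_ne_zero (pow_ne_zero _ hk) leftTrace_one_ne_zero
  · intro i
    refine Commute.list_prod_right _ _ fun y hy => ?_
    obtain ⟨t, ht, rfl⟩ := List.mem_map.mp hy
    exact hγ.commute_tileOp (by rintro rfl; exact h1l ht) i k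
  · intro i
    refine Commute.list_prod_right _ _ fun y hy => ?_
    obtain ⟨t, ht, rfl⟩ := List.mem_map.mp hy
    exact hγ.commute_tileOp (by rintro rfl; exact h2l ht) i k

/-- The Forking automaton has no renormalisation with a coarse-grained cell other than the scalars and
a projection other than the identity, if it is not special and its square is not trivial. -/
theorem IsForking.dim_lt_two {U : CellAlg fermion} {T : FCA fermion} (hT : IsForking U T)
    {a b s : ℂ} (ha : a ≠ 0) (hb : b ≠ 0) (hs : s ^ 2 = 1) (hab : a ^ 2 + b ^ 2 = 1)
    (hX : Uᴴ * majX * U = a • majX + b • majY)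
    (hY : Uᴴ * majY * U = s • (b • majX - a • majY)) {C' : Cell} {S : FCA C'}
    {P : QuasiLocal fermion ℤ} (hP1 : P ≠ 1) (hren : IsRenormalisation T S 2 P) : C'.dim < 2 := by
  obtain ⟨e, he, rfl, hren⟩ := hren
  have hinj : Function.Injective (tileSite 2) := fun i j h => by
    simpa [tileSite, Fin.ext_iff] using h
  obtain ⟨k, hk⟩ := exists_tileCoeff (he.graded 0 1 (isHomog_one C'))
  have hP := hk ℤ _ hinj
  have hmul := he.map_mul 1 1
  rw [one_mul] at hmul
  have hone : k.one ≠ 0 := by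
    refine tileCoeff_one_ne_zero hinj ?_ ?_ ?_
    · rw [← hP, ← he.map_star, Matrix.conjTranspose_one]
    · rw [← hP, ← hmul]
    · rw [← hP]
      intro h
      have h1 : (1 : CellAlg C') 0 0 = 0 := by rw [he.injective 1 h]; rfl
      rw [Matrix.one_apply_eq] at h1
      exact one_ne_zero h1
  obtain ⟨K₁, hK₁⟩ := exists_forall_isRegularWrapping (iterScheme T.scheme 2)
  obtain ⟨K₂, hK₂⟩ := exists_forall_isRegularWrapping S.scheme
  obtain ⟨m, hm⟩ : ∃ m, m = K₁ + K₂ + 3 := ⟨_, rfl⟩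
  have : NeZero m := ⟨by omega⟩
  obtain ⟨Tw, Sw, E, hTw, -, hE, hfix⟩ := hren m (hK₁ _ (by omega)) (hK₂ _ (by omega))
  have hE1 := hE 1
  rw [boxProd_one] at hE1
  have hfix1 := hfix 1
  rw [map_one Sw] at hfix1
  have htile : ∀ t, (e 1).place (ringTileSite m 2 t) = tileOp k (pairGen (ringTileSite m 2 t)) :=
    fun t => hk _ _ fun i j h => (Prod.ext_iff.mp
      (ringTileSite_injective m 2 (a₁ := (t, i)) (a₂ := (t, j)) h)).2
  simp only [Pi.one_apply, htile] at hE1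
  obtain ⟨hxy, hxx, hxxyy⟩ := hT.tileCoeff_relations ha hb hs hab hX hY (by omega) hTw hone hE1 hfix1
  have : Nontrivial (QuasiLocal fermion ℤ) := ⟨⟨_, _, hP1⟩⟩
  refine he.dim_lt_two fun c hc => ?_
  obtain ⟨k', hk'⟩ := exists_tileCoeff hc
  rw [hP, hk' ℤ _ hinj]
  exact exists_smul_of_tileCoeff_relations (isClifford_pairGen hinj) hone hxy hxx hxxyy
    (by rw [← hP, ← hmul]) (by rwa [← hP]) k'

theorem IsForking.isSpecialUnitary_of_admits {U : CellAlg fermion} (hU : U ∈ unitary (CellAlg fermion))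
    (hpar : ∃ p : ZMod 2, IsHomog fermion p U) {T : FCA fermion} (hT : IsForking U T)
    (h : AdmitsNontrivialRenormalisation T 2) : IsSpecialUnitary U := by
  obtain ⟨a, b, s, hab, hs, hX, hY, hiff⟩ := exists_orthogonal_action hU hpar
  rw [hiff]
  by_contra ha
  obtain ⟨htriv, C', S, P, hdim, hP, hren⟩ := h
  by_cases hb : b = 0
  · rw [hb] at hX hY
    refine htriv (hT.isTrivialAfter (a := a) (s := -(s * a)) ?_ ?_)
    · rw [hX]
      simp
    · rw [hY, Complex.ofReal_zero]
      module
  · exact absurd (hT.dim_lt_two (by exact_mod_cast ha) (by exact_mod_cast hb) (by exact_mod_cast hs)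
      (by exact_mod_cast hab) hX hY hP hren) (by omega)

end NoGo

/-! ### Shifts and signed shifts of the generators -/

section ShiftAutomaton

/-- The restriction of a `*`-automorphism to an invariant `*`-subalgebra. -/
def StarSubalgebra.restrictAut {A : Type*} [Ring A] [StarRing A] [Algebra ℂ A] [StarModule ℂ A]
    (D : StarSubalgebra ℂ A) (θ : A ≃⋆ₐ[ℂ] A) (h : ∀ a : D, θ a ∈ D)
    (h' : ∀ a : D, θ.symm a ∈ D) : D ≃⋆ₐ[ℂ] D where
  toFun a := ⟨θ a, h a⟩
  invFun a := ⟨θ.symm a, h' a⟩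
  left_inv a := Subtype.ext (θ.symm_apply_apply a)
  right_inv a := Subtype.ext (θ.apply_symm_apply a)
  map_mul' _ _ := Subtype.ext (map_mul θ _ _)
  map_add' _ _ := Subtype.ext (map_add θ _ _)
  map_star' _ := Subtype.ext (map_star θ _)
  map_smul' c _ := Subtype.ext (map_smul θ c _)

variable {C : Cell}

/-- The configuration `σ` translated by `-z`. -/
noncomputable def shiftConfig (z : ℤ) (σ : Config C ℤ) : Config C ℤ :=
  σ.equivMapDomain (Equiv.subRight z)

theorem shiftConfig_apply (z : ℤ) (σ : Config C ℤ) (y : ℤ) : shiftConfig z σ y = σ (y + z) := rfl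

theorem shiftConfig_shiftConfig (z w : ℤ) (σ : Config C ℤ) :
    shiftConfig z (shiftConfig w σ) = shiftConfig (z + w) σ := by
  ext1 y
  rw [shiftConfig_apply, shiftConfig_apply, shiftConfig_apply, add_assoc]

theorem shiftConfig_zero (σ : Config C ℤ) : shiftConfig 0 σ = σ := by
  ext1 y
  rw [shiftConfig_apply, add_zero]

theorem shiftConfig_eq_iff {z : ℤ} {σ τ : Config C ℤ} : shiftConfig z σ = τ ↔ σ = shiftConfig (-z) τ := by
  constructor
  · rintro rfl
    rw [shiftConfig_shiftConfig, neg_add_cancel, shiftConfig_zero]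
  · rintro rfl
    rw [shiftConfig_shiftConfig, add_neg_cancel, shiftConfig_zero]

theorem shiftConfig_injective (z : ℤ) : Function.Injective (shiftConfig (C := C) z) := fun σ τ h => by
  rw [shiftConfig_eq_iff, shiftConfig_shiftConfig, neg_add_cancel, shiftConfig_zero] at h
  exact h

theorem shiftConfig_update (z : ℤ) (σ : Config C ℤ) (y : ℤ) (j : Fin C.dim) :
    shiftConfig z (σ.update (y + z) j) = (shiftConfig z σ).update y j := by
  ext1 w
  simp only [shiftConfig_apply, Finsupp.update_apply, add_left_inj]

theorem stringPar_shiftConfig (z x : ℤ) (σ : Config C ℤ) :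
    stringPar x (shiftConfig z σ) = stringPar (x + z) σ := by
  rw [stringPar, stringPar]
  refine Finset.sum_bij (fun y _ => y + z) ?_ ?_ ?_ ?_
  · intro y hy
    simp only [Finset.mem_filter, Finsupp.mem_support_iff, shiftConfig_apply] at hy ⊢
    exact ⟨hy.1, by omega⟩
  · intro y _ y' _ h
    exact add_right_cancel h
  · intro y hy
    simp only [Finset.mem_filter, Finsupp.mem_support_iff] at hy
    refine ⟨y - z, ?_, by ring⟩
    simp only [Finset.mem_filter, Finsupp.mem_support_iff, shiftConfig_apply, sub_add_cancel]
    exact ⟨hy.1, by omega⟩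
  · intro y _
    rw [shiftConfig_apply]

/-- The translation of Fock space. -/
noncomputable def shiftOp (C : Cell) (z : ℤ) : Fock C ℤ →L[ℂ] Fock C ℤ :=
  weightedComp (fun _ => 1) 1 zero_le_one (by simp) (shiftConfig z) (shiftConfig_injective z)

theorem shiftOp_apply (z : ℤ) (ψ : Fock C ℤ) (σ : Config C ℤ) :
    shiftOp C z ψ σ = ψ (shiftConfig z σ) := by
  change (1 : ℂ) * ψ (shiftConfig z σ) = _
  rw [one_mul]

theorem shiftOp_mul_neg (z : ℤ) : shiftOp C z * shiftOp C (-z) = 1 := by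
  refine op_ext fun σ τ => ?_
  change shiftOp C z (shiftOp C (-z) (ket τ)) σ = ket τ σ
  rw [shiftOp_apply, shiftOp_apply, shiftConfig_shiftConfig, neg_add_cancel, shiftConfig_zero]

theorem star_shiftOp (z : ℤ) : star (shiftOp C z) = shiftOp C (-z) := by
  refine op_ext fun σ τ => ?_
  rw [star_apply_ket, shiftOp_apply, shiftOp_apply, ket_apply, ket_apply, apply_ite star, star_one,
    star_zero]
  refine if_congr ?_ rfl rfl
  rw [shiftConfig_eq_iff, eq_comm]

theorem shiftOp_mem_unitary (z : ℤ) : shiftOp C z ∈ unitary (Fock C ℤ →L[ℂ] Fock C ℤ) := by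
  rw [Unitary.mem_iff, star_shiftOp]
  refine ⟨?_, shiftOp_mul_neg z⟩
  have h := shiftOp_mul_neg (C := C) (-z)
  rwa [neg_neg] at h

theorem shiftOp_conj_cellOp (z x : ℤ) (m : CellAlg C) :
    shiftOp C z * cellOp x m * star (shiftOp C z) = cellOp (x + z) m := by
  rw [star_shiftOp]
  ext ψ σ
  change shiftOp C z (cellOp x m (shiftOp C (-z) ψ)) σ = _
  rw [shiftOp_apply, cellOp_apply, cellOp_apply]
  refine Finset.sum_congr rfl fun j _ => ?_
  rw [shiftOp_apply, ← shiftConfig_update, shiftConfig_shiftConfig, neg_add_cancel, shiftConfig_zero,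
    stringPar_shiftConfig, shiftConfig_apply]

/-- Conjugation by the translation of Fock space. -/
noncomputable def shiftConj (C : Cell) (z : ℤ) :
    (Fock C ℤ →L[ℂ] Fock C ℤ) ≃⋆ₐ[ℂ] (Fock C ℤ →L[ℂ] Fock C ℤ) :=
  Unitary.conjStarAlgAut ℂ _ ⟨shiftOp C z, shiftOp_mem_unitary z⟩

theorem shiftConj_apply (z : ℤ) (a : Fock C ℤ →L[ℂ] Fock C ℤ) :
    shiftConj C z a = shiftOp C z * a * star (shiftOp C z) := by
  rw [shiftConj, Unitary.conjStarAlgAut_apply]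

theorem shiftConj_neg (z : ℤ) (a : Fock C ℤ →L[ℂ] Fock C ℤ) :
    shiftConj C (-z) (shiftConj C z a) = a := by
  have h := shiftOp_mul_neg (C := C) (-z)
  rw [neg_neg] at h
  rw [shiftConj_apply, shiftConj_apply, star_shiftOp, star_shiftOp, neg_neg, ← mul_assoc, ← mul_assoc,
    h, one_mul, mul_assoc, h, mul_one]

theorem shiftConj_shiftConj_neg (z : ℤ) (a : Fock C ℤ →L[ℂ] Fock C ℤ) :
    shiftConj C z (shiftConj C (-z) a) = a := by
  have h := shiftConj_neg (-z) a
  rwa [neg_neg] at h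

theorem shiftConj_mem (z : ℤ) (a : QuasiLocal C ℤ) :
    shiftConj C z a ∈ (StarAlgebra.adjoin ℂ
      {a : Fock C ℤ →L[ℂ] Fock C ℤ | ∃ x m, a = cellOp x m}).topologicalClosure := by
  have hcont : Continuous (shiftConj C z) := by
    have : ⇑(shiftConj C z) = fun a => shiftOp C z * a * star (shiftOp C z) :=
      funext (shiftConj_apply z)
    rw [this]
    fun_prop
  refine map_mem_closure hcont a.2 fun b hb => ?_
  have hle : StarAlgebra.adjoin ℂ {a : Fock C ℤ →L[ℂ] Fock C ℤ | ∃ x m, a = cellOp x m} ≤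
      (StarAlgebra.adjoin ℂ {a : Fock C ℤ →L[ℂ] Fock C ℤ | ∃ x m, a = cellOp x m}).comap
        (shiftConj C z : (Fock C ℤ →L[ℂ] Fock C ℤ) →⋆ₐ[ℂ] (Fock C ℤ →L[ℂ] Fock C ℤ)) := by
    refine StarAlgebra.adjoin_le ?_
    rintro _ ⟨x, m, rfl⟩
    refine StarAlgebra.subset_adjoin ℂ _ ⟨x + z, m, ?_⟩
    exact (shiftConj_apply z _).trans (shiftOp_conj_cellOp z x m)
  exact hle hb

theorem shiftConj_symm_mem (z : ℤ) (a : QuasiLocal C ℤ) :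
    (shiftConj C z).symm a ∈ (StarAlgebra.adjoin ℂ
      {a : Fock C ℤ →L[ℂ] Fock C ℤ | ∃ x m, a = cellOp x m}).topologicalClosure := by
  have h : (shiftConj C z).symm a = shiftConj C (-z) a :=
    (congrArg (shiftConj C z).symm (shiftConj_shiftConj_neg z _).symm).trans
      ((shiftConj C z).symm_apply_apply _)
  rw [h]
  exact shiftConj_mem (-z) a

/-- The shift of the quasi-local algebra by `z` cells. -/
noncomputable def shiftAut (C : Cell) (z : ℤ) : QuasiLocal C ℤ ≃⋆ₐ[ℂ] QuasiLocal C ℤ :=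
  StarSubalgebra.restrictAut _ (shiftConj C z) (shiftConj_mem z) (shiftConj_symm_mem z)

theorem shiftAut_cell (z x : ℤ) (m : CellAlg C) : shiftAut C z (cell x m) = cell (x + z) m :=
  Subtype.ext ((shiftConj_apply z _).trans (shiftOp_conj_cellOp z x m))

theorem LocOp.isHomog_tensor {F : Type} [Fintype F] [LinearOrder F] {M : F → CellAlg C}
    {p : F → ZMod 2} (h : ∀ y, _root_.IsHomog C (p y) (M y)) : (LocOp.tensor M).IsHomog (∑ y, p y) := by
  intro σ τ hστ
  refine Finset.sum_congr rfl fun y _ => h y _ _ fun h0 => hστ ?_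
  exact Finset.prod_eq_zero (Finset.mem_univ y) h0

theorem LocOp.isHomog_oneSite {F : Type} [Fintype F] [LinearOrder F] {m : CellAlg C} {p : ZMod 2}
    (h : _root_.IsHomog C p m) (y : F) : (LocOp.oneSite y m).IsHomog p := by
  have h1 := LocOp.isHomog_tensor (M := Pi.mulSingle y m) (p := Pi.single y p) fun z => by
    by_cases hz : z = y
    · subst hz
      rwa [Pi.mulSingle_eq_same, Pi.single_eq_same]
    · rw [Pi.mulSingle_eq_of_ne hz, Pi.single_eq_of_ne hz]
      exact isHomog_one C
  rwa [Finset.sum_pi_single', if_pos (Finset.mem_univ _)] at h1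

/-- The shift by `z` cells as a cellular automaton. -/
noncomputable def shiftFCA (C : Cell) (z : ℤ) : FCA C where
  scheme := {z}
  rule m := LocOp.oneSite ⟨z, Finset.mem_singleton_self z⟩ m
  aut := shiftAut C z
  aut_cell x m := by rw [shiftAut_cell, LocOp.place_oneSite]
  graded _ _ h := LocOp.isHomog_oneSite h _

theorem isShift_shiftFCA (C : Cell) (z : ℤ) : IsShift (shiftFCA C z) z := fun x m =>
  shiftAut_cell z x m

end ShiftAutomaton

section RingShift

theorem ringSite_val (n : ℕ) [NeZero n] (i : Fin n) : ringSite n i.val = i := by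
  refine Fin.ext ?_
  change ((i.val : ℤ) % n).toNat = i.val
  rw [Int.emod_eq_of_lt (by positivity) (by exact_mod_cast i.isLt), Int.toNat_natCast]

theorem dvd_ringSite_sub (n : ℕ) [NeZero n] (x : ℤ) : (n : ℤ) ∣ (ringSite n x).val - x := by
  rw [← ringSite_eq_iff, ringSite_val]

theorem ringSite_ringSite_add (n : ℕ) [NeZero n] (x z : ℤ) :
    ringSite n ((ringSite n x).val + z) = ringSite n (x + z) := by
  rw [ringSite_eq_iff, add_sub_add_right_eq_sub]
  exact dvd_ringSite_sub n x

/-- The rotation of the ring of `n` sites by `z`. -/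
def ringShift (n : ℕ) [NeZero n] (z : ℤ) : Equiv.Perm (Fin n) where
  toFun i := ringSite n (i.val + z)
  invFun i := ringSite n (i.val + -z)
  left_inv i := by
    dsimp only
    rw [ringSite_ringSite_add, add_neg_cancel_right, ringSite_val]
  right_inv i := by
    dsimp only
    rw [ringSite_ringSite_add, neg_add_cancel_right, ringSite_val]

theorem ringShift_ringSite (n : ℕ) [NeZero n] (z x : ℤ) :
    ringShift n z (ringSite n x) = ringSite n (x + z) := ringSite_ringSite_add n x z

theorem ringTileSite_ringSite (m N : ℕ) [NeZero m] [NeZero (m * N)] (x : ℤ) (j : Fin N) :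
    ringTileSite m N (ringSite m x) j = ringSite (m * N) (N * x + j.val) := by
  rw [ringTileSite_eq, ringSite_eq_iff, add_sub_add_right_eq_sub, ← mul_sub, Nat.cast_mul, mul_comm]
  exact mul_dvd_mul_left _ (dvd_ringSite_sub m x)

/-- The automorphism of a ring of fermionic modes which moves the generators `X` by `z` sites and the
generators `Y` by `w` sites, with signs. -/
theorem exists_ring_aut (n : ℕ) [NeZero n] (z w : ℤ) {a b : ℂ} (ha : a = 1 ∨ a = -1)
    (hb : b = 1 ∨ b = -1) :
    ∃ θ : QuasiLocal fermion (Fin n) ≃⋆ₐ[ℂ] QuasiLocal fermion (Fin n), ∀ x,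
      θ (gen (ringSite n x, true)) = a • gen (ringSite n (x + z), true) ∧
      θ (gen (ringSite n x, false)) = b • gen (ringSite n (x + w), false) := by
  obtain ⟨θ, hθ⟩ := exists_signedPerm_aut (G := Fin n)
    { toFun := fun k => (ringShift n (if k.2 then z else w) k.1, k.2)
      invFun := fun k => ((ringShift n (if k.2 then z else w)).symm k.1, k.2)
      left_inv := fun k => by simp
      right_inv := fun k => by simp } (ε := fun k => if k.2 then a else b)
    (fun k => by split_ifs <;> assumption)
  refine ⟨θ, fun x => ⟨(hθ _).trans ?_, (hθ _).trans ?_⟩⟩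
  · simp [ringShift_ringSite]
  · simp [ringShift_ringSite]

/-- The shift wraps on a ring of any length, where it moves every generator by `z` sites. -/
theorem exists_isWrapping_shiftFCA (n : ℕ) [NeZero n] (z : ℤ) :
    ∃ Sw : QuasiLocal fermion (Fin n) ≃⋆ₐ[ℂ] QuasiLocal fermion (Fin n),
      IsWrapping (shiftFCA fermion z) n Sw ∧
      ∀ x κ, Sw (gen (ringSite n x, κ)) = gen (ringSite n (x + z), κ) := by
  obtain ⟨θ, hθ⟩ := exists_ring_aut n z z (Or.inl rfl) (Or.inl rfl)
  have h : ∀ x κ, θ (gen (ringSite n x, κ)) = gen (ringSite n (x + z), κ) := by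
    intro x κ
    cases κ
    · rw [(hθ x).2, one_smul]
    · rw [(hθ x).1, one_smul]
  refine ⟨θ, fun x m => ?_, h⟩
  refine Eq.trans ?_ (LocOp.place_oneSite _ _ _).symm
  rw [cell_eq_majPair_gen, map_majPair, h, h, cell_eq_majPair_gen]

end RingShift

section SpecialForking

theorem FCA.rule_eq {C : Cell} (T : FCA C) {m : CellAlg C} {c : LocOp C T.scheme}
    (h : T.aut (cell 0 m) = c.place fun y => (y : ℤ)) : T.rule m = c := by
  refine LocOp.place_injective (G := ℤ) (s := fun y : T.scheme => (y : ℤ))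
    Subtype.val_injective ?_
  refine Eq.trans ?_ h
  rw [T.aut_cell]
  simp only [zero_add]

/-- A fermionic automaton which moves the generators `X` by `z` and the generators `Y` by `w < z`, with
signs, has wrappings on all rings. -/
theorem exists_isWrapping_of_signed {T : FCA fermion} {z w : ℤ} (hwz : w < z) (hz : z ∈ T.scheme)
    (hw : w ∈ T.scheme) {a b : ℂ} (ha : a = 1 ∨ a = -1) (hb : b = 1 ∨ b = -1)
    (hX : ∀ x, T.aut (gen (x, true)) = a • gen (x + z, true))
    (hY : ∀ x, T.aut (gen (x, false)) = b • gen (x + w, false)) (n : ℕ) [NeZero n] :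
    ∃ Tw : QuasiLocal fermion (Fin n) ≃⋆ₐ[ℂ] QuasiLocal fermion (Fin n), IsWrapping T n Tw ∧ ∀ x,
      Tw (gen (ringSite n x, true)) = a • gen (ringSite n (x + z), true) ∧
      Tw (gen (ringSite n x, false)) = b • gen (ringSite n (x + w), false) := by
  obtain ⟨θ, hθ⟩ := exists_ring_aut n z w ha hb
  refine ⟨θ, fun x m => ?_, hθ⟩
  obtain ⟨p, q, r, t, rfl⟩ := exists_maj_expansion m
  -- the transition rule, with the product of the two generators in the order of the sites
  obtain ⟨c, hc⟩ : ∃ c : LocOp fermion T.scheme, ∀ (G : Type) [LinearOrder G] (s : T.scheme → G),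
      c.place s = p • 1 + q • (a • gen (s ⟨z, hz⟩, true)) + r • (b • gen (s ⟨w, hw⟩, false)) +
        t • (a • gen (s ⟨z, hz⟩, true) * b • gen (s ⟨w, hw⟩, false)) := by
    refine ⟨p • LocOp.tensor 1 + q • a • LocOp.oneSite ⟨z, hz⟩ majX +
      r • b • LocOp.oneSite ⟨w, hw⟩ majY +
      t • (-(a * b)) • LocOp.twoSite ⟨w, hw⟩ ⟨z, hz⟩ majY majX, fun G _ s => ?_⟩
    have h2 : (LocOp.twoSite (⟨w, hw⟩ : T.scheme) ⟨z, hz⟩ majY majX).place s =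
        gen (s ⟨w, hw⟩, false) * gen (s ⟨z, hz⟩, true) :=
      LocOp.place_twoSite (y := (⟨w, hw⟩ : T.scheme)) (z := ⟨z, hz⟩) hwz _ _ _
    have h := isClifford_gen.anti (s ⟨z, hz⟩, true) (s ⟨w, hw⟩, false) (by simp)
    rw [← placeLin_apply]
    simp only [map_add, map_smul, placeLin_apply, h2, LocOp.place_oneSite, LocOp.place_tensor,
      boxProd_one, cell_majX, cell_majY, smul_mul_smul_comm, h]
    module
  have hexp : ∀ (G : Type) [LinearOrder G] (y : G),
      cell y (p • 1 + q • majX + r • majY + t • (majX * majY)) = p • 1 + q • gen (y, true) +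
        r • gen (y, false) + t • (gen (y, true) * gen (y, false)) := fun G _ y => by
    simp only [cell_add, cell_smul, cell_mul, cell_one, cell_majX, cell_majY]
  have hrule : T.rule (p • 1 + q • majX + r • majY + t • (majX * majY)) = c := by
    refine T.rule_eq ?_
    rw [hexp, hc]
    simp only [map_add, map_smul, map_mul, map_one, hX, hY, zero_add]
  rw [hrule, hexp, hc]
  simp only [map_add, map_smul, map_mul, map_one, hθ]

end SpecialForking

/-! ### The pairing projection of a tile -/

section PairingProjection

variable {A : Type*} [Ring A] [Algebra ℂ A]

/-- The projection `½ (1 + ν h₀ h₁)` of a tile, where `h₀`, `h₁` are the generators of the type other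
than `κ`; it is a projection for `ν = ±i`. -/
noncomputable def pairProj (ν : ℂ) (κ : Bool) (c : Fin 2 × Bool → A) : A :=
  (1 / 2 : ℂ) • (1 + ν • (c (0, !κ) * c (1, !κ)))

variable {ν : ℂ} {κ : Bool} {c : Fin 2 × Bool → A}

theorem pairProj_mul_self (hν : ν * ν = -1) (hc : IsClifford c) :
    pairProj ν κ c * pairProj ν κ c = pairProj ν κ c := by
  have h := hc.pair_sq (k := (0, !κ)) (l := (1, !κ)) (by simp)
  obtain ⟨w, hw⟩ : ∃ w, w = c (0, !κ) * c (1, !κ) := ⟨_, rfl⟩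
  rw [← hw] at h
  rw [pairProj, ← hw, smul_mul_smul_comm, mul_add, add_mul, add_mul, one_mul, mul_one, one_mul,
    smul_mul_smul_comm, h, hν]
  module

/-- The pairing projection commutes with the generators of type `κ`. -/
theorem commute_pairProj {z : A} (h : ∀ i, z * c (i, !κ) = -(c (i, !κ) * z)) :
    Commute z (pairProj ν κ c) :=
  ((Commute.one_right z).add_right ((commute_mul_of_anti (h 0) (h 1)).smul_right ν)).smul_right _

theorem gen_mul_pairProj (hc : IsClifford c) (i : Fin 2) :
    c (i, κ) * pairProj ν κ c = pairProj ν κ c * c (i, κ) :=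
  commute_pairProj fun _ => hc.anti _ _ (by simp)

theorem pairProj_mul_gen (hc : IsClifford c) (i : Fin 2) :
    pairProj ν κ c * c (i, !κ) = c (i, !κ) - c (i, !κ) * pairProj ν κ c := by
  have h1 : c (0, !κ) * c (1, !κ) * c (i, !κ) = -(c (i, !κ) * (c (0, !κ) * c (1, !κ))) := by
    fin_cases i
    exacts [hc.pair_mul_left (by simp), hc.pair_mul_right (by simp)]
  rw [pairProj, smul_mul_assoc, add_mul, one_mul, smul_mul_assoc, h1, mul_smul_comm, mul_add, mul_one,
    mul_smul_comm]
  module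

theorem pairProj_mul_gen_mul (hν : ν * ν = -1) (hc : IsClifford c) (i : Fin 2) :
    pairProj ν κ c * c (i, !κ) * pairProj ν κ c = 0 := by
  rw [pairProj_mul_gen hc, sub_mul, mul_assoc, pairProj_mul_self hν hc, sub_self]

theorem pair_mul_pairProj (hν : ν * ν = -1) (hc : IsClifford c) :
    c (0, !κ) * c (1, !κ) * pairProj ν κ c = -ν • pairProj ν κ c := by
  have h := hc.pair_sq (k := (0, !κ)) (l := (1, !κ)) (by simp)
  have h2 : -ν • pairProj ν κ c = (1 / 2 : ℂ) • (-ν • 1 - (ν * ν) • (c (0, !κ) * c (1, !κ))) := by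
    rw [pairProj]
    module
  rw [h2, hν, pairProj, mul_smul_comm, mul_add, mul_one, mul_smul_comm, h]
  module

theorem star_pairProj [StarRing A] [StarModule ℂ A] (hν : star ν = -ν) (hc : IsClifford c)
    (hstar : ∀ i, star (c i) = c i) : star (pairProj ν κ c) = pairProj ν κ c := by
  have h2 : star (1 / 2 : ℂ) = 1 / 2 := by simp
  rw [pairProj, star_smul, star_add, star_one, star_smul, star_mul, hstar, hstar, hν,
    hc.anti _ _ (by simp), h2, smul_neg, neg_smul, neg_neg]

theorem pairProj_ne_one [Nontrivial A] (hν : ν * ν = -1) (hc : IsClifford c) :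
    pairProj ν κ c ≠ 1 := by
  intro h
  have h1 := pairProj_mul_gen_mul (κ := κ) hν hc 0
  rw [h, one_mul, mul_one] at h1
  have h2 := hc.sq (0, !κ)
  rw [h1, zero_mul] at h2
  exact zero_ne_one h2

theorem pairProj_ne_zero [Nontrivial A] (hc : IsClifford c) : pairProj ν κ c ≠ 0 := by
  intro h
  have h1 := pairProj_mul_gen (ν := ν) (κ := κ) hc 0
  rw [h, zero_mul, mul_zero, sub_zero] at h1
  have h2 := hc.sq (0, !κ)
  rw [← h1, zero_mul] at h2
  exact zero_ne_one h2

theorem commute_majPair {z g h : A} (hg : Commute z g) (hh : Commute z h) (m : CellAlg fermion) :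
    Commute z (majPair g h m) := by
  obtain ⟨p, q, r, t, rfl⟩ := exists_maj_expansion m
  simp only [map_add, map_smul, majPair_one, majPair_X, majPair_Y, majPair_XY]
  exact ((((Commute.one_right z).smul_right p).add_right (hg.smul_right q)).add_right
    (hh.smul_right r)).add_right ((hg.mul_right hh).smul_right t)

theorem commute_pairProj_majPair (hc : IsClifford c) (m : CellAlg fermion) :
    Commute (pairProj ν κ c) (majPair (c (0, κ)) (c (1, κ)) m) :=
  commute_majPair (gen_mul_pairProj hc 0).symm (gen_mul_pairProj hc 1).symm m

/-- The algebra generated by the generators of type `κ`, cut down by the pairing projection, is a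
one-mode algebra. -/
theorem majPair_mul_pairProj_injective [Nontrivial A] (hc : IsClifford c)
    {m : CellAlg fermion} (h : majPair (c (0, κ)) (c (1, κ)) m * pairProj ν κ c = 0) : m = 0 := by
  have hmul := majPair_mul (hc.sq (0, κ)) (hc.sq (1, κ)) (hc.anti (1, κ) (0, κ) (by simp))
  obtain ⟨φ, hφ⟩ : ∃ φ, φ = majPair (c (0, κ)) (c (1, κ)) := ⟨_, rfl⟩
  rw [← hφ] at h hmul
  have hcomm : ∀ m, Commute (φ m) (pairProj ν κ c) := fun m => by
    rw [hφ]
    exact (commute_pairProj_majPair hc m).symm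
  have hab : ∀ a b, φ (a * m * b) * pairProj ν κ c = 0 := fun a b => by
    rw [hmul, hmul, mul_assoc, (hcomm b).eq, ← mul_assoc, mul_assoc (φ a), h, mul_zero, zero_mul]
  ext i j
  have h1 : ∑ k, Matrix.single k i 1 * m * Matrix.single j k 1 = m i j • (1 : CellAlg fermion) := by
    ext a b
    simp [Matrix.single_mul_mul_single, Matrix.sum_apply, Matrix.single_apply, Matrix.one_apply,
      ite_and]
  have h2 : φ (m i j • 1) * pairProj ν κ c = 0 := by
    rw [← h1, map_sum, Finset.sum_mul]
    exact Finset.sum_eq_zero fun k _ => hab _ _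
  rw [map_smul, hφ, majPair_one, smul_mul_assoc, one_mul] at h2
  exact (smul_eq_zero.mp h2).resolve_right (pairProj_ne_zero hc)

end PairingProjection

section PairingIsometry

/-- The isometry of a one-mode algebra onto the corner of the pairing projection, which maps `X`, `Y`
to the generators of type `κ` of the two modes of the tile, times the projection. -/
noncomputable def pairEmb (ν : ℂ) (κ : Bool) : CellAlg fermion →ₗ[ℂ] LocOp fermion (Fin 2) :=
  majLin
    ((1 / 2 : ℂ) • (LocOp.tensor ![1, 1] + ν • LocOp.tensor ![majGen !κ, majGen !κ]))
    ((1 / 2 : ℂ) • (LocOp.tensor ![majGen κ, 1] +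
      ν • LocOp.tensor ![majGen κ * majGen !κ, majGen !κ]))
    ((1 / 2 : ℂ) • (LocOp.tensor ![1, majGen κ] -
      ν • LocOp.tensor ![majGen !κ, majGen κ * majGen !κ]))
    ((1 / 2 : ℂ) • (LocOp.tensor ![majGen κ, majGen κ] -
      ν • LocOp.tensor ![majGen κ * majGen !κ, majGen κ * majGen !κ]))

theorem place_tensor_fin_two {C : Cell} {G : Type} [LinearOrder G] (s : Fin 2 → G)
    (m m' : CellAlg C) : (LocOp.tensor ![m, m']).place s = cell (s 0) m * cell (s 1) m' := by
  rw [LocOp.place_tensor, boxProd_fin_two]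
  rfl

theorem place_pairEmb (ν : ℂ) (κ : Bool) {G : Type} [LinearOrder G] {s : Fin 2 → G}
    (hs : Function.Injective s) (m : CellAlg fermion) :
    (pairEmb ν κ m).place s =
      majPair (gen (s 0, κ)) (gen (s 1, κ)) m * pairProj ν κ (pairGen s) := by
  have hc := isClifford_pairGen hs
  have h : placeLin fermion s ∘ₗ pairEmb ν κ =
      LinearMap.mulRight ℂ (pairProj ν κ (pairGen s)) ∘ₗ
        majPair (gen (s 0, κ)) (gen (s 1, κ)) := by
    obtain ⟨e1, eX, eY, eXY⟩ := majLin_basis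
      ((1 / 2 : ℂ) • (LocOp.tensor ![1, 1] + ν • LocOp.tensor ![majGen !κ, majGen !κ]))
      ((1 / 2 : ℂ) • (LocOp.tensor ![majGen κ, 1] +
        ν • LocOp.tensor ![majGen κ * majGen !κ, majGen !κ]))
      ((1 / 2 : ℂ) • (LocOp.tensor ![1, majGen κ] -
        ν • LocOp.tensor ![majGen !κ, majGen κ * majGen !κ]))
      ((1 / 2 : ℂ) • (LocOp.tensor ![majGen κ, majGen κ] -
        ν • LocOp.tensor ![majGen κ * majGen !κ, majGen κ * majGen !κ]))
    change pairEmb ν κ _ = _ at e1 eX eY eXY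
    have hcell : ∀ (x : G) (κ : Bool), cell x (majGen κ) = gen (x, κ) := fun _ _ => rfl
    have a1 := hc.anti (1, κ) (0, !κ) (by simp)
    obtain ⟨g0, hg0⟩ : ∃ x, x = gen (s 0, κ) := ⟨_, rfl⟩
    obtain ⟨g1, hg1⟩ : ∃ x, x = gen (s 1, κ) := ⟨_, rfl⟩
    obtain ⟨h0, hh0⟩ : ∃ x, x = gen (s 0, !κ) := ⟨_, rfl⟩
    obtain ⟨h1, hh1⟩ : ∃ x, x = gen (s 1, !κ) := ⟨_, rfl⟩
    simp only [pairGen] at a1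
    rw [← hg1, ← hh0] at a1
    have a2 : g1 * (h0 * h1) = -(h0 * (g1 * h1)) := by
      rw [← mul_assoc, a1, neg_mul, mul_assoc]
    have hQ : pairProj ν κ (pairGen s) = (1 / 2 : ℂ) • (1 + ν • (h0 * h1)) := by
      rw [hh0, hh1]; rfl
    refine majLin_ext ?_ ?_ ?_ ?_ <;>
      simp only [LinearMap.comp_apply, LinearMap.mulRight_apply, e1, eX, eY, eXY, map_smul, map_add,
        map_sub, placeLin_apply, place_tensor_fin_two, majPair_one, majPair_X, majPair_Y, majPair_XY,
        hcell, cell_mul, cell_one, hQ, ← hg0, ← hg1, ← hh0, ← hh1, one_mul, mul_smul_comm, mul_add,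
        mul_one, mul_assoc, a2, mul_neg] <;>
      module
  exact LinearMap.congr_fun h m

theorem IsHomog.mul {C : Cell} {p q : ZMod 2} {a b : CellAlg C} (ha : IsHomog C p a)
    (hb : IsHomog C q b) : IsHomog C (p + q) (a * b) := by
  intro i j h
  rw [Matrix.mul_apply] at h
  obtain ⟨k, -, hk⟩ := Finset.exists_ne_zero_of_sum_ne_zero h
  have h1 := ha i k (left_ne_zero_of_mul hk)
  have h2 := hb k j (right_ne_zero_of_mul hk)
  rw [← h1, ← h2]
  linear_combination -CharTwo.add_self_eq_zero (C.par k)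

section

variable {C : Cell} {F : Type} [Fintype F] {p : ZMod 2}

theorem LocOp.IsHomog.add {c d : LocOp C F} (hc : c.IsHomog p) (hd : d.IsHomog p) :
    LocOp.IsHomog p (c + d) := by
  intro σ τ h
  by_cases h0 : c σ τ = 0
  · refine hd σ τ fun h1 => h ?_
    rw [Matrix.add_apply, h0, h1, add_zero]
  · exact hc σ τ h0

theorem LocOp.IsHomog.smul {c : LocOp C F} (hc : c.IsHomog p) (a : ℂ) :
    LocOp.IsHomog p (a • c) := by
  intro σ τ h
  rw [Matrix.smul_apply] at h
  exact hc σ τ fun h0 => h (by rw [h0, smul_zero])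

end

theorem isHomog_tensor_fin_two {C : Cell} {p q : ZMod 2} {a b : CellAlg C} (ha : IsHomog C p a)
    (hb : IsHomog C q b) : (LocOp.tensor ![a, b]).IsHomog (p + q) := by
  have h := LocOp.isHomog_tensor (M := ![a, b]) (p := ![p, q]) (by
    rw [Fin.forall_fin_two]
    exact ⟨ha, hb⟩)
  rwa [Fin.sum_univ_two] at h

theorem isHomog_pairEmb (ν : ℂ) (κ : Bool) {p : ZMod 2} {m : CellAlg fermion}
    (hm : IsHomog fermion p m) : (pairEmb ν κ m).IsHomog p := by
  obtain ⟨e1, eX, eY, eXY⟩ := majLin_basis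
    ((1 / 2 : ℂ) • (LocOp.tensor ![1, 1] + ν • LocOp.tensor ![majGen !κ, majGen !κ]))
    ((1 / 2 : ℂ) • (LocOp.tensor ![majGen κ, 1] +
      ν • LocOp.tensor ![majGen κ * majGen !κ, majGen !κ]))
    ((1 / 2 : ℂ) • (LocOp.tensor ![1, majGen κ] -
      ν • LocOp.tensor ![majGen !κ, majGen κ * majGen !κ]))
    ((1 / 2 : ℂ) • (LocOp.tensor ![majGen κ, majGen κ] -
      ν • LocOp.tensor ![majGen κ * majGen !κ, majGen κ * majGen !κ]))
  change pairEmb ν κ _ = _ at e1 eX eY eXY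
  have h1 := isHomog_one fermion
  have hg := isHomog_majGen
  have hgh : IsHomog fermion 0 (majGen κ * majGen !κ) := (hg κ).mul (hg _)
  rw [sub_eq_add_neg, ← neg_smul] at eY eXY
  rcases ZMod.two_cases p with rfl | rfl
  · obtain ⟨a, b, rfl⟩ := exists_even_expansion hm
    rw [map_add, map_smul, map_smul, e1, eXY]
    exact ((((isHomog_tensor_fin_two h1 h1).add
      ((isHomog_tensor_fin_two (hg _) (hg _)).smul _)).smul _).smul _).add
      ((((isHomog_tensor_fin_two (hg _) (hg _)).add
      ((isHomog_tensor_fin_two hgh hgh).smul _)).smul _).smul _)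
  · obtain ⟨a, b, rfl⟩ := exists_odd_expansion hm
    rw [map_add, map_smul, map_smul, eX, eY]
    exact ((((isHomog_tensor_fin_two (hg _) h1).add
      ((isHomog_tensor_fin_two hgh (hg _)).smul _)).smul _).smul _).add
      ((((isHomog_tensor_fin_two h1 (hg _)).add
      ((isHomog_tensor_fin_two (hg _) hgh).smul _)).smul _).smul _)

theorem exists_gen_expansion (κ : Bool) (m : CellAlg fermion) : ∃ p q r t : ℂ,
    m = p • 1 + q • majGen κ + r • majGen (!κ) + t • (majGen κ * majGen (!κ)) := by
  obtain ⟨p, q, r, t, rfl⟩ := exists_maj_expansion m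
  cases κ
  · refine ⟨p, r, q, -t, ?_⟩
    have h : majX * majY = -(majY * majX) := majGen_anti (κ := true) (κ' := false) (by simp)
    change _ = p • 1 + r • majY + q • majX + -t • (majY * majX)
    rw [h]
    module
  · exact ⟨p, q, r, t, rfl⟩

/-- The corner of the pairing projection is generated by the generators of type `κ`, as the corner
of a generator of the other type vanishes. -/
theorem exists_pairProj_mul_mul {ν : ℂ} (hν : ν * ν = -1) (κ : Bool) {G : Type} [LinearOrder G]
    {s : Fin 2 → G} (hs : Function.Injective s) (m m' : CellAlg fermion) :
    ∃ a, pairProj ν κ (pairGen s) * (cell (s 0) m * cell (s 1) m') * pairProj ν κ (pairGen s) =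
      majPair (gen (s 0, κ)) (gen (s 1, κ)) a * pairProj ν κ (pairGen s) := by
  have hc := isClifford_pairGen hs
  have hmul := majPair_mul (hc.sq (0, κ)) (hc.sq (1, κ)) (hc.anti (1, κ) (0, κ) (by simp))
  have hP := pairProj_mul_self (κ := κ) hν hc
  have hcomm := commute_pairProj_majPair (ν := ν) (κ := κ) hc
  have hzero := pairProj_mul_gen_mul (κ := κ) hν hc
  have hpair := pair_mul_pairProj (κ := κ) hν hc
  have a1 := hc.anti (0, !κ) (1, κ) (by simp)
  have hX := majPair_X (gen (s 0, κ)) (gen (s 1, κ))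
  have hY := majPair_Y (gen (s 0, κ)) (gen (s 1, κ))
  have h1 := majPair_one (gen (s 0, κ)) (gen (s 1, κ))
  obtain ⟨p, q, r, t, rfl⟩ := exists_gen_expansion κ m
  obtain ⟨p', q', r', t', rfl⟩ := exists_gen_expansion κ m'
  have hexp : ∀ (x : G) (p q r t : ℂ), cell x (p • 1 + q • majGen κ + r • majGen (!κ) +
      t • (majGen κ * majGen (!κ))) = p • 1 + q • gen (x, κ) + r • gen (x, !κ) +
        t • (gen (x, κ) * gen (x, !κ)) := fun x p q r t => by
    simp only [cell_add, cell_smul, cell_mul, cell_one]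
    rfl
  rw [hexp, hexp]
  change ∀ m, Commute _ (majPair (gen (s 0, κ)) (gen (s 1, κ)) m) at hcomm
  change ∀ m n, majPair (gen (s 0, κ)) (gen (s 1, κ)) (m * n) =
    majPair (gen (s 0, κ)) (gen (s 1, κ)) m * majPair (gen (s 0, κ)) (gen (s 1, κ)) n at hmul
  change gen (s 0, !κ) * gen (s 1, !κ) * _ = _ at hpair
  change gen (s 0, !κ) * gen (s 1, κ) = -(gen (s 1, κ) * gen (s 0, !κ)) at a1
  have hz0 := hzero 0
  have hz1 := hzero 1
  change _ * gen (s 0, !κ) * _ = 0 at hz0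
  change _ * gen (s 1, !κ) * _ = 0 at hz1
  obtain ⟨P, hPdef⟩ : ∃ P, P = pairProj ν κ (pairGen s) := ⟨_, rfl⟩
  obtain ⟨φ, hφ⟩ : ∃ φ, φ = majPair (gen (s 0, κ)) (gen (s 1, κ)) := ⟨_, rfl⟩
  obtain ⟨g0, hg0⟩ : ∃ x, x = gen (s 0, κ) := ⟨_, rfl⟩
  obtain ⟨g1, hg1⟩ : ∃ x, x = gen (s 1, κ) := ⟨_, rfl⟩
  obtain ⟨h0, hh0⟩ : ∃ x, x = gen (s 0, !κ) := ⟨_, rfl⟩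
  obtain ⟨h1', hh1⟩ : ∃ x, x = gen (s 1, !κ) := ⟨_, rfl⟩
  rw [← hφ] at hX hY h1 hcomm hmul ⊢
  rw [← hPdef] at hP hcomm hpair hz0 hz1 ⊢
  rw [← hg0] at hX ⊢
  rw [← hg1] at hY a1 ⊢
  rw [← hh0] at hpair a1 hz0 ⊢
  rw [← hh1] at hpair hz1 ⊢
  refine ⟨(p • 1 + q • majX) * (p' • 1 + q' • majY) -
    ν • ((r • 1 + t • majX) * (r' • 1 - t' • majY)), ?_⟩
  have a2 : ∀ x, h0 * (g1 * x) = -(g1 * (h0 * x)) := fun x => by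
    rw [← mul_assoc, a1, neg_mul, mul_assoc]
  have hz : (p • 1 + q • g0 + r • h0 + t • (g0 * h0)) * (p' • 1 + q' • g1 + r' • h1' +
      t' • (g1 * h1')) = φ ((p • 1 + q • majX) * (p' • 1 + q' • majY)) +
      φ ((p • 1 + q • majX) * (r' • 1 + t' • majY)) * h1' +
      φ ((r • 1 + t • majX) * (p' • 1 - q' • majY)) * h0 +
      φ ((r • 1 + t • majX) * (r' • 1 - t' • majY)) * (h0 * h1') := by
    simp only [hmul, map_add, map_sub, map_smul, hX, hY, h1, mul_add, add_mul, mul_sub, sub_mul,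
      mul_smul_comm, smul_mul_assoc, one_mul, mul_one, mul_assoc, a1, a2, mul_neg]
    module
  have hleft : ∀ w x, P * (φ w * x) * P = φ w * (P * x * P) := fun w x => by
    rw [← mul_assoc P, (hcomm w).eq]
    simp only [mul_assoc]
  rw [hz, mul_add, mul_add, mul_add, add_mul, add_mul, add_mul, hleft, hleft, hleft, hz0, hz1,
    (hcomm _).eq, mul_assoc, hP, mul_assoc P, hpair, mul_smul_comm, hP, map_sub, map_smul, sub_mul]
  simp only [mul_zero, add_zero, mul_smul_comm, smul_mul_assoc, neg_smul, mul_neg]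
  exact (sub_eq_add_neg _ _).symm

theorem isTileIsometry_pairEmb {ν : ℂ} (hν : ν * ν = -1) (hν' : star ν = -ν) (κ : Bool) :
    IsTileIsometry (pairEmb ν κ) := by
  have hinj : Function.Injective (tileSite 2) := fun i j h => by
    simpa [tileSite, Fin.ext_iff] using h
  have hc := isClifford_pairGen hinj
  have hp : ∀ m, (pairEmb ν κ m).place (tileSite 2) =
    majPair (pairGen (tileSite 2) (0, κ)) (pairGen (tileSite 2) (1, κ)) m *
      pairProj ν κ (pairGen (tileSite 2)) := place_pairEmb ν κ hinj
  have hstar : ∀ i, star (pairGen (tileSite 2) i) = pairGen (tileSite 2) i := fun _ => star_gen _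
  have hanti := hc.anti (1, κ) (0, κ) (by simp)
  have hmul := majPair_mul (hc.sq (0, κ)) (hc.sq (1, κ)) hanti
  constructor
  · intro a b
    rw [hp, hp, hp, hmul, mul_assoc, mul_assoc, ← mul_assoc (pairProj _ _ _),
      (commute_pairProj_majPair hc b).eq, mul_assoc, pairProj_mul_self hν hc]
  · intro a
    rw [hp, hp, star_mul, star_pairProj hν' hc hstar, majPair_star (hstar _) (hstar _) hanti,
      ← majPair_star (hstar _) (hstar _) hanti, (commute_pairProj_majPair hc _).eq]
  · exact fun p a h => isHomog_pairEmb ν κ h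
  · intro a h
    rw [hp] at h
    exact majPair_mul_pairProj_injective hc h
  · intro d
    obtain ⟨P, hP⟩ : ∃ P, P = pairProj ν κ (pairGen (tileSite 2)) := ⟨_, rfl⟩
    have hone : (pairEmb ν κ 1).place (tileSite 2) = P := by
      rw [hp, majPair_one, one_mul, hP]
    rw [hone]
    let S : Submodule ℂ (LocOp fermion (Fin 2)) :=
      { carrier := {d | ∃ a, P * d.place (tileSite 2) * P = (pairEmb ν κ a).place (tileSite 2)}
        add_mem' := by
          rintro d d' ⟨a, ha⟩ ⟨a', ha'⟩
          refine ⟨a + a', ?_⟩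
          have h := map_add (placeLin fermion (tileSite 2))
          simp only [placeLin_apply] at h
          rw [map_add, h, h, mul_add, add_mul, ha, ha']
        zero_mem' := by
          refine ⟨0, ?_⟩
          have h := map_zero (placeLin fermion (tileSite 2))
          rw [placeLin_apply] at h
          rw [map_zero, h, mul_zero, zero_mul]
        smul_mem' := by
          rintro r d ⟨a, ha⟩
          refine ⟨r • a, ?_⟩
          have h := map_smul (placeLin fermion (tileSite 2))
          simp only [placeLin_apply] at h
          rw [map_smul, h, h, mul_smul_comm, smul_mul_assoc, ha] }
    change d ∈ S
    rw [Matrix.matrix_eq_sum_single d]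
    refine S.sum_mem fun σ _ => S.sum_mem fun τ _ => ?_
    rw [← mul_one (d σ τ), ← smul_eq_mul, ← Matrix.smul_single]
    refine S.smul_mem _ ?_
    obtain ⟨a, ha⟩ := exists_pairProj_mul_mul hν κ hinj (Matrix.single (σ 0) (τ 0) 1)
      (Matrix.single (σ 1) (τ 1) 1)
    refine ⟨a, ?_⟩
    rw [place_single, boxProd_fin_two, place_pairEmb ν κ hinj, hP, ha]

end PairingIsometry

/-! ### Renormalisation to a shift -/

section PairingRenormalisation

theorem Commute.pairProj_right {A : Type*} [Ring A] [Algebra ℂ A] {ν : ℂ} {κ : Bool}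
    {c : Fin 2 × Bool → A} {z : A} (h : ∀ i, Commute z (c (i, !κ))) : Commute z (pairProj ν κ c) :=
  ((Commute.one_right z).add_right (((h 0).mul_right (h 1)).smul_right ν)).smul_right _

/-- The displacement of the generators of type `κ`: `X` moves to the right, `Y` moves to the left. -/
def drift (κ : Bool) : ℤ := if κ then 1 else -1

section Ring

variable {m : ℕ} {ν : ℂ} {κ : Bool}

/-- The pairing projection of the `t`-th tile of a ring. -/
noncomputable def ringPairProj (m : ℕ) (ν : ℂ) (κ : Bool) (t : Fin m) :
    QuasiLocal fermion (Fin (m * 2)) := pairProj ν κ (pairGen (ringTileSite m 2 t))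

theorem commute_gen_ringPairProj (x : Fin (m * 2)) (t : Fin m) :
    Commute (gen (x, κ)) (ringPairProj m ν κ t) :=
  commute_pairProj fun _ => isClifford_gen.anti _ _ (by simp)

theorem commute_ringPairProj (t t' : Fin m) :
    Commute (ringPairProj m ν κ t) (ringPairProj m ν κ t') := by
  by_cases h : t = t'
  · rw [h]
  refine Commute.pairProj_right fun i => Commute.symm (commute_pairProj fun j => ?_)
  refine isClifford_gen.anti _ _ fun h' => h ?_
  have h1 := ringTileSite_injective m 2 (a₁ := (t', i)) (a₂ := (t, j)) (Prod.ext_iff.mp h').1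
  exact (Prod.ext_iff.mp h1).1.symm

/-- The product of the pairing projections of all tiles is invariant under automorphisms which permute
them. -/
theorem map_prod_ringPairProj {B : Type*} [FunLike B (QuasiLocal fermion (Fin (m * 2)))
      (QuasiLocal fermion (Fin (m * 2)))]
    [MonoidHomClass B (QuasiLocal fermion (Fin (m * 2))) (QuasiLocal fermion (Fin (m * 2)))]
    (W : B) (π : Equiv.Perm (Fin m)) (h : ∀ t, W (ringPairProj m ν κ t) = ringPairProj m ν κ (π t)) :
    W ((Finset.univ.sort (fun a b : Fin m => a ≤ b)).map (ringPairProj m ν κ)).prod =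
      ((Finset.univ.sort (fun a b : Fin m => a ≤ b)).map (ringPairProj m ν κ)).prod := by
  obtain ⟨l, hl⟩ : ∃ l, l = Finset.univ.sort (fun a b : Fin m => a ≤ b) := ⟨_, rfl⟩
  have hnodup : l.Nodup := by rw [hl]; exact Finset.sort_nodup _ _
  have hmem : ∀ t, t ∈ l := by simp [hl]
  have hperm : (l.map π).Perm l := by
    rw [List.perm_ext_iff_of_nodup (hnodup.map π.injective) hnodup]
    intro t
    simp only [hmem, iff_true, List.mem_map, true_and]
    exact ⟨π.symm t, π.apply_symm_apply t⟩
  rw [← hl, map_list_prod, List.map_map,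
    show W ∘ ringPairProj m ν κ = ringPairProj m ν κ ∘ π from funext h, ← List.map_map]
  refine (hperm.map _).prod_eq' ?_
  rw [List.pairwise_map]
  exact List.pairwise_of_forall fun t t' => commute_ringPairProj t t'

/-- The embedding of a ring of coarse-grained modes, before cutting down by the pairing projections. -/
theorem exists_coarse_algHom (m : ℕ) (ν : ℂ) (κ : Bool) :
    ∃ φ : QuasiLocal fermion (Fin m) →ₐ[ℂ] QuasiLocal fermion (Fin (m * 2)),
      (∀ t β, φ (gen (t, β)) = gen (ringTileSite m 2 t (if β then 0 else 1), κ)) ∧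
      ∀ M : Fin m → CellAlg fermion, φ (boxProd id M) *
        ((Finset.univ.sort (fun a b : Fin m => a ≤ b)).map (ringPairProj m ν κ)).prod =
          ((Finset.univ.sort (fun a b : Fin m => a ≤ b)).map fun t =>
            (pairEmb ν κ (M t)).place (ringTileSite m 2 t)).prod := by
  let δ : Fin m × Bool → QuasiLocal fermion (Fin (m * 2)) := fun k =>
    gen (ringTileSite m 2 k.1 (if k.2 then 0 else 1), κ)
  have hδ : IsClifford δ := ⟨fun _ => isClifford_gen.sq _, fun k l hkl =>
    isClifford_gen.anti _ _ fun h => hkl ?_⟩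
  swap
  · have h1 := ringTileSite_injective m 2 (a₁ := (k.1, if k.2 then 0 else 1))
      (a₂ := (l.1, if l.2 then 0 else 1)) (Prod.ext_iff.mp h).1
    obtain ⟨h2, h3⟩ := Prod.ext_iff.mp h1
    refine Prod.ext h2 ?_
    revert h3
    cases k.2 <;> cases l.2 <;> simp
  obtain ⟨φ, hφ⟩ := exists_algHom_of_isClifford hδ
  refine ⟨φ, fun t β => hφ _, fun M => ?_⟩
  have hcell : ∀ t, φ (cell t (M t)) = majPair (δ (t, true)) (δ (t, false)) (M t) := fun t => by
    rw [cell_eq_majPair_gen, map_majPair, hφ, hφ]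
  have hplace : ∀ t, (pairEmb ν κ (M t)).place (ringTileSite m 2 t) =
      majPair (δ (t, true)) (δ (t, false)) (M t) * ringPairProj m ν κ t := fun t =>
    place_pairEmb ν κ (fun i j h => (Prod.ext_iff.mp
      (ringTileSite_injective m 2 (a₁ := (t, i)) (a₂ := (t, j)) h)).2) _
  have hmap : φ (boxProd id M) = ((Finset.univ.sort (fun a b : Fin m => a ≤ b)).map fun t =>
      majPair (δ (t, true)) (δ (t, false)) (M t)).prod := by
    rw [boxProd, map_list_prod, List.map_map]
    exact congrArg List.prod (List.map_congr_left fun t _ => hcell t)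
  rw [hmap, ← List.prod_map_mul_of_commute]
  · exact congrArg List.prod (List.map_congr_left fun t _ => (hplace t).symm)
  · intro t _ t' _
    exact commute_majPair (commute_gen_ringPairProj _ _).symm (commute_gen_ringPairProj _ _).symm _

end Ring

/-- An automaton which moves the generators `X` to the right and the generators `Y` to the left is
renormalised to a shift by the pairing of the generators of either type. -/
theorem isRenormalisation_pairProj {T : FCA fermion} (hscheme : T.scheme = {-1, 0, 1}) {a b : ℂ}
    (ha : a = 1 ∨ a = -1) (hb : b = 1 ∨ b = -1)
    (hX : ∀ x, T.aut (gen (x, true)) = a • gen (x + 1, true))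
    (hY : ∀ x, T.aut (gen (x, false)) = b • gen (x + -1, false)) {ν : ℂ} (hν : ν * ν = -1)
    (hν' : star ν = -ν) (κ : Bool) :
    IsRenormalisation T (shiftFCA fermion (drift κ)) 2
      (pairProj ν κ (pairGen (tileSite 2))) := by
  have hinj : Function.Injective (tileSite 2) := fun i j h => by
    simpa [tileSite, Fin.ext_iff] using h
  refine ⟨pairEmb ν κ, isTileIsometry_pairEmb hν hν' κ, ?_, fun m _ _ _ => ?_⟩
  · rw [place_pairEmb ν κ hinj, majPair_one, one_mul]
  obtain ⟨Tw, hTw, hact⟩ := exists_isWrapping_of_signed (T := T) (z := 1) (w := -1) (by norm_num)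
    (by rw [hscheme]; decide) (by rw [hscheme]; decide) ha hb hX hY (m * 2)
  obtain ⟨Sw, hSw, hshift⟩ := exists_isWrapping_shiftFCA m (drift κ)
  have hW : ∀ x κ', Tw (Tw (gen (ringSite (m * 2) x, κ'))) =
      gen (ringSite (m * 2) (x + 2 * drift κ'), κ') := by
    intro x κ'
    have haa : a * a = 1 := by rcases ha with rfl | rfl <;> norm_num
    have hbb : b * b = 1 := by rcases hb with rfl | rfl <;> norm_num
    cases κ'
    · rw [(hact x).2, map_smul, (hact _).2, smul_smul, hbb, one_smul, add_assoc]
      rfl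
    · rw [(hact x).1, map_smul, (hact _).1, smul_smul, haa, one_smul, add_assoc]
      rfl
  let W : QuasiLocal fermion (Fin (m * 2)) →ₐ[ℂ] QuasiLocal fermion (Fin (m * 2)) :=
    (AlgHomClass.toAlgHom Tw).comp (AlgHomClass.toAlgHom Tw)
  change ∀ x κ', W _ = _ at hW
  have hWtile : ∀ (t : ℤ) (i : Fin 2) κ', W (gen (ringTileSite m 2 (ringSite m t) i, κ')) =
      gen (ringTileSite m 2 (ringSite m (t + drift κ')) i, κ') := by
    intro t i κ'
    rw [ringTileSite_ringSite, ringTileSite_ringSite, hW]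
    congr 3
    push_cast
    ring
  obtain ⟨φ, hφ, hE⟩ := exists_coarse_algHom m ν κ
  obtain ⟨Q, hQ⟩ : ∃ Q, Q = ((Finset.univ.sort (fun a b : Fin m => a ≤ b)).map
    (ringPairProj m ν κ)).prod := ⟨_, rfl⟩
  have hWQ : W Q = Q := by
    rw [hQ]
    refine map_prod_ringPairProj W (ringShift m (drift !κ)) fun t => ?_
    obtain ⟨x, rfl⟩ : ∃ x, t = ringSite m x := ⟨t.val, (ringSite_val m t).symm⟩
    rw [ringShift_ringSite]
    simp only [ringPairProj, pairProj, pairGen, map_smul, map_add, map_one, map_mul, hWtile]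
  have hinter : W.comp φ = φ.comp (AlgHomClass.toAlgHom Sw) := by
    refine algHom_ext_gen fun k => ?_
    obtain ⟨t, β⟩ := k
    obtain ⟨x, rfl⟩ : ∃ x, t = ringSite m x := ⟨t.val, (ringSite_val m t).symm⟩
    change W (φ _) = φ (Sw _)
    rw [hφ, hshift, hφ]
    exact hWtile _ _ _
  refine ⟨Tw, Sw, LinearMap.mulRight ℂ Q ∘ₗ φ.toLinearMap, hTw, hSw, fun M => ?_, fun z => ?_⟩
  · rw [hQ]
    exact hE M
  · change W (φ z * Q) = φ (Sw z) * Q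
    rw [map_mul, hWQ]
    congr 1
    exact DFunLike.congr_fun hinter z

end PairingRenormalisation

/-! ### Special gates -/

section SpecialUnitaries

theorem unitsInt_sq (u : ℤˣ) : ((u : ℤ) : ℂ) * ((u : ℤ) : ℂ) = 1 := by
  rcases Int.units_eq_one_or u with rfl | rfl <;> norm_num

theorem cell_majZ {G : Type} [LinearOrder G] (x : G) :
    cell x majZ = -Complex.I • (gen (x, true) * gen (x, false)) := by
  have h : majZ = -Complex.I • (majX * majY) := by
    rw [majX_mul_majY, smul_smul, neg_mul, Complex.I_mul_I, neg_neg, one_smul]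
  rw [h, cell_smul, cell_mul, cell_majX, cell_majY]

theorem projZ_eq (u : ℤˣ) (x : ℤ) :
    projZ u x = (1 / 2 : ℂ) • (1 + ((u : ℤ) : ℂ) • -Complex.I • (gen (x, true) * gen (x, false))) := by
  rw [projZ, cell_smul, cell_add, cell_one, cell_smul, cell_majZ]

theorem conj_add_one_of_anticomm {A : Type*} [Ring A] [Algebra ℂ A] {r : ℂ} (hr : r * r = 1 / 2)
    {w a : A} (hw : w * w = -1) (h : w * a = -(a * w)) :
    r • (1 + w) * a * (r • (1 - w)) = w * a := by
  have h1 := conj_one_add_of_anticomm hr (w := -w) (a := a) (by rw [neg_mul_neg, hw])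
    (by rw [neg_mul, h, mul_neg])
  rw [sub_neg_eq_add, ← sub_eq_add_neg] at h1
  rw [h1, mul_neg, h]

/-- Undoing the Majorana swap of the tile turns a local parity into a pairing of generators of the two
modes. -/
theorem unswap_projZ (u : ℤˣ) :
    unswap (projZ u 0) =
      pairProj (-(((u : ℤ) : ℂ) * Complex.I)) true (pairGen (tileSite 2)) ∧
    unswap (projZ u 1) = pairProj (((u : ℤ) : ℂ) * Complex.I) false (pairGen (tileSite 2)) := by
  obtain ⟨x0, hx0⟩ : ∃ x : QuasiLocal fermion ℤ, x = gen (0, true) := ⟨_, rfl⟩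
  obtain ⟨y0, hy0⟩ : ∃ x : QuasiLocal fermion ℤ, x = gen (0, false) := ⟨_, rfl⟩
  obtain ⟨x1, hx1⟩ : ∃ x : QuasiLocal fermion ℤ, x = gen (1, true) := ⟨_, rfl⟩
  obtain ⟨y1, hy1⟩ : ∃ x : QuasiLocal fermion ℤ, x = gen (1, false) := ⟨_, rfl⟩
  have hw : swapGen 0 = x0 * y1 := by rw [hx0, hy1]; rfl
  have hww := swapGen_sq 0
  have s0 : x0 * x0 = 1 := by rw [hx0]; exact isClifford_gen.sq _
  have s1 : y1 * y1 = 1 := by rw [hy1]; exact isClifford_gen.sq _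
  have b1 : y1 * x0 = -(x0 * y1) := by rw [hx0, hy1]; exact isClifford_gen.anti _ _ (by simp)
  have b2 : y1 * y0 = -(y0 * y1) := by rw [hy0, hy1]; exact isClifford_gen.anti _ _ (by simp)
  have b3 : y1 * x1 = -(x1 * y1) := by rw [hx1, hy1]; exact isClifford_gen.anti _ _ (by simp)
  have b4 : y0 * x0 = -(x0 * y0) := by rw [hx0, hy0]; exact isClifford_gen.anti _ _ (by simp)
  have b5 : x1 * x0 = -(x0 * x1) := by rw [hx0, hx1]; exact isClifford_gen.anti _ _ (by simp)
  have l0 : ∀ a, x0 * (x0 * a) = a := fun a => by rw [← mul_assoc, s0, one_mul]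
  have d1 : ∀ a, y1 * (x0 * a) = -(x0 * (y1 * a)) := fun a => by
    rw [← mul_assoc, b1, neg_mul, mul_assoc]
  have d2 : ∀ a, y0 * (x0 * a) = -(x0 * (y0 * a)) := fun a => by
    rw [← mul_assoc, b4, neg_mul, mul_assoc]
  have d3 : ∀ a, y1 * (x1 * a) = -(x1 * (y1 * a)) := fun a => by
    rw [← mul_assoc, b3, neg_mul, mul_assoc]
  have e0 : swapGen 0 * (x0 * y0) = y0 * y1 ∧
      swapGen 0 * (x0 * y0) = -(x0 * y0 * swapGen 0) := by
    rw [hw]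
    constructor <;> simp only [mul_assoc, d1, d2, b2, mul_neg, neg_neg, l0]
  have e1 : swapGen 0 * (x1 * y1) = -(x0 * x1) ∧
      swapGen 0 * (x1 * y1) = -(x1 * y1 * swapGen 0) := by
    rw [hw]
    constructor <;> simp only [mul_assoc, d1, d3, s1, mul_neg, neg_neg, mul_one]
    exact b5.symm
  have hone : majSwap 0 * 1 * star (majSwap 0) = 1 := by
    have h := conj_one_add_of_comm (A := QuasiLocal fermion ℤ) invSqrtTwo_mul_self
      (w := -swapGen 0) (a := 1) (by rw [neg_mul_neg, hww]) (by rw [mul_one, one_mul])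
    rwa [sub_neg_eq_add, ← sub_eq_add_neg, ← majSwap_eq, ← star_majSwap] at h
  have hconj : ∀ x, swapGen 0 * (gen (x, true) * gen (x, false)) =
      -(gen (x, true) * gen (x, false) * swapGen 0) → unswap (projZ u x) = (1 / 2 : ℂ) •
        (1 + ((u : ℤ) : ℂ) • -Complex.I • (swapGen 0 * (gen (x, true) * gen (x, false)))) := by
    intro x hx
    have h := conj_add_one_of_anticomm invSqrtTwo_mul_self hww hx
    rw [← majSwap_eq, ← star_majSwap] at h
    rw [unswap, projZ_eq, mul_smul_comm, smul_mul_assoc, mul_add, add_mul, hone, mul_smul_comm,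
      mul_smul_comm, smul_mul_assoc, smul_mul_assoc, h]
  constructor
  · rw [hconj 0 (by rw [← hx0, ← hy0]; exact e0.2), ← hx0, ← hy0, e0.1, hy0, hy1, smul_smul, mul_neg]
    rfl
  · rw [hconj 1 (by rw [← hx1, ← hy1]; exact e1.2), ← hx1, ← hy1, e1.1, smul_neg, neg_smul, neg_neg,
      hx0, hx1, smul_smul]
    rfl

/-- Two steps of the automaton move `X` and `Y` in opposite directions. -/
theorem not_isTrivialAfter {T : FCA fermion} {a b : ℂ} (ha : a = 1 ∨ a = -1) (hb : b = 1 ∨ b = -1)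
    (hX : ∀ x, T.aut (gen (x, true)) = a • gen (x + 1, true))
    (hY : ∀ x, T.aut (gen (x, false)) = b • gen (x + -1, false)) : ¬ IsTrivialAfter T 2 := by
  rintro ⟨z, hz⟩
  have haa : a * a = 1 := by rcases ha with rfl | rfl <;> norm_num
  have hbb : b * b = 1 := by rcases hb with rfl | rfl <;> norm_num
  -- an element of a cell does not belong to another cell
  have key : ∀ (y : ℤ) (κ : Bool) (m : CellAlg fermion), gen (y, κ) = cell z m → y = z := by
    intro y κ m h
    by_contra hne
    have h1 : Commute (gen (y, κ) * gen (y, !κ)) (cell z m) := by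
      rw [cell_eq_majPair_gen]
      exact commute_majPair (isClifford_gen.pair_comm (by simp [hne]) (by simp [hne]))
        (isClifford_gen.pair_comm (by simp [hne]) (by simp [hne]))
        m
    rw [← h] at h1
    have h2 := isClifford_gen.pair_mul_left (k := (y, κ)) (l := (y, !κ)) (by simp)
    rw [h1.eq, isClifford_gen.mul_mul_left] at h2
    have h3 := isClifford_gen.sq (y, !κ)
    have h4 : (2 : ℂ) • gen (y, !κ) = 0 := by
      rw [two_smul]
      exact add_eq_zero_iff_eq_neg.mpr h2
    rw [(smul_eq_zero.mp h4).resolve_left two_ne_zero, zero_mul] at h3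
    exact zero_ne_one h3
  obtain ⟨m, hm⟩ := hz 0 majX
  obtain ⟨m', hm'⟩ := hz 0 majY
  change T.aut (T.aut (gen (0, true))) = _ at hm
  change T.aut (T.aut (gen (0, false))) = _ at hm'
  rw [hX, map_smul, hX, smul_smul, haa, one_smul, zero_add z] at hm
  rw [hY, map_smul, hY, smul_smul, hbb, one_smul, zero_add z] at hm'
  have h1 := key _ _ _ hm
  have h2 := key _ _ _ hm'
  omega

/-- A special cell-wise gate exchanges the two Majorana generators up to signs, so that the Forking
automaton moves the generators `X` to the right and the generators `Y` to the left. -/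
theorem IsForking.aut_gen_of_special {U : CellAlg fermion} {T : FCA fermion} (hT : IsForking U T)
    (hU : U ∈ unitary (CellAlg fermion)) (hpar : ∃ p : ZMod 2, IsHomog fermion p U)
    (h : IsSpecialUnitary U) : ∃ a b : ℂ, (a = 1 ∨ a = -1) ∧ (b = 1 ∨ b = -1) ∧
      (∀ x, T.aut (gen (x, true)) = a • gen (x + 1, true)) ∧
      ∀ x, T.aut (gen (x, false)) = b • gen (x + -1, false) := by
  obtain ⟨a, b, s, hab, hs, hX, hY, hiff⟩ := exists_orthogonal_action hU hpar
  rw [hiff.mp h, zero_pow two_ne_zero, zero_add] at hab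
  rw [hiff.mp h, Complex.ofReal_zero, zero_smul, zero_add] at hX
  rw [hiff.mp h, Complex.ofReal_zero, zero_smul, sub_zero, smul_smul] at hY
  have hsb : (s * b) ^ 2 = 1 := by rw [mul_pow, hs, hab, one_mul]
  refine ⟨s * b, -b, ?_, ?_, fun x => ?_, fun x => ?_⟩
  · rcases sq_eq_one_iff.mp hsb with h | h
    · left; exact_mod_cast h
    · right; exact_mod_cast h
  · rcases sq_eq_one_iff.mp hab with rfl | rfl <;> simp
  · rw [(hT.aut_gen x).1, hY, cell_smul, cell_majX]
  · rw [(hT.aut_gen x).2, hX, cell_smul, cell_majY, neg_smul, sub_eq_add_neg]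

end SpecialUnitaries

theorem mainTheorem3 (U : CellAlg fermion) (hU : U ∈ unitary (CellAlg fermion))
    (hpar : ∃ p : ZMod 2, IsHomog fermion p U) (T : FCA fermion) (hT : IsForking U T) :
    (AdmitsNontrivialRenormalisation T 2 ↔ IsSpecialUnitary U) ∧
    (IsSpecialUnitary U → ∀ u : ℤˣ,
      (∃ S : FCA fermion, IsShift S 1 ∧ IsRenormalisation T S 2 (unswap (projZ u 0))) ∧
      (∃ S : FCA fermion, IsShift S (-1) ∧ IsRenormalisation T S 2 (unswap (projZ u 1)))) := by
  have hν : ∀ u : ℤˣ, ((u : ℤ) : ℂ) * Complex.I * (((u : ℤ) : ℂ) * Complex.I) = -1 := fun u => by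
    rw [mul_mul_mul_comm, unitsInt_sq, Complex.I_mul_I, one_mul]
  have hν' : ∀ u : ℤˣ, star (((u : ℤ) : ℂ) * Complex.I) = -(((u : ℤ) : ℂ) * Complex.I) := fun u => by
    simp
  have hren : IsSpecialUnitary U → ∀ u : ℤˣ,
      IsRenormalisation T (shiftFCA fermion 1) 2 (unswap (projZ u 0)) ∧
      IsRenormalisation T (shiftFCA fermion (-1)) 2 (unswap (projZ u 1)) := by
    intro h u
    obtain ⟨a, b, ha, hb, hX, hY⟩ := hT.aut_gen_of_special hU hpar h
    rw [(unswap_projZ u).1, (unswap_projZ u).2]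
    exact ⟨isRenormalisation_pairProj hT.1 ha hb hX hY (by rw [neg_mul_neg, hν])
        (by rw [star_neg, hν']) true,
      isRenormalisation_pairProj hT.1 ha hb hX hY (hν u) (hν' u) false⟩
  refine ⟨⟨hT.isSpecialUnitary_of_admits hU hpar, fun h => ?_⟩, fun h u =>
    ⟨⟨_, isShift_shiftFCA _ _, (hren h u).1⟩, ⟨_, isShift_shiftFCA _ _, (hren h u).2⟩⟩⟩
  obtain ⟨a, b, ha, hb, hX, hY⟩ := hT.aut_gen_of_special hU hpar h
  refine ⟨not_isTrivialAfter ha hb hX hY, fermion, _, _, le_rfl, ?_, (hren h 1).1⟩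
  rw [(unswap_projZ 1).1]
  exact pairProj_ne_one (by rw [neg_mul_neg, hν]) (isClifford_pairGen fun i j h => by
    simpa [tileSite, Fin.ext_iff] using h)
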